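/- **Setting.** Identify the Riemann sphere $\hat{\mathbb C}=\mathbb C\cup\{\infty\}$, with the metric $2|dz|/(1+|z|^2)$, with the unit sphere, and let $d$ be the spherical distance. A closed disk is a set $\{w: d(z,w)\le r\}$ with center $z\in\hat{\mathbb C}$ and radius $r\in(0,\pi)$. Let $T$ be a triangulation of the sphere (a finite simplicial complex that is a connected closed surface of Euler characteristic $2$) with vertex set $V$ and edge set $E$, where $|V|>4$. A circle pattern $\mathcal P=\{D(v)\}_{v\in V}$ is a family of closed disks on $\hat{\mathbb C}$. Its contact graph has vertex set $V$, and distinct $u,w$ are joined exactly when $D(u)\cap D(w)\ne\emptyset$. It is *irreducible* if $\bigcup_{v\in A}D(v)\subsetneq\hat{\mathbb C}$ for every $A\subsetneq V$. If the contact graph is the 1-skeleton of $T$, the overlap angle of $\mathcal P$ at an edge $e=[u,w]$ is $\Theta(e)=\arccos I(e)$, where $$I(e)=\frac{\cos r_u\cos r_w-\cos d(z_u,z_w)}{\sin r_u\sin r_w}$$ and $z_v,r_v$ denote the center and radius of $D(v)$. (Under the hypotheses below $-1<I(e)<1$.) Let $W$ be the set of functions $\Theta:E\to(0,\pi)$,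 with the topology of pointwise convergence, such that: - **(c1)** If $e_1,e_2$ form a simple arc with non-adjacent endpoints, then $\Theta(e_1)+\Theta(e_2)\le\pi$; and if $T$ is the boundary of a double tetrahedron (two tetrahedra glued along a face), at least one of these inequalities is strict. - **(c2)** If $e_1,e_2,e_3$ form the boundary of a triangle of $T$, then $\Theta(e_1)+\Theta(e_2)+\Theta(e_3)>\pi$, $\Theta(e_1)+\Theta(e_2)<\Theta(e_3)+\pi$, $\Theta(e_2)+\Theta(e_3)<\Theta(e_1)+\pi$ and $\Theta(e_3)+\Theta(e_1)<\Theta(e_2)+\pi$. - **(c3)** If $e_1,e_2,e_3$ form a simple closed curve separating the vertices of $T$, then $\sum_{\mu=1}^3\Theta(e_\mu)<\pi$. - **(c4)** If $e_1,e_2,e_3,e_4$ form a simple closed curve separating the vertices of $T$, then $\sum_{\mu=1}^4\Theta(e_\mu)<2\pi$. Here a curve separates the vertices of $T$ if two vertices off the curve lie in different components of its complement in the sphere. **Theorem.** Let $(\mathcal P_n)$ be a sequence of irreducible circle patterns on $\hat{\mathbb C}$, each with contact graph the 1-skeleton of $T$, and suppose that their overlap angle functions $\Theta_n$ all lie in one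 compact subset of $W$. Then there are a subsequence $(\mathcal P_{n_k})$, linear or anti-linear fractional maps $f_k$ of $\hat{\mathbb C}$ (that is, $z\mapsto\frac{az+b}{cz+d}$ or $z\mapsto\frac{a\bar z+b}{c\bar z+d}$ with $ad-bc\ne0$), and an irreducible circle pattern $\mathcal P_\infty=\{D_\infty(v)\}_{v\in V}$ with contact graph the 1-skeleton of $T$, such that $f_k(\mathcal P_{n_k})\to\mathcal P_\infty$; that is, for each $v\in V$ the centers and radii of the disks $f_k(D_{n_k}(v))$ converge to the center and radius of $D_\infty(v)$. -/

import Mathlib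

open Filter Topology

/-! ### Triangulations of the sphere -/

/-- The edges (two-element simplices) of the simplicial complex spanned by a set of triangles. -/
def complexEdges {V : Type*} [DecidableEq V] (F : Finset (Finset V)) : Finset (Finset V) :=
  F.biUnion (fun t => t.powersetCard 2)

/-- The 1-skeleton of the simplicial complex spanned by a set of triangles. -/
def complexSkeleton {V : Type*} (F : Finset (Finset V)) : SimpleGraph V where
  Adj a b := a ≠ b ∧ ∃ t ∈ F, a ∈ t ∧ b ∈ t
  symm := ⟨fun _ _ h => ⟨h.1.symm, h.2.imp fun _ ht => ⟨ht.1, ht.2.2, ht.2.1⟩⟩⟩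
  loopless := ⟨fun _ h => h.1 rfl⟩

/-- The link of the vertex `v`, as a graph: `a` and `b` are joined when `v, a, b` span
a triangle. -/
def linkGraph {V : Type*} [DecidableEq V] (F : Finset (Finset V)) (v : V) : SimpleGraph V where
  Adj a b := a ≠ v ∧ b ≠ v ∧ a ≠ b ∧ ({v, a, b} : Finset V) ∈ F
  symm := ⟨fun a b h => ⟨h.2.1, h.1, h.2.2.1.symm, by rw [Finset.pair_comm b a]; exact h.2.2.2⟩⟩
  loopless := ⟨fun _ h => h.2.2.1 rfl⟩

/-- A (simplicial) triangulation of the 2-sphere with vertex set `V`: a finite, pure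
two-dimensional simplicial complex, recorded by its triangles, which is a connected closed
surface (each edge lies in exactly two triangles, each vertex link is connected, hence a cycle)
of Euler characteristic `2`. -/
structure SphereTriangulation (V : Type*) [Fintype V] [DecidableEq V] where
  triangles : Finset (Finset V)
  card_triangle : ∀ t ∈ triangles, t.card = 3
  vertex_mem : ∀ v : V, ∃ t ∈ triangles, v ∈ t
  edge_mem_two : ∀ e ∈ complexEdges triangles, (triangles.filter (fun t => e ⊆ t)).card = 2
  link_connected : ∀ v a b : V, (complexSkeleton triangles).Adj v a →
    (complexSkeleton triangles).Adj v b → (linkGraph triangles v).Reachable a b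
  connected : (complexSkeleton triangles).Connected
  euler : (Fintype.card V : ℤ) - (complexEdges triangles).card + triangles.card = 2

namespace SphereTriangulation

variable {V : Type*} [Fintype V] [DecidableEq V] (T : SphereTriangulation V)

/-- The 1-skeleton of the triangulation. -/
def skeleton : SimpleGraph V := complexSkeleton T.triangles

/-- The simplices (vertices, edges and triangles) of the triangulation. -/
def simplices : Set (Finset V) := {s | s.Nonempty ∧ ∃ t ∈ T.triangles, s ⊆ t}

/-- The simplices contained in the curve formed by the edges in `es`: these edges and their
endpoints. -/
def curve (es : Finset (Finset V)) : Set (Finset V) := {s | s.Nonempty ∧ ∃ e ∈ es, s ⊆ e}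

/-- The incidence graph of the (open) simplices which make up the complement of a curve in the
sphere. Two of these open simplices lie in the same connected component of the complement if and
only if they can be joined by a path in this graph. -/
def complementGraph (es : Finset (Finset V)) : SimpleGraph (Finset V) where
  Adj s t := s ≠ t ∧ s ∈ T.simplices \ curve es ∧ t ∈ T.simplices \ curve es ∧ (s ⊆ t ∨ t ⊆ s)
  symm := ⟨fun _ _ h => ⟨h.1.symm, h.2.2.1, h.2.1, h.2.2.2.symm⟩⟩
  loopless := ⟨fun _ h => h.1 rfl⟩

/-- The curve formed by the edges in `es` separates the vertices of the triangulation: there are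
vertices off the curve in different connected components of its complement. -/
def Separates (es : Finset (Finset V)) : Prop :=
  ∃ u w : V, {u} ∉ curve es ∧ {w} ∉ curve es ∧ ¬ (T.complementGraph es).Reachable {u} {w}

/-- The triangulation is the boundary of a double tetrahedron: two tetrahedra `a x y z` and
`b x y z` glued along their common face `x y z`. -/
def IsDoubleTetrahedron : Prop :=
  ∃ a b x y z : V, [a, b, x, y, z].Nodup ∧
    T.triangles = {{a, x, y}, {a, y, z}, {a, z, x}, {b, x, y}, {b, y, z}, {b, z, x}}

variable {T}

/-- The edge between two adjacent vertices. -/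
def edge {a b : V} (h : T.skeleton.Adj a b) : T.skeleton.edgeSet := ⟨s(a, b), h⟩

variable (T)

/-- The first condition: the angle sum along a simple arc `a, b, c` of two edges with
non-adjacent endpoints is at most `π`, with at least one strict inequality for the boundary of a
double tetrahedron. -/
def CondOne (Θ : T.skeleton.edgeSet → ℝ) : Prop :=
  (∀ (a b c : V) (hab : T.skeleton.Adj a b) (hbc : T.skeleton.Adj b c),
      a ≠ c → ¬ T.skeleton.Adj a c → Θ (edge hab) + Θ (edge hbc) ≤ Real.pi) ∧
  (T.IsDoubleTetrahedron →
    ∃ (a b c : V) (hab : T.skeleton.Adj a b) (hbc : T.skeleton.Adj b c),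
      a ≠ c ∧ ¬ T.skeleton.Adj a c ∧ Θ (edge hab) + Θ (edge hbc) < Real.pi)

/-- The second condition, on the three edges of a triangle. -/
def CondTwo (Θ : T.skeleton.edgeSet → ℝ) : Prop :=
  ∀ (a b c : V) (hab : T.skeleton.Adj a b) (hbc : T.skeleton.Adj b c) (hca : T.skeleton.Adj c a),
    {a, b, c} ∈ T.triangles →
      Real.pi < Θ (edge hab) + Θ (edge hbc) + Θ (edge hca) ∧
      Θ (edge hab) + Θ (edge hbc) < Θ (edge hca) + Real.pi ∧
      Θ (edge hbc) + Θ (edge hca) < Θ (edge hab) + Real.pi ∧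
      Θ (edge hca) + Θ (edge hab) < Θ (edge hbc) + Real.pi

/-- The third condition, on separating simple closed curves of three edges. -/
def CondThree (Θ : T.skeleton.edgeSet → ℝ) : Prop :=
  ∀ (a b c : V) (hab : T.skeleton.Adj a b) (hbc : T.skeleton.Adj b c) (hca : T.skeleton.Adj c a),
    T.Separates {{a, b}, {b, c}, {c, a}} →
      Θ (edge hab) + Θ (edge hbc) + Θ (edge hca) < Real.pi

/-- The fourth condition, on separating simple closed curves of four edges. -/
def CondFour (Θ : T.skeleton.edgeSet → ℝ) : Prop :=
  ∀ (a b c d : V) (hab : T.skeleton.Adj a b) (hbc : T.skeleton.Adj b c)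
    (hcd : T.skeleton.Adj c d) (hda : T.skeleton.Adj d a), a ≠ c → b ≠ d →
    T.Separates {{a, b}, {b, c}, {c, d}, {d, a}} →
      Θ (edge hab) + Θ (edge hbc) + Θ (edge hcd) + Θ (edge hda) < 2 * Real.pi

/-- The set `W` of functions from the edges to `(0, π)` satisfying the four conditions. -/
def W : Set (T.skeleton.edgeSet → ℝ) :=
  {Θ | (∀ e, Θ e ∈ Set.Ioo 0 Real.pi) ∧
    T.CondOne Θ ∧ T.CondTwo Θ ∧ T.CondThree Θ ∧ T.CondFour Θ}

end SphereTriangulation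

/-! ### The Riemann sphere, its disks and its Möbius maps -/

/-- The inverse stereographic projection, from the Riemann sphere `ℂ ∪ {∞}` to the unit sphere
of Euclidean 3-space. -/
noncomputable def toUnitSphere : OnePoint ℂ → EuclideanSpace ℝ (Fin 3)
  | none => !₂[0, 0, 1]
  | some z => !₂[2 * z.re / (‖z‖ ^ 2 + 1), 2 * z.im / (‖z‖ ^ 2 + 1), (‖z‖ ^ 2 - 1) / (‖z‖ ^ 2 + 1)]

/-- The spherical distance on the Riemann sphere, that is, the distance of the Riemannian metric
`2 |dz| / (1 + |z|²)`: the angle between the corresponding unit vectors. -/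
noncomputable def sphericalDist (z w : OnePoint ℂ) : ℝ :=
  InnerProductGeometry.angle (toUnitSphere z) (toUnitSphere w)

/-- A closed disk on the Riemann sphere, given by its spherical center and radius. -/
structure SphericalDisk where
  center : OnePoint ℂ
  radius : ℝ
  radius_pos : 0 < radius
  radius_lt_pi : radius < Real.pi

namespace SphericalDisk

/-- The closed disk as a set of points. -/
def toSet (D : SphericalDisk) : Set (OnePoint ℂ) :=
  {w | sphericalDist D.center w ≤ D.radius}

/-- The inversive distance of two disks. -/
noncomputable def inversiveDist (D E : SphericalDisk) : ℝ :=
  (Real.cos D.radius * Real.cos E.radius - Real.cos (sphericalDist D.center E.center)) /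
    (Real.sin D.radius * Real.sin E.radius)

/-- The overlap angle of two disks. It lies strictly between `0` and `π` if and only if the
inversive distance lies strictly between `-1` and `1`, that is, if and only if the boundary
circles cross at two points. -/
noncomputable def overlapAngle (D E : SphericalDisk) : ℝ := Real.arccos (D.inversiveDist E)

theorem overlapAngle_comm (D E : SphericalDisk) : D.overlapAngle E = E.overlapAngle D := by
  simp only [overlapAngle, inversiveDist, sphericalDist]
  rw [InnerProductGeometry.angle_comm, mul_comm (Real.cos D.radius), mul_comm (Real.sin D.radius)]

end SphericalDisk

/-- Linear fractional maps `z ↦ (az + b) / (cz + d)` and anti-linear fractional maps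
`z ↦ (a z̄ + b) / (c z̄ + d)` of the Riemann sphere, with `ad - bc ≠ 0`. -/
def IsMobiusOrAntiMobius (f : OnePoint ℂ → OnePoint ℂ) : Prop :=
  ∃ g : GL (Fin 2) ℂ, (∀ z, f z = g • z) ∨ (∀ z, f z = g • OnePoint.map (starRingEnd ℂ) z)

/-! ### Circle patterns -/

/-- A circle pattern: a collection of closed disks on the Riemann sphere. -/
abbrev CirclePattern (V : Type*) := V → SphericalDisk

namespace CirclePattern

variable {V : Type*}

/-- The contact graph: distinct vertices are joined when their disks intersect. -/
def contactGraph (P : CirclePattern V) : SimpleGraph V where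
  Adj u w := u ≠ w ∧ ((P u).toSet ∩ (P w).toSet).Nonempty
  symm := ⟨fun _ _ h => ⟨h.1.symm, by rw [Set.inter_comm]; exact h.2⟩⟩
  loopless := ⟨fun _ h => h.1 rfl⟩

/-- No proper subfamily of the disks covers the sphere. -/
def Irreducible (P : CirclePattern V) : Prop :=
  ∀ A : Set V, A ⊂ Set.univ → (⋃ v ∈ A, (P v).toSet) ⊂ Set.univ

/-- The overlap angles of a pattern, as a function on the edges of a graph. -/
noncomputable def overlapAngles (P : CirclePattern V) (G : SimpleGraph V) : G.edgeSet → ℝ :=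
  fun e => Sym2.lift ⟨fun u w => (P u).overlapAngle (P w),
    fun u w => (P u).overlapAngle_comm (P w)⟩ (e : Sym2 V)

/-- The sequence of patterns `Q` converges to `P`: for each vertex, the centers and the radii of
the disks converge. -/
def ConvergesTo (Q : ℕ → CirclePattern V) (P : CirclePattern V) : Prop :=
  ∀ v : V, Tendsto (fun n => (Q n v).center) atTop (𝓝 (P v).center) ∧
    Tendsto (fun n => (Q n v).radius) atTop (𝓝 (P v).radius)

end CirclePattern

/-!
The proof takes place in Minkowski space `ℝ^{3,1}`. A disk with center `z` and radius `r` is the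
unit spacelike vector `X = (z / sin r, cot r)`; it bounds a half-space of hyperbolic 3-space, the
inversive distance of two disks is `-⟨X, Y⟩`, and Möbius maps act by Lorentz transformations. By
the second condition the three vectors of a face of `T` have a positive definite Gram matrix, so
the three planes meet in a point of hyperbolic space. Moving this point to the origin makes the
disks of one fixed face hemispheres (`exists_normalizing_map`). Centers, radii and angles then
converge along a subsequence, a priori to a pattern with degenerate disks, and three things remain
to be shown.

*No disk degenerates* (`radius_mem_Ioo`). No radius tends to `π`, because the centers of the fixed
face span `ℝ³`. If some disks shrink to a point `q`, then the vertices whose limit circles pass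
through `q` separate them from the fixed face in the 1-skeleton. Near `q` these circles look like
lines: circles of a 3-cycle cannot share `q` because a face has a spherical and any other 3-cycle
a hyperbolic angle sum, and circles of non-adjacent vertices touch at `q`. But a vertex cut of a
triangulated sphere contains a cycle (`exists_four_cycle_of_cut`), here a 4-cycle without
diagonals, whose angles add up to `2π`, against the fourth condition.

*Disks of non-adjacent vertices do not touch in the limit* (`radius_add_lt`). They are not
complementary, since then `T` would be a suspension with angle sums `π` along its meridians, which
the fourth condition excludes, or the first one for the double tetrahedron. At a point of tangency
the first condition keeps all other disks from containing the point in their interior, and at most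
one more circle passes through it, so that part of the thin gap between the two disks is
uncovered. However, the disks of an irreducible pattern cover the sphere (`exists_lor_pos`): the
points of hyperbolic space attached to the faces satisfy a local convexity condition, which by
the simplex method makes them the vertices of a compact polyhedron.

*The limit is irreducible* (`exists_uncovered`). A limit of points uncovered by the disks of a
proper subfamily lies on at most two of the limit circles and in the interior of no limit disk of
that subfamily, so it can be moved off all of them.

The combinatorial input is the vanishing of the first homology of `T` modulo `2`
(`exists_eq_boundary`), which follows from the Euler characteristic by counting dimensions. It
shows that 3-cycles which are not faces and 4-cycles without diagonals separate the vertices.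
-/

/-! ### Combinatorics of triangulated spheres -/

namespace SphereTriangulation

variable {V : Type*} [Fintype V] [DecidableEq V] (T : SphereTriangulation V)

theorem exists_eq_of_mem_triangles {t : Finset V} (ht : t ∈ T.triangles) {a b : V} (hab : a ≠ b)
    (ha : a ∈ t) (hb : b ∈ t) : ∃ c, c ≠ a ∧ c ≠ b ∧ t = {a, b, c} := by
  have h3 := T.card_triangle t ht
  have h1 : ((t.erase a).erase b).card = 1 := by
    rw [Finset.card_erase_of_mem (by simp [hb, hab.symm]), Finset.card_erase_of_mem ha, h3]
  obtain ⟨c, hc⟩ := Finset.card_eq_one.1 h1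
  have hc' : c ∈ (t.erase a).erase b := by simp [hc]
  simp only [Finset.mem_erase] at hc'
  refine ⟨c, hc'.2.1, hc'.1, ?_⟩
  ext x
  have := congrArg (x ∈ ·) hc
  simp only [Finset.mem_erase, Finset.mem_singleton, eq_iff_iff] at this
  simp only [Finset.mem_insert, Finset.mem_singleton]
  by_cases hxa : x = a
  · simp [hxa, ha]
  by_cases hxb : x = b
  · simp [hxb, hb]
  simpa [hxa, hxb] using this

theorem adj_of_mem {t : Finset V} (ht : t ∈ T.triangles) {a b : V} (hab : a ≠ b)
    (ha : a ∈ t) (hb : b ∈ t) : T.skeleton.Adj a b := ⟨hab, t, ht, ha, hb⟩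

theorem pair_mem_edges {a b : V} (hab : T.skeleton.Adj a b) :
    ({a, b} : Finset V) ∈ complexEdges T.triangles := by
  obtain ⟨hne, t, ht, ha, hb⟩ := hab
  simp only [complexEdges, Finset.mem_biUnion, Finset.mem_powersetCard]
  exact ⟨t, ht, by simp [Finset.insert_subset_iff, ha, hb], Finset.card_pair hne⟩

theorem exists_pair_of_mem_edges {e : Finset V} (he : e ∈ complexEdges T.triangles) :
    ∃ a b, T.skeleton.Adj a b ∧ e = {a, b} := by
  simp only [complexEdges, Finset.mem_biUnion, Finset.mem_powersetCard] at he
  obtain ⟨t, ht, hsub, hc⟩ := he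
  obtain ⟨a, b, hab, rfl⟩ := Finset.card_eq_two.1 hc
  exact ⟨a, b, T.adj_of_mem ht hab (hsub (by simp)) (hsub (by simp)), rfl⟩

/-- Across every edge of a triangle there is exactly one other triangle. -/
theorem exists_other_triangle {t : Finset V} (ht : t ∈ T.triangles) {a b : V} (hab : a ≠ b)
    (ha : a ∈ t) (hb : b ∈ t) :
    ∃ t' ∈ T.triangles, t' ≠ t ∧ a ∈ t' ∧ b ∈ t' ∧
      ∀ s ∈ T.triangles, a ∈ s → b ∈ s → s = t ∨ s = t' := by
  have h2 := T.edge_mem_two _ (T.pair_mem_edges (T.adj_of_mem ht hab ha hb))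
  obtain ⟨x, y, hxy, hF⟩ := Finset.card_eq_two.1 h2
  have hmem : ∀ s, s ∈ T.triangles ∧ a ∈ s ∧ b ∈ s ↔ s = x ∨ s = y := by
    intro s
    have := congrArg (s ∈ ·) hF
    simpa [Finset.insert_subset_iff] using this
  rcases (hmem t).1 ⟨ht, ha, hb⟩ with rfl | rfl
  · obtain ⟨h1, h3, h4⟩ := (hmem y).2 (Or.inr rfl)
    exact ⟨y, h1, hxy.symm, h3, h4, fun s hs h5 h6 => (hmem s).1 ⟨hs, h5, h6⟩⟩
  · obtain ⟨h1, h3, h4⟩ := (hmem x).2 (Or.inl rfl)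
    exact ⟨x, h1, hxy, h3, h4, fun s hs h5 h6 => ((hmem s).1 ⟨hs, h5, h6⟩).symm⟩

/-- A set of triangles that is closed under crossing the edges at `v` contains all triangles
at `v` or none of them: the link of `v` is connected. -/
theorem star_consistent (F : Finset V → Prop) (v : V)
    (h : ∀ a, a ≠ v → ∀ t ∈ T.triangles, ∀ t' ∈ T.triangles, v ∈ t → a ∈ t → v ∈ t' → a ∈ t' →
      F t → F t')
    {t t' : Finset V} (ht : t ∈ T.triangles) (ht' : t' ∈ T.triangles) (hv : v ∈ t) (hv' : v ∈ t')
    (hF : F t) : F t' := by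
  have key : ∀ a b, (linkGraph T.triangles v).Reachable a b →
      (∀ s ∈ T.triangles, v ∈ s → a ∈ s → F s) → (∀ s ∈ T.triangles, v ∈ s → b ∈ s → F s) := by
    rintro a b ⟨p⟩
    induction p with
    | nil => exact id
    | cons hadj p ih =>
      intro hs
      refine ih fun s hs1 hs2 hs3 => ?_
      obtain ⟨_, hb, _, htri⟩ := hadj
      exact h _ hb _ htri s hs1 (by simp) (by simp) hs2 hs3 (hs _ htri (by simp) (by simp))
  have nb : ∀ s ∈ T.triangles, v ∈ s → ∃ a ∈ s, a ≠ v := by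
    intro s hs _
    exact Finset.exists_mem_ne (by rw [T.card_triangle s hs]; norm_num) v
  obtain ⟨a, hat, hav⟩ := nb t ht hv
  obtain ⟨b, hbt, hbv⟩ := nb t' ht' hv'
  have hr := T.link_connected v a b (T.adj_of_mem ht hav.symm hv hat)
    (T.adj_of_mem ht' hbv.symm hv' hbt)
  exact key a b hr (fun s hs h1 h2 => h a hav t ht s hs hv hat h1 h2 hF) t' ht' hv' hbt

/-- The triangles form a strongly connected complex: a nonempty set of triangles closed under
crossing edges contains all of them. -/
theorem strongly_connected (F : Finset V → Prop)
    (h : ∀ v a, a ≠ v → ∀ t ∈ T.triangles, ∀ t' ∈ T.triangles, v ∈ t → a ∈ t → v ∈ t' → a ∈ t' →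
      F t → F t')
    {t t' : Finset V} (ht : t ∈ T.triangles) (ht' : t' ∈ T.triangles) (hF : F t) : F t' := by
  have key : ∀ a b, T.skeleton.Reachable a b →
      (∀ s ∈ T.triangles, a ∈ s → F s) → (∀ s ∈ T.triangles, b ∈ s → F s) := by
    rintro a b ⟨p⟩
    induction p with
    | nil => exact id
    | cons hadj p ih =>
      intro hs
      refine ih fun s hs1 hs2 => ?_
      obtain ⟨_, r, hr, h1, h2⟩ := hadj
      exact T.star_consistent F _ (h _) hr hs1 h2 hs2 (hs r hr h1)
  have nb : ∀ s ∈ T.triangles, s.Nonempty := by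
    intro s hs
    rw [← Finset.card_pos, T.card_triangle s hs]; norm_num
  obtain ⟨a, ha⟩ := nb t ht
  obtain ⟨b, hb⟩ := nb t' ht'
  exact key a b (T.connected.preconnected a b)
    (fun s hs h1 => T.star_consistent F _ (h _) ht hs ha h1 hF) t' ht' hb

/-- The vertex-edge incidence matrix modulo `2`, the matrix of the first boundary map. -/
def vertexEdgeMatrix : Matrix V (complexEdges T.triangles) (ZMod 2) :=
  Matrix.of fun v e => if v ∈ e.1 then 1 else 0

/-- The edge-triangle incidence matrix modulo `2`, the matrix of the second boundary map. -/
def edgeTriangleMatrix : Matrix (complexEdges T.triangles) T.triangles (ZMod 2) :=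
  Matrix.of fun e t => if e.1 ⊆ t.1 then 1 else 0

theorem edgeTriangleMatrix_mulVec (x : T.triangles → ZMod 2) {a b : V} (hab : T.skeleton.Adj a b)
    {t t' : Finset V} (ht : t ∈ T.triangles) (ht' : t' ∈ T.triangles) (hne : t' ≠ t)
    (hall : ∀ s ∈ T.triangles, a ∈ s ∧ b ∈ s ↔ s = t ∨ s = t') :
    T.edgeTriangleMatrix.mulVec x ⟨{a, b}, T.pair_mem_edges hab⟩ = x ⟨t, ht⟩ + x ⟨t', ht'⟩ := by
  simp only [Matrix.mulVec, dotProduct, edgeTriangleMatrix, Matrix.of_apply, ite_mul, one_mul,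
    zero_mul]
  rw [← Finset.sum_filter]
  have : (Finset.univ.filter fun s : T.triangles => ({a, b} : Finset V) ⊆ s.1) =
      {⟨t, ht⟩, ⟨t', ht'⟩} := by
    ext ⟨s, hs⟩
    simpa [Finset.insert_subset_iff] using hall s hs
  rw [this, Finset.sum_pair]
  simpa using hne.symm

theorem vertexEdgeMatrix_mul_edgeTriangleMatrix :
    T.vertexEdgeMatrix * T.edgeTriangleMatrix = 0 := by
  ext v ⟨t, ht⟩
  simp only [Matrix.mul_apply, vertexEdgeMatrix, edgeTriangleMatrix, Matrix.of_apply,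
    Matrix.zero_apply, mul_ite, mul_one, mul_zero, ← ite_and]
  rw [Finset.sum_boole]
  by_cases hv : v ∈ t
  · obtain ⟨a, hat, hav⟩ := Finset.exists_mem_ne
      (by rw [T.card_triangle t ht]; norm_num : 1 < t.card) v
    obtain ⟨c, hcv, hca, rfl⟩ := T.exists_eq_of_mem_triangles ht hav.symm hv hat
    have h1 := T.adj_of_mem ht hav.symm (by simp) (by simp)
    have h2 := T.adj_of_mem ht hcv.symm (by simp) (by simp)
    have : (Finset.univ.filter fun e : complexEdges T.triangles =>
        e.1 ⊆ {v, a, c} ∧ v ∈ e.1) =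
        {⟨{v, a}, T.pair_mem_edges h1⟩, ⟨{v, c}, T.pair_mem_edges h2⟩} := by
      ext ⟨e, he⟩
      simp only [Finset.mem_filter, Finset.mem_univ, true_and, Finset.mem_insert,
        Subtype.mk.injEq, Finset.mem_singleton]
      constructor
      · rintro ⟨hs, hve⟩
        obtain ⟨x, y, hxy, rfl⟩ := T.exists_pair_of_mem_edges he
        have hx : x = v ∨ x = a ∨ x = c := by simpa using hs (show x ∈ ({x, y} : Finset V) by simp)
        have hy : y = v ∨ y = a ∨ y = c := by simpa using hs (show y ∈ ({x, y} : Finset V) by simp)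
        have hxy' := hxy.ne
        simp only [Finset.mem_insert, Finset.mem_singleton] at hve
        rcases hve with rfl | rfl
        · rcases hy with rfl | rfl | rfl <;> simp_all
        · rcases hx with rfl | rfl | rfl <;> simp_all [Finset.pair_comm]
      · rintro (rfl | rfl) <;> simp [Finset.insert_subset_iff]
    rw [this, Finset.card_pair]
    · rfl
    · simp only [ne_eq, Subtype.mk.injEq]
      intro h
      have : a ∈ ({v, c} : Finset V) := h ▸ (by simp)
      simp only [Finset.mem_insert, Finset.mem_singleton] at this
      rcases this with h | h
      · exact hav h
      · exact hca h.symm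
  · rw [Finset.card_eq_zero.2]
    · simp
    · ext ⟨e, he⟩
      simp only [Finset.mem_filter, Finset.mem_univ, true_and, Finset.notMem_empty, iff_false]
      rintro ⟨h1, h2⟩
      exact hv (h1 h2)

theorem finrank_le_one_of_forall_eq {ι : Type*} [Fintype ι]
    (U : Submodule (ZMod 2) (ι → ZMod 2)) (h : ∀ x ∈ U, ∀ i j, x i = x j) :
    Module.finrank (ZMod 2) U ≤ 1 := by
  have hle : U ≤ Submodule.span (ZMod 2) {fun _ => 1} := by
    intro x hx
    rw [Submodule.mem_span_singleton]
    rcases isEmpty_or_nonempty ι with hι | ⟨⟨i⟩⟩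
    · exact ⟨0, Subsingleton.elim _ _⟩
    · exact ⟨x i, by ext j; simp [h x hx i j]⟩
  refine (Submodule.finrank_mono hle).trans ?_
  refine (finrank_span_le_card _).trans ?_
  simp

/-- The first homology group modulo `2` vanishes: by the Euler characteristic, the dimensions of
the spaces of cycles and of boundaries agree. -/
theorem exists_eq_boundary (z : complexEdges T.triangles → ZMod 2)
    (hz : T.vertexEdgeMatrix.mulVec z = 0) : ∃ x, T.edgeTriangleMatrix.mulVec x = z := by
  set L1 := T.vertexEdgeMatrix.mulVecLin
  set L1t := T.vertexEdgeMatrix.transpose.mulVecLin with hL1t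
  set L2 := T.edgeTriangleMatrix.mulVecLin with hL2
  have r1 := L1.finrank_range_add_finrank_ker
  have r1t := L1t.finrank_range_add_finrank_ker
  have r2 := L2.finrank_range_add_finrank_ker
  have htr : Module.finrank (ZMod 2) (LinearMap.range L1t) =
      Module.finrank (ZMod 2) (LinearMap.range L1) := Matrix.rank_transpose T.vertexEdgeMatrix
  have k1 : Module.finrank (ZMod 2) (LinearMap.ker L1t) ≤ 1 := by
    apply finrank_le_one_of_forall_eq
    intro f hf
    have hadj : ∀ a b, T.skeleton.Adj a b → f a = f b := by
      intro a b hab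
      have := congrFun (LinearMap.mem_ker.1 hf) ⟨{a, b}, T.pair_mem_edges hab⟩
      simp only [hL1t, Matrix.mulVecLin_apply, Matrix.mulVec, dotProduct, Matrix.transpose_apply,
        vertexEdgeMatrix, Matrix.of_apply, ite_mul, one_mul, zero_mul, Pi.zero_apply] at this
      rw [← Finset.sum_filter, Finset.filter_mem_eq_inter, Finset.univ_inter,
        Finset.sum_pair hab.ne] at this
      exact CharTwo.add_eq_zero.1 this
    intro a b
    obtain ⟨p⟩ := T.connected.preconnected a b
    induction p with
    | nil => rfl
    | cons h p ih => exact (hadj _ _ h).trans ih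
  have k2 : Module.finrank (ZMod 2) (LinearMap.ker L2) ≤ 1 := by
    apply finrank_le_one_of_forall_eq
    rintro x hx ⟨t, ht⟩ ⟨t', ht'⟩
    have := T.strongly_connected (fun s => ∀ hs : s ∈ T.triangles, x ⟨s, hs⟩ = x ⟨t, ht⟩) ?_ ht ht'
      (fun _ => rfl)
    · exact (this ht').symm
    · intro v a hav s hs s' hs' hv ha hv' ha' hF _
      obtain ⟨s'', hs'', hne, hv'', ha'', hall⟩ := T.exists_other_triangle hs hav.symm hv ha
      rcases hall s' hs' hv' ha' with rfl | rfl
      · exact hF hs'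
      · have h0 := congrFun (LinearMap.mem_ker.1 hx)
          ⟨{v, a}, T.pair_mem_edges (T.adj_of_mem hs hav.symm hv ha)⟩
        rw [hL2, Matrix.mulVecLin_apply, T.edgeTriangleMatrix_mulVec x
          (T.adj_of_mem hs hav.symm hv ha) hs hs'' hne] at h0
        · rw [← CharTwo.add_eq_zero.1 h0]
          exact hF hs
        · intro r hr
          exact ⟨fun h => hall r hr h.1 h.2, by rintro (rfl | rfl) <;> simp [*]⟩
  have hle : LinearMap.range L2 ≤ LinearMap.ker L1 := by
    rintro _ ⟨x, rfl⟩
    rw [LinearMap.mem_ker, hL2, Matrix.mulVecLin_apply, Matrix.mulVecLin_apply,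
      Matrix.mulVec_mulVec, T.vertexEdgeMatrix_mul_edgeTriangleMatrix, Matrix.zero_mulVec]
  have heq : LinearMap.range L2 = LinearMap.ker L1 := by
    apply Submodule.eq_of_le_of_finrank_le hle
    have he := T.euler
    simp only [Module.finrank_fintype_fun_eq_card, Fintype.card_coe] at r1 r1t r2
    omega
  have hz' : z ∈ LinearMap.ker L1 := hz
  rw [← heq] at hz'
  exact hz'

end SphereTriangulation

/-! ### Separating curves -/

namespace SphereTriangulation

variable {V : Type*} [Fintype V] [DecidableEq V] (T : SphereTriangulation V)

/-- A Jordan curve theorem: the vertices off a mod `2` cycle which is a full subcomplex fall into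
two nonempty classes that are not joined by any edge. The two classes come from the two
`2`-chains bounded by the cycle. -/
theorem exists_side_of_cycle (es : Finset (Finset V)) (hes : es ⊆ complexEdges T.triangles)
    (hne : es.Nonempty)
    (hcyc : ∀ v, ∑ e ∈ es, (if v ∈ e then (1 : ZMod 2) else 0) = 0)
    (hfull : ∀ s ∈ T.simplices, (∀ v ∈ s, ∃ e ∈ es, v ∈ e) → s ∈ curve es) :
    ∃ side : V → Prop, (∃ v, (∀ e ∈ es, v ∉ e) ∧ side v) ∧ (∃ v, (∀ e ∈ es, v ∉ e) ∧ ¬ side v) ∧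
      ∀ v w, (∀ e ∈ es, v ∉ e) → (∀ e ∈ es, w ∉ e) → T.skeleton.Adj v w → (side v ↔ side w) := by
  set z : complexEdges T.triangles → ZMod 2 := fun e => if e.1 ∈ es then 1 else 0 with hzdef
  have hz : T.vertexEdgeMatrix.mulVec z = 0 := by
    ext v
    simp only [Matrix.mulVec, dotProduct, vertexEdgeMatrix, Matrix.of_apply, hzdef, mul_ite,
      mul_one, mul_zero, Pi.zero_apply]
    refine Eq.trans ?_ (hcyc v)
    rw [Finset.sum_coe_sort (complexEdges T.triangles)
      (fun e => if e ∈ es then (if v ∈ e then (1 : ZMod 2) else 0) else 0), Finset.sum_ite_mem,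
      Finset.inter_eq_right.2 hes]
  obtain ⟨x, hx⟩ := T.exists_eq_boundary z hz
  have hcross : ∀ {t t' : Finset V} (ht : t ∈ T.triangles) (ht' : t' ∈ T.triangles) {a b : V}
      (_ : a ≠ b) (_ : a ∈ t) (_ : b ∈ t) (_ : a ∈ t') (_ : b ∈ t') (_ : t' ≠ t),
      x ⟨t, ht⟩ + x ⟨t', ht'⟩ = if ({a, b} : Finset V) ∈ es then 1 else 0 := by
    intro t t' ht ht' a b hab ha hb ha' hb' hne
    obtain ⟨s, hs, hst, has, hbs, hall⟩ := T.exists_other_triangle ht hab ha hb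
    obtain rfl : t' = s := (hall t' ht' ha' hb').resolve_left hne
    have hadj := T.adj_of_mem ht hab ha hb
    rw [← T.edgeTriangleMatrix_mulVec x hadj ht ht' hne, hx]
    intro r hr
    exact ⟨fun h => hall r hr h.1 h.2, by rintro (rfl | rfl) <;> simp [*]⟩
  set F : Finset V → Prop := fun s => ∀ hs : s ∈ T.triangles, x ⟨s, hs⟩ = 1 with hFdef
  have hstar : ∀ v, (∀ e ∈ es, v ∉ e) → ∀ t ∈ T.triangles, ∀ t' ∈ T.triangles, v ∈ t → v ∈ t' →
      F t → F t' := by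
    intro v hv t ht t' ht' hvt hvt' hF
    refine T.star_consistent F v ?_ ht ht' hvt hvt' hF
    intro a hav s hs s' hs' h1 h2 h3 h4 hFs _
    by_cases hss : s' = s
    · subst hss; exact hFs hs
    have := hcross hs hs' hav.symm h1 h2 h3 h4 hss
    rw [if_neg (fun h => hv _ h (by simp)), hFs hs] at this
    exact (CharTwo.add_eq_zero.1 this).symm
  have hoff : ∀ t ∈ T.triangles, ∃ v ∈ t, ∀ e ∈ es, v ∉ e := by
    intro t ht
    by_contra hcon
    push Not at hcon
    have h3 := T.card_triangle t ht
    obtain ⟨-, e, he, hte⟩ := hfull t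
      ⟨by rw [← Finset.card_pos, h3]; norm_num, t, ht, subset_rfl⟩ hcon
    obtain ⟨a, b, hab, rfl⟩ := T.exists_pair_of_mem_edges (hes he)
    have := Finset.card_le_card hte
    rw [h3, Finset.card_pair hab.ne] at this
    omega
  have hboth : ∃ t ∈ T.triangles, ∃ t' ∈ T.triangles, F t ∧ ¬ F t' := by
    obtain ⟨e, he⟩ := hne
    obtain ⟨a, b, hab, rfl⟩ := T.exists_pair_of_mem_edges (hes he)
    obtain ⟨hne', t, ht, ha, hb⟩ := hab
    obtain ⟨s, hs, hst, has, hbs, -⟩ := T.exists_other_triangle ht hne' ha hb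
    have := hcross ht hs hne' ha hb has hbs hst
    rw [if_pos he] at this
    have two : ∀ y y' : ZMod 2, y + y' = 1 → (y = 1 ∧ y' ≠ 1) ∨ (y' = 1 ∧ y ≠ 1) := by decide
    rcases two _ _ this with ⟨h1, h2⟩ | ⟨h1, h2⟩
    · exact ⟨t, ht, s, hs, fun _ => h1, fun h => h2 (h hs)⟩
    · exact ⟨s, hs, t, ht, fun _ => h1, fun h => h2 (h ht)⟩
  obtain ⟨t, ht, t', ht', hF, hF'⟩ := hboth
  obtain ⟨v, hvt, hv⟩ := hoff t ht
  obtain ⟨v', hvt', hv'⟩ := hoff t' ht'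
  refine ⟨fun v => ∀ t ∈ T.triangles, v ∈ t → F t, ⟨v, hv, fun s hs hvs => hstar v hv t ht s hs hvt
    hvs hF⟩, ⟨v', hv', fun h => hF' (h t' ht' hvt')⟩, ?_⟩
  intro v w hv hw hadj
  obtain ⟨-, s, hs, hvs, hws⟩ := hadj
  exact ⟨fun h r hr hwr => hstar w hw s hs r hr hws hwr (h s hs hvs),
    fun h r hr hvr => hstar v hv s hs r hr hvs hvr (h s hs hws)⟩

/-- If the vertices off a full curve fall into two classes not joined by edges, then the curve
separates the vertices of the triangulation. -/
theorem separates_of_side (es : Finset (Finset V))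
    (hfull : ∀ s ∈ T.simplices, (∀ v ∈ s, ∃ e ∈ es, v ∈ e) → s ∈ curve es)
    (side : V → Prop) (h1 : ∃ v, (∀ e ∈ es, v ∉ e) ∧ side v)
    (h2 : ∃ v, (∀ e ∈ es, v ∉ e) ∧ ¬ side v)
    (h : ∀ v w, (∀ e ∈ es, v ∉ e) → (∀ e ∈ es, w ∉ e) → T.skeleton.Adj v w →
      (side v ↔ side w)) : T.Separates es := by
  obtain ⟨u, hu, hus⟩ := h1
  obtain ⟨w, hw, hws⟩ := h2
  have off : ∀ v, (∀ e ∈ es, v ∉ e) → ({v} : Finset V) ∉ curve es := by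
    rintro v hv ⟨-, e, he, hve⟩
    exact hv e he (by simpa using hve)
  refine ⟨u, w, off u hu, off w hw, ?_⟩
  have step : ∀ s t, (T.complementGraph es).Adj s t →
      (∃ v ∈ s, (∀ e ∈ es, v ∉ e) ∧ side v) → (∃ v ∈ t, (∀ e ∈ es, v ∉ e) ∧ side v) := by
    rintro s t ⟨-, ⟨hs, hsc⟩, ⟨ht, htc⟩, hst⟩ ⟨v, hvs, hv, hside⟩
    rcases hst with hst | hst
    · exact ⟨v, hst hvs, hv, hside⟩
    · have : ¬ ∀ v ∈ t, ∃ e ∈ es, v ∈ e := fun hcon => htc (hfull t ht hcon)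
      push Not at this
      obtain ⟨v', hv't, hv'⟩ := this
      refine ⟨v', hv't, hv', ?_⟩
      by_cases hvv : v = v'
      · exact hvv ▸ hside
      obtain ⟨-, r, hr, hsr⟩ := hs
      exact (h v v' hv hv' (T.adj_of_mem hr hvv (hsr hvs) (hsr (hst hv't)))).1 hside
  have key : ∀ s t, (T.complementGraph es).Reachable s t →
      (∃ v ∈ s, (∀ e ∈ es, v ∉ e) ∧ side v) → (∃ v ∈ t, (∀ e ∈ es, v ∉ e) ∧ side v) := by
    rintro s t ⟨p⟩
    induction p with
    | nil => exact id
    | cons hadj p ih => exact fun hs => ih (step _ _ hadj hs)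
  intro hr
  obtain ⟨v, hv, -, hside⟩ := key _ _ hr ⟨u, by simp, hu, hus⟩
  rw [Finset.mem_singleton] at hv
  exact hws (hv ▸ hside)

theorem ite_mem_pair {ι : Type*} [DecidableEq ι] {v a b : ι} (hab : a ≠ b) :
    (if v ∈ ({a, b} : Finset ι) then (1 : ZMod 2) else 0) =
      (if v = a then 1 else 0) + (if v = b then 1 else 0) := by
  by_cases ha : v = a
  · subst ha; simp [hab]
  · simp [ha]

theorem three_cycle_full {a b c : V} (hab : T.skeleton.Adj a b)
    (hbc : T.skeleton.Adj b c) (hca : T.skeleton.Adj c a)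
    (hface : ({a, b, c} : Finset V) ∉ T.triangles) :
    ∀ s ∈ T.simplices,
    (∀ v ∈ s, ∃ e ∈ ({{a, b}, {b, c}, {c, a}} : Finset (Finset V)), v ∈ e) →
      s ∈ curve ({{a, b}, {b, c}, {c, a}} : Finset (Finset V)) := by
  rintro s ⟨hs, t, ht, hst⟩ hon
  have hsub : ∀ v ∈ s, v = a ∨ v = b ∨ v = c := by
    intro v hv
    have := hon v hv
    simp only [Finset.mem_insert, Finset.mem_singleton, exists_eq_or_imp, exists_eq_left] at this
    tauto
  refine ⟨hs, ?_⟩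
  simp only [Finset.mem_insert, Finset.mem_singleton, exists_eq_or_imp, exists_eq_left]
  have hmiss : a ∉ s ∨ b ∉ s ∨ c ∉ s := by
    by_contra hcon
    push Not at hcon
    have hsub3 : ({a, b, c} : Finset V) ⊆ t := by
      simp only [Finset.insert_subset_iff, Finset.singleton_subset_iff]
      exact ⟨hst hcon.1, hst hcon.2.1, hst hcon.2.2⟩
    have := Finset.eq_of_subset_of_card_le hsub3 (by
      rw [T.card_triangle t ht, Finset.card_eq_three.2 ⟨a, b, c, hab.ne, hca.ne', hbc.ne, rfl⟩])
    exact hface (this ▸ ht)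
  rcases hmiss with h | h | h
  · refine Or.inr (Or.inl fun v hv => ?_)
    rcases hsub v hv with rfl | rfl | rfl <;> simp_all
  · refine Or.inr (Or.inr fun v hv => ?_)
    rcases hsub v hv with rfl | rfl | rfl <;> simp_all
  · refine Or.inl fun v hv => ?_
    rcases hsub v hv with rfl | rfl | rfl <;> simp_all

/-- A 3-cycle which does not bound a face leaves two nonempty classes of vertices not joined by
edges. -/
theorem exists_side_of_three_cycle {a b c : V} (hab : T.skeleton.Adj a b)
    (hbc : T.skeleton.Adj b c) (hca : T.skeleton.Adj c a)
    (hface : ({a, b, c} : Finset V) ∉ T.triangles) :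
    ∃ side : V → Prop, (∃ v, (v ≠ a ∧ v ≠ b ∧ v ≠ c) ∧ side v) ∧
      (∃ v, (v ≠ a ∧ v ≠ b ∧ v ≠ c) ∧ ¬ side v) ∧
      ∀ v w, (v ≠ a ∧ v ≠ b ∧ v ≠ c) → (w ≠ a ∧ w ≠ b ∧ w ≠ c) → T.skeleton.Adj v w →
        (side v ↔ side w) := by
  have hoff : ∀ v, (∀ e ∈ ({{a, b}, {b, c}, {c, a}} : Finset (Finset V)), v ∉ e) ↔
      (v ≠ a ∧ v ≠ b ∧ v ≠ c) := by
    intro v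
    simp only [Finset.mem_insert, Finset.mem_singleton, forall_eq_or_imp, forall_eq]
    tauto
  have hf := T.three_cycle_full hab hbc hca hface
  obtain ⟨es, hes⟩ : ∃ es, es = ({{a, b}, {b, c}, {c, a}} : Finset (Finset V)) := ⟨_, rfl⟩
  rw [← hes] at hf hoff
  have := T.exists_side_of_cycle es ?_ ?_ ?_ hf
  · simpa only [hoff] using this
  · intro e he
    simp only [hes, Finset.mem_insert, Finset.mem_singleton] at he
    rcases he with rfl | rfl | rfl
    · exact T.pair_mem_edges hab
    · exact T.pair_mem_edges hbc
    · exact T.pair_mem_edges hca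
  · exact hes ▸ Finset.insert_nonempty _ _
  · intro v
    have h1 := hab.ne
    have h2 := hbc.ne
    have h3 := hca.ne
    have d1 : ({a, b} : Finset V) ∉ ({{b, c}, {c, a}} : Finset (Finset V)) := by
      simp only [Finset.mem_insert, Finset.mem_singleton, Finset.ext_iff, not_or, not_forall]
      exact ⟨⟨a, by simp [h1, h3.symm]⟩, ⟨b, by simp [h1.symm, h2]⟩⟩
    have d2 : ({b, c} : Finset V) ∉ ({{c, a}} : Finset (Finset V)) := by
      simp only [Finset.mem_singleton, Finset.ext_iff, not_forall]
      exact ⟨b, by simp [h1.symm, h2]⟩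
    rw [hes, Finset.sum_insert d1, Finset.sum_insert d2, Finset.sum_singleton]
    rw [ite_mem_pair h1, ite_mem_pair h2, ite_mem_pair h3]
    have : ∀ x y z : ZMod 2, x + y + (y + z + (z + x)) = 0 := by decide
    exact this _ _ _

theorem separates_three_cycle {a b c : V} (hab : T.skeleton.Adj a b)
    (hbc : T.skeleton.Adj b c) (hca : T.skeleton.Adj c a)
    (hface : ({a, b, c} : Finset V) ∉ T.triangles) :
    T.Separates {{a, b}, {b, c}, {c, a}} := by
  obtain ⟨side, h1, h2, h⟩ := T.exists_side_of_three_cycle hab hbc hca hface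
  have hoff : ∀ v, (∀ e ∈ ({{a, b}, {b, c}, {c, a}} : Finset (Finset V)), v ∉ e) ↔
      (v ≠ a ∧ v ≠ b ∧ v ≠ c) := by
    intro v
    simp only [Finset.mem_insert, Finset.mem_singleton, forall_eq_or_imp, forall_eq]
    tauto
  have hf := T.three_cycle_full hab hbc hca hface
  obtain ⟨es, hes⟩ : ∃ es, es = ({{a, b}, {b, c}, {c, a}} : Finset (Finset V)) := ⟨_, rfl⟩
  rw [← hes] at hf hoff ⊢
  apply T.separates_of_side _ hf side <;> simpa only [hoff]

/-- A 4-cycle without diagonals separates the vertices of the triangulation. -/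
theorem separates_four_cycle {a b c d : V} (hab : T.skeleton.Adj a b) (hbc : T.skeleton.Adj b c)
    (hcd : T.skeleton.Adj c d) (hda : T.skeleton.Adj d a) (hac : a ≠ c) (hbd : b ≠ d)
    (hnac : ¬ T.skeleton.Adj a c) (hnbd : ¬ T.skeleton.Adj b d) :
    T.Separates {{a, b}, {b, c}, {c, d}, {d, a}} := by
  have hfull : ∀ s ∈ T.simplices,
      (∀ v ∈ s, ∃ e ∈ ({{a, b}, {b, c}, {c, d}, {d, a}} : Finset (Finset V)), v ∈ e) →
        s ∈ curve ({{a, b}, {b, c}, {c, d}, {d, a}} : Finset (Finset V)) := by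
    rintro s ⟨hs, t, ht, hst⟩ hon
    have hsub : ∀ v ∈ s, v = a ∨ v = b ∨ v = c ∨ v = d := by
      intro v hv
      have := hon v hv
      simp only [Finset.mem_insert, Finset.mem_singleton, exists_eq_or_imp, exists_eq_left] at this
      tauto
    refine ⟨hs, ?_⟩
    simp only [Finset.mem_insert, Finset.mem_singleton, exists_eq_or_imp, exists_eq_left]
    have m1 : a ∉ s ∨ c ∉ s := by
      by_contra hcon
      push Not at hcon
      exact hnac (T.adj_of_mem ht hac (hst hcon.1) (hst hcon.2))
    have m2 : b ∉ s ∨ d ∉ s := by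
      by_contra hcon
      push Not at hcon
      exact hnbd (T.adj_of_mem ht hbd (hst hcon.1) (hst hcon.2))
    rcases m1 with h | h <;> rcases m2 with h' | h'
    · refine Or.inr (Or.inr (Or.inl fun v hv => ?_))
      rcases hsub v hv with rfl | rfl | rfl | rfl <;> simp_all
    · refine Or.inr (Or.inl fun v hv => ?_)
      rcases hsub v hv with rfl | rfl | rfl | rfl <;> simp_all
    · refine Or.inr (Or.inr (Or.inr fun v hv => ?_))
      rcases hsub v hv with rfl | rfl | rfl | rfl <;> simp_all
    · refine Or.inl fun v hv => ?_
      rcases hsub v hv with rfl | rfl | rfl | rfl <;> simp_all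
  obtain ⟨es, hes⟩ : ∃ es, es = ({{a, b}, {b, c}, {c, d}, {d, a}} : Finset (Finset V)) := ⟨_, rfl⟩
  rw [← hes] at hfull ⊢
  obtain ⟨side, h1, h2, h⟩ := T.exists_side_of_cycle es (by
    intro e he
    simp only [hes, Finset.mem_insert, Finset.mem_singleton] at he
    rcases he with rfl | rfl | rfl | rfl
    · exact T.pair_mem_edges hab
    · exact T.pair_mem_edges hbc
    · exact T.pair_mem_edges hcd
    · exact T.pair_mem_edges hda) (hes ▸ Finset.insert_nonempty _ _) (by
    intro v
    have h1 := hab.ne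
    have h2 := hbc.ne
    have h3 := hcd.ne
    have h4 := hda.ne
    have d1 : ({a, b} : Finset V) ∉ ({{b, c}, {c, d}, {d, a}} : Finset (Finset V)) := by
      simp only [Finset.mem_insert, Finset.mem_singleton, Finset.ext_iff, not_or, not_forall]
      exact ⟨⟨a, by simp [h1, hac]⟩, ⟨a, by simp [h4.symm, hac]⟩, ⟨b, by simp [h1.symm, hbd]⟩⟩
    have d2 : ({b, c} : Finset V) ∉ ({{c, d}, {d, a}} : Finset (Finset V)) := by
      simp only [Finset.mem_insert, Finset.mem_singleton, Finset.ext_iff, not_or, not_forall]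
      exact ⟨⟨b, by simp [h2, hbd]⟩, ⟨b, by simp [h1.symm, hbd]⟩⟩
    have d3 : ({c, d} : Finset V) ∉ ({{d, a}} : Finset (Finset V)) := by
      simp only [Finset.mem_singleton, Finset.ext_iff, not_forall]
      exact ⟨c, by simp [h3, hac.symm]⟩
    rw [hes, Finset.sum_insert d1, Finset.sum_insert d2, Finset.sum_insert d3, Finset.sum_singleton]
    rw [ite_mem_pair h1, ite_mem_pair h2, ite_mem_pair h3, ite_mem_pair h4]
    have : ∀ x y z w : ZMod 2, x + y + (y + z + (z + w + (w + x))) = 0 := by decide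
    exact this _ _ _ _) hfull
  exact T.separates_of_side _ hfull side h1 h2 h

end SphereTriangulation

/-! ### Vertex cuts and small configurations -/

namespace SphereTriangulation

variable {V : Type*} [Fintype V] [DecidableEq V] (T : SphereTriangulation V)

/-- The boundary of a set of triangles has no vertex of degree one, since the boundary of a
boundary vanishes modulo `2`. -/
theorem exists_other_boundary_edge (F : Finset V → Prop) {a b : V} {t t' : Finset V}
    (ht : t ∈ T.triangles) (ht' : t' ∈ T.triangles) (hab : a ≠ b) (hat : a ∈ t) (hbt : b ∈ t)
    (hat' : a ∈ t') (hbt' : b ∈ t') (hF : F t) (hF' : ¬ F t') :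
    ∃ c, c ≠ b ∧ a ≠ c ∧ ∃ s ∈ T.triangles, ∃ s' ∈ T.triangles,
      a ∈ s ∧ c ∈ s ∧ a ∈ s' ∧ c ∈ s' ∧ F s ∧ ¬ F s' := by
  by_contra hcon
  have hcon' : ∀ c, c ≠ b → a ≠ c → ∀ s ∈ T.triangles, ∀ s' ∈ T.triangles,
      a ∈ s → c ∈ s → a ∈ s' → c ∈ s' → F s → F s' := by
    intro c h1 h2 s hs s' hs' m1 m2 m3 m4 m5
    by_contra m6
    exact hcon ⟨c, h1, h2, s, hs, s', hs', m1, m2, m3, m4, m5, m6⟩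
  have hadj := T.adj_of_mem ht hab hat hbt
  obtain ⟨x, hx1, hx0⟩ : ∃ x : T.triangles → ZMod 2,
      (∀ s, F s.1 → x s = 1) ∧ (∀ s, ¬ F s.1 → x s = 0) := by
    classical
    exact ⟨fun s => if F s.1 then 1 else 0, fun s h => if_pos h, fun s h => if_neg h⟩
  have h0 : T.vertexEdgeMatrix.mulVec (T.edgeTriangleMatrix.mulVec x) a = 0 := by
    rw [Matrix.mulVec_mulVec, T.vertexEdgeMatrix_mul_edgeTriangleMatrix, Matrix.zero_mulVec,
      Pi.zero_apply]
  have val : ∀ {c s s'} (hac : T.skeleton.Adj a c) (hs : s ∈ T.triangles) (hs' : s' ∈ T.triangles)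
      (_ : a ∈ s) (_ : c ∈ s) (_ : a ∈ s') (_ : c ∈ s') (_ : s' ≠ s),
      T.edgeTriangleMatrix.mulVec x ⟨{a, c}, T.pair_mem_edges hac⟩ =
        x ⟨s, hs⟩ + x ⟨s', hs'⟩ := by
    intro c s s' hac hs hs' m1 m2 m3 m4 m5
    refine T.edgeTriangleMatrix_mulVec x hac hs hs' m5 fun r hr => ?_
    obtain ⟨q, hq, hqs, maq, mcq, hall⟩ := T.exists_other_triangle hs hac.ne m1 m2
    obtain rfl : s' = q := (hall s' hs' m3 m4).resolve_left m5
    exact ⟨fun h => hall r hr h.1 h.2, by rintro (rfl | rfl) <;> exact ⟨‹_›, ‹_›⟩⟩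
  have hb : T.edgeTriangleMatrix.mulVec x ⟨{a, b}, T.pair_mem_edges hadj⟩ = 1 := by
    rw [val hadj ht ht' hat hbt hat' hbt' (by rintro rfl; exact hF' hF), hx1 _ hF, hx0 _ hF',
      add_zero]
  have hc : ∀ c (hac : T.skeleton.Adj a c), c ≠ b →
      T.edgeTriangleMatrix.mulVec x ⟨{a, c}, T.pair_mem_edges hac⟩ = 0 := by
    intro c hac hcb
    obtain ⟨hne, s, hs, has, hcs⟩ := id hac
    obtain ⟨s', hs', hst, has', hcs', -⟩ := T.exists_other_triangle hs hne has hcs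
    rw [val hac hs hs' has hcs has' hcs' hst]
    by_cases m : F s
    · rw [hx1 _ m, hx1 _ (hcon' c hcb hne s hs s' hs' has hcs has' hcs' m)]
      rfl
    · rw [hx0 _ m, hx0 _ fun m' => m (hcon' c hcb hne s' hs' s hs has' hcs' has hcs m'), add_zero]
  generalize T.edgeTriangleMatrix.mulVec x = y at h0 hb hc
  rw [Matrix.mulVec, dotProduct, Finset.sum_eq_single ⟨{a, b}, T.pair_mem_edges hadj⟩, hb] at h0
  · simp [vertexEdgeMatrix] at h0
  · rintro ⟨e, he⟩ - hne
    by_cases hae : a ∈ e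
    · obtain ⟨p, q, hpq, rfl⟩ := T.exists_pair_of_mem_edges he
      obtain ⟨c, hac, hpqc⟩ : ∃ c, T.skeleton.Adj a c ∧ ({p, q} : Finset V) = {a, c} := by
        simp only [Finset.mem_insert, Finset.mem_singleton] at hae
        rcases hae with rfl | rfl
        · exact ⟨q, hpq, rfl⟩
        · exact ⟨p, hpq.symm, Finset.pair_comm _ _⟩
      have hcb : c ≠ b := by
        rintro rfl
        exact hne (Subtype.ext hpqc)
      simp only [hpqc]
      rw [hc c hac hcb, mul_zero]
    · simp [vertexEdgeMatrix, hae]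
  · simp

/-- A vertex cut `Z` contains a cycle, the boundary of the union of the triangles that meet one
side. If `Z` contains no 3-cycle and every vertex of `Z` has at most one non-neighbour in `Z`,
this produces a 4-cycle without diagonals. -/
theorem exists_four_cycle_of_cut (Z B : V → Prop) (hB : ∃ v, B v) (hR : ∃ v, ¬ B v ∧ ¬ Z v)
    (hN : ∀ v w, B v → T.skeleton.Adj v w → B w ∨ Z w)
    (h3 : ∀ a b c, Z a → Z b → Z c → T.skeleton.Adj a b → T.skeleton.Adj b c →
      ¬ T.skeleton.Adj c a)
    (h1 : ∀ a b c, Z a → Z b → Z c → a ≠ b → a ≠ c → ¬ T.skeleton.Adj a b →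
      ¬ T.skeleton.Adj a c → b = c) :
    ∃ a b c d, Z a ∧ Z b ∧ Z c ∧ Z d ∧ T.skeleton.Adj a b ∧ T.skeleton.Adj b c ∧
      T.skeleton.Adj c d ∧ T.skeleton.Adj d a ∧ a ≠ c ∧ b ≠ d ∧
      ¬ T.skeleton.Adj a c ∧ ¬ T.skeleton.Adj b d := by
  classical
  set F : Finset V → Prop := fun t => ∃ v ∈ t, B v with hF
  -- the edges between a triangle that meets `B` and one that does not
  set Bd : V → V → Prop := fun a b => a ≠ b ∧ ∃ t ∈ T.triangles, ∃ t' ∈ T.triangles,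
    a ∈ t ∧ b ∈ t ∧ a ∈ t' ∧ b ∈ t' ∧ F t ∧ ¬ F t' with hBd
  have symm : ∀ {a b}, Bd a b → Bd b a := by
    rintro a b ⟨h, t, ht, t', ht', h1, h2, h3, h4, h5⟩
    exact ⟨h.symm, t, ht, t', ht', h2, h1, h4, h3, h5⟩
  have adj : ∀ {a b}, Bd a b → T.skeleton.Adj a b := by
    rintro a b ⟨h, t, ht, t', ht', h1, h2, h3, h4, h5⟩
    exact T.adj_of_mem ht h h1 h2
  have inZ : ∀ {a b}, Bd a b → Z a := by
    rintro a b ⟨h, t, ht, t', ht', h1, h2, h3, h4, ⟨v, hvt, hv⟩, h6⟩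
    have ha : ¬ B a := fun hBa => h6 ⟨a, h3, hBa⟩
    have hva : v ≠ a := by rintro rfl; exact ha hv
    exact (hN v a hv (T.adj_of_mem ht hva hvt h1)).resolve_left ha
  have ex : ∃ a b, Bd a b := by
    by_contra hcon
    push Not at hcon
    obtain ⟨v, hv⟩ := hB
    obtain ⟨r, hr1, hr2⟩ := hR
    obtain ⟨t, ht, hvt⟩ := T.vertex_mem v
    obtain ⟨t', ht', hrt'⟩ := T.vertex_mem r
    have := T.strongly_connected F ?_ ht ht' ⟨v, hvt, hv⟩
    · obtain ⟨v', hv', hBv'⟩ := this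
      have hne : v' ≠ r := by rintro rfl; exact hr1 hBv'
      exact (hN v' r hBv' (T.adj_of_mem ht' hne hv' hrt')).elim hr1 hr2
    · intro x a hax s hs s' hs' m1 m2 m3 m4 hFs
      by_contra hFs'
      exact hcon x a ⟨hax.symm, s, hs, s', hs', m1, m2, m3, m4, hFs, hFs'⟩
  have next : ∀ {a b}, Bd a b → ∃ c, c ≠ b ∧ Bd a c := by
    rintro a b ⟨h, t, ht, t', ht', h⟩
    obtain ⟨c, h1, h2⟩ := T.exists_other_boundary_edge F ht ht' ‹_› h.1 h.2.1 h.2.2.1 h.2.2.2.1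
      h.2.2.2.2.1 h.2.2.2.2.2
    exact ⟨c, h1, h2⟩
  obtain ⟨s, x, hsx⟩ := ex
  obtain ⟨y, hyx, hsy⟩ := next hsx
  obtain ⟨t, hts, hxt⟩ := next (symm hsx)
  have Zs := inZ hsx
  have Zx := inZ (symm hsx)
  have Zy := inZ (symm hsy)
  have Zt := inZ (symm hxt)
  have hxy : ¬ T.skeleton.Adj x y := fun h => h3 s x y Zs Zx Zy (adj hsx) h (adj hsy).symm
  have hst : ¬ T.skeleton.Adj s t := fun h => h3 s x t Zs Zx Zt (adj hsx) (adj hxt) h.symm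
  have hty : t ≠ y := by rintro rfl; exact hxy (adj hxt)
  have hty' : T.skeleton.Adj t y := by
    by_contra hcon
    exact (adj hxt).ne (h1 y x t Zy Zx Zt hyx hty.symm (fun h => hxy h.symm)
      (fun h => hcon h.symm))
  exact ⟨s, x, t, y, Zs, Zx, Zt, Zy, adj hsx, adj hxt, hty', (adj hsy).symm, hts.symm, hyx.symm,
    hst, hxy⟩

/-- The boundary of a tetrahedron is a whole component of the complex. -/
theorem card_le_four_of_faces {Q : Finset V} (hQ : Q.card = 4)
    (h : ∀ x ∈ Q, Q.erase x ∈ T.triangles) : Fintype.card V ≤ 4 := by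
  have hcross : ∀ v a, a ≠ v → ∀ t ∈ T.triangles, ∀ t' ∈ T.triangles, v ∈ t → a ∈ t → v ∈ t' →
      a ∈ t' → t ⊆ Q → t' ⊆ Q := by
    intro v a hav t ht t' ht' hv ha hv' ha' htQ
    obtain ⟨y, hyv, hya, rfl⟩ := T.exists_eq_of_mem_triangles ht hav.symm hv ha
    have hyQ : y ∈ Q := htQ (by simp)
    obtain ⟨s, hs, hst, hvs, has, hall⟩ := T.exists_other_triangle ht hav.symm hv ha
    have h2 := hall _ (h y hyQ) (by simp [hyv.symm, htQ hv]) (by simp [hya.symm, htQ ha])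
    have h3 : Q.erase y ≠ {v, a, y} := fun he => Finset.notMem_erase y Q (he ▸ by simp)
    rcases hall t' ht' hv' ha' with rfl | rfl
    · exact htQ
    · rw [← h2.resolve_left h3]
      exact Finset.erase_subset _ _
  obtain ⟨x, hx⟩ : Q.Nonempty := by rw [← Finset.card_pos, hQ]; norm_num
  have hall : ∀ v, v ∈ Q := by
    intro v
    obtain ⟨t, ht, hvt⟩ := T.vertex_mem v
    exact T.strongly_connected (· ⊆ Q) hcross (h x hx) ht (Finset.erase_subset _ _) hvt
  rw [← hQ, ← Finset.card_univ]
  exact Finset.card_le_card fun v _ => hall v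

theorem not_mem_or_not_mem_of_four_clique (hV : 4 < Fintype.card V) {a b c d : V}
    (hab : a ≠ b) (hac : a ≠ c) (had : a ≠ d) (hbc : b ≠ c) (hbd : b ≠ d) (hcd : c ≠ d)
    (h1 : ({a, b, c} : Finset V) ∈ T.triangles) (h2 : ({a, b, d} : Finset V) ∈ T.triangles) :
    ({a, c, d} : Finset V) ∉ T.triangles ∨ ({b, c, d} : Finset V) ∉ T.triangles := by
  by_contra hcon
  push Not at hcon
  have hQ : ({a, b, c, d} : Finset V).card = 4 := by
    simp [*]
  have e1 : ({a, b, c, d} : Finset V).erase a = {b, c, d} := by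
    ext x; simp only [Finset.mem_erase, Finset.mem_insert, Finset.mem_singleton]
    constructor
    · tauto
    · rintro (rfl | rfl | rfl) <;> simp_all [Ne.symm]
  have e2 : ({a, b, c, d} : Finset V).erase b = {a, c, d} := by
    ext x; simp only [Finset.mem_erase, Finset.mem_insert, Finset.mem_singleton]
    constructor
    · tauto
    · rintro (rfl | rfl | rfl) <;> simp_all [Ne.symm]
  have e3 : ({a, b, c, d} : Finset V).erase c = {a, b, d} := by
    ext x; simp only [Finset.mem_erase, Finset.mem_insert, Finset.mem_singleton]
    constructor
    · tauto
    · rintro (rfl | rfl | rfl) <;> simp_all [Ne.symm]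
  have e4 : ({a, b, c, d} : Finset V).erase d = {a, b, c} := by
    ext x; simp only [Finset.mem_erase, Finset.mem_insert, Finset.mem_singleton]
    constructor
    · tauto
    · rintro (rfl | rfl | rfl) <;> simp_all [Ne.symm]
  have := T.card_le_four_of_faces hQ (by
    intro x hx
    simp only [Finset.mem_insert, Finset.mem_singleton] at hx
    rcases hx with h | h | h | h <;> rw [h]
    · rw [e1]; exact hcon.2
    · rw [e2]; exact hcon.1
    · rw [e3]; exact h2
    · rw [e4]; exact h1)
  omega

/-- In a suspension whose equator is a clique, every equatorial edge spans a face with each pole: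
otherwise it would span a 3-cycle around which the other pole connects all vertices. -/
theorem suspension_face {p q : V} (hpq : p ≠ q)
    (hp : ∀ s, s ≠ p → s ≠ q → T.skeleton.Adj p s) (hq : ∀ s, s ≠ p → s ≠ q → T.skeleton.Adj q s)
    (hcl : ∀ s t, s ≠ p → s ≠ q → t ≠ p → t ≠ q → s ≠ t → T.skeleton.Adj s t) :
    ∀ s t, s ≠ p → s ≠ q → t ≠ p → t ≠ q → s ≠ t → ({p, s, t} : Finset V) ∈ T.triangles := by
  intro s t hsp hsq htp htq hst
  by_contra hface
  obtain ⟨side, ⟨v, hv, hsv⟩, ⟨v', hv', hsv'⟩, hside⟩ := T.exists_side_of_three_cycle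
    (hp s hsp hsq) (hcl s t hsp hsq htp htq hst) (hp t htp htq).symm hface
  have hqoff : q ≠ p ∧ q ≠ s ∧ q ≠ t := ⟨hpq.symm, hsq.symm, htq.symm⟩
  have same : ∀ x, (x ≠ p ∧ x ≠ s ∧ x ≠ t) → (side x ↔ side q) := by
    intro x hx
    by_cases hxq : x = q
    · rw [hxq]
    · exact (hside q x hqoff hx (hq x hx.1 hxq)).symm
  exact hsv' ((same v' hv').2 ((same v hv).1 hsv))

theorem eq_of_subset_cone {t : Finset V} (ht : t ∈ T.triangles) {p x y z : V} (hp : p ∈ t)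
    (hv : ∀ v ∈ t, v = p ∨ v = x ∨ v = y ∨ v = z) :
    t = {p, x, y} ∨ t = {p, y, z} ∨ t = {p, z, x} := by
  obtain ⟨a, hat, hap⟩ := Finset.exists_mem_ne
    (by rw [T.card_triangle t ht]; norm_num : 1 < t.card) p
  obtain ⟨b, hbp, hba, rfl⟩ := T.exists_eq_of_mem_triangles ht hap.symm hp hat
  have ha := (hv a (by simp)).resolve_left hap
  have hb := (hv b (by simp)).resolve_left hbp
  rcases ha with rfl | rfl | rfl <;> rcases hb with rfl | rfl | rfl
  · exact absurd rfl hba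
  · exact Or.inl rfl
  · exact Or.inr (Or.inr (by rw [Finset.pair_comm]))
  · exact Or.inl (by rw [Finset.pair_comm])
  · exact absurd rfl hba
  · exact Or.inr (Or.inl rfl)
  · exact Or.inr (Or.inr rfl)
  · exact Or.inr (Or.inl (by rw [Finset.pair_comm]))
  · exact absurd rfl hba

/-- A suspension whose equator is a clique is the boundary of a double tetrahedron. -/
theorem isDoubleTetrahedron_of_suspension (hV : 4 < Fintype.card V) {u w : V} (huw : u ≠ w)
    (hnadj : ¬ T.skeleton.Adj u w)
    (hu : ∀ s, s ≠ u → s ≠ w → T.skeleton.Adj u s) (hw : ∀ s, s ≠ u → s ≠ w → T.skeleton.Adj w s)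
    (hcl : ∀ s t, s ≠ u → s ≠ w → t ≠ u → t ≠ w → s ≠ t → T.skeleton.Adj s t) :
    T.IsDoubleTetrahedron := by
  have fu := T.suspension_face huw hu hw hcl
  have fw := T.suspension_face huw.symm (fun s h1 h2 => hw s h2 h1) (fun s h1 h2 => hu s h2 h1)
    (fun s t h1 h2 h3 h4 h5 => hcl s t h2 h1 h4 h3 h5)
  obtain ⟨R, hR⟩ : ∃ R : Finset V, R = (Finset.univ.erase u).erase w := ⟨_, rfl⟩
  have memR : ∀ x, x ∈ R ↔ x ≠ w ∧ x ≠ u := by intro x; simp [hR]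
  have cardR : R.card + 2 = Fintype.card V := by
    rw [hR, Finset.card_erase_of_mem (by simp [huw.symm]), Finset.card_erase_of_mem (by simp),
      Finset.card_univ]
    omega
  obtain ⟨x, hx⟩ : R.Nonempty := by rw [← Finset.card_pos]; omega
  have hx' := (memR x).1 hx
  have hle : (R.erase x).card ≤ 2 := by
    rw [← T.edge_mem_two _ (T.pair_mem_edges (hu x hx'.2 hx'.1))]
    refine Finset.card_le_card_of_injOn (fun y => {u, x, y}) ?_ ?_
    · intro y hy
      have hy1 : y ≠ x ∧ y ∈ R := Finset.mem_erase.1 hy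
      have hy2 := (memR y).1 hy1.2
      simp only [Finset.coe_filter, Set.mem_ofPred_eq]
      exact ⟨fu x y hx'.2 hx'.1 hy2.2 hy2.1 hy1.1.symm, by simp [Finset.insert_subset_iff]⟩
    · intro y hy y' hy' hyy
      have hy1 : y ≠ x ∧ y ∈ R := Finset.mem_erase.1 hy
      have hy2 := (memR y).1 hy1.2
      have : y ∈ ({u, x, y'} : Finset V) := by
        have hyy' : ({u, x, y} : Finset V) = {u, x, y'} := hyy
        rw [← hyy']; simp
      simpa [hy1.1, hy2.2] using this
  have h3 : R.card = 3 := by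
    rw [Finset.card_erase_of_mem hx] at hle
    omega
  obtain ⟨x, y, z, hxy, hxz, hyz, hRe⟩ := Finset.card_eq_three.1 h3
  have mx := (memR x).1 (by simp [hRe])
  have my := (memR y).1 (by simp [hRe])
  have mz := (memR z).1 (by simp [hRe])
  have all : ∀ v, v = u ∨ v = w ∨ v = x ∨ v = y ∨ v = z := by
    intro v
    by_cases h1 : v = u
    · exact Or.inl h1
    by_cases h2 : v = w
    · exact Or.inr (Or.inl h2)
    have := (memR v).2 ⟨h2, h1⟩
    rw [hRe] at this
    simp only [Finset.mem_insert, Finset.mem_singleton] at this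
    tauto
  have uxy := fu x y mx.2 mx.1 my.2 my.1 hxy
  have uyz := fu y z my.2 my.1 mz.2 mz.1 hyz
  have uzx := fu z x mz.2 mz.1 mx.2 mx.1 hxz.symm
  have wxy := fw x y mx.1 mx.2 my.1 my.2 hxy
  have wyz := fw y z my.1 my.2 mz.1 mz.2 hyz
  have wzx := fw z x mz.1 mz.2 mx.1 mx.2 hxz.symm
  refine ⟨u, w, x, y, z, ?_, ?_⟩
  · simp [huw, mx.1.symm, mx.2.symm, my.1.symm, my.2.symm, mz.1.symm, mz.2.symm, hxy, hxz, hyz]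
  · ext t
    simp only [Finset.mem_insert, Finset.mem_singleton]
    constructor
    · intro ht
      by_cases hut : u ∈ t
      · have hwt : w ∉ t := fun h => hnadj (T.adj_of_mem ht huw hut h)
        have := T.eq_of_subset_cone ht hut (fun v hv => by
          rcases all v with h | h | h
          · exact Or.inl h
          · exact absurd (h ▸ hv) hwt
          · exact Or.inr h)
        tauto
      by_cases hwt : w ∈ t
      · have := T.eq_of_subset_cone ht hwt (fun v hv => by
          rcases all v with h | h | h
          · exact absurd (h ▸ hv) hut
          · exact Or.inl h
          · exact Or.inr h)
        tauto
      -- the equator is not a face: its edge `xy` already lies in two triangles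
      have hsub : t ⊆ R := fun v hv => (memR v).2
        ⟨by rintro rfl; exact hwt hv, by rintro rfl; exact hut hv⟩
      have hte : t = R := Finset.eq_of_subset_of_card_le hsub (by rw [h3, T.card_triangle t ht])
      have hxt : x ∈ t := by rw [hte, hRe]; simp
      have hyt : y ∈ t := by rw [hte, hRe]; simp
      obtain ⟨s, hs, -, -, -, hall⟩ := T.exists_other_triangle ht hxy hxt hyt
      have h1 := (hall _ uxy (by simp) (by simp)).resolve_left
        (fun h => hut (h ▸ by simp))
      have h2 := (hall _ wxy (by simp) (by simp)).resolve_left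
        (fun h => hwt (h ▸ by simp))
      have : u ∈ ({w, x, y} : Finset V) := by rw [h2, ← h1]; simp
      simp [huw, mx.2.symm, my.2.symm] at this
    · rintro (rfl | rfl | rfl | rfl | rfl | rfl) <;> assumption

end SphereTriangulation

/-! ### Minkowski space -/

/-- Euclidean 3-space, which contains the unit sphere. -/
abbrev E3 := EuclideanSpace ℝ (Fin 3)

/-- Minkowski space of signature `(3, 1)`; the second component is the time. -/
abbrev Mink := E3 × ℝ

/-- The Lorentz form. -/
noncomputable def lor (x y : Mink) : ℝ := inner ℝ x.1 y.1 - x.2 * y.2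

theorem lor_comm (x y : Mink) : lor x y = lor y x := by
  simp only [lor, real_inner_comm, mul_comm]

theorem lor_add_left (x y z : Mink) : lor (x + y) z = lor x z + lor y z := by
  simp only [lor, Prod.fst_add, Prod.snd_add, inner_add_left]; ring

theorem lor_smul_left (a : ℝ) (x z : Mink) : lor (a • x) z = a * lor x z := by
  simp only [lor, Prod.smul_fst, Prod.smul_snd, real_inner_smul_left, smul_eq_mul]; ring

theorem lor_add_right (x y z : Mink) : lor z (x + y) = lor z x + lor z y := by
  simp only [lor_comm z, lor_add_left]

theorem lor_smul_right (a : ℝ) (x z : Mink) : lor z (a • x) = a * lor z x := by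
  simp only [lor_comm z, lor_smul_left]

theorem lor_neg_left (x z : Mink) : lor (-x) z = -lor x z := by
  rw [← neg_one_smul ℝ x, lor_smul_left]; ring

theorem lor_sub_left (x y z : Mink) : lor (x - y) z = lor x z - lor y z := by
  rw [sub_eq_add_neg, lor_add_left, lor_neg_left]; ring

/-- The linear form `x ↦ lor x y`. -/
noncomputable def lorLin (y : Mink) : Mink →ₗ[ℝ] ℝ where
  toFun x := lor x y
  map_add' x z := lor_add_left x z y
  map_smul' a x := lor_smul_left a x y

/-- A vector of the closed future cone and a future timelike vector have negative product. -/
theorem lor_neg_of_timelike {x y : Mink} (hx : ‖x.1‖ ≤ x.2) (hx0 : 0 < x.2) (hy : lor y y < 0)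
    (hy0 : 0 < y.2) : lor x y < 0 := by
  have h1 : ‖y.1‖ < y.2 := by
    rw [lor, real_inner_self_eq_norm_sq] at hy
    exact lt_of_pow_lt_pow_left₀ 2 hy0.le (by nlinarith)
  have h2 := real_inner_le_norm x.1 y.1
  have h3 : ‖x.1‖ * ‖y.1‖ ≤ x.2 * ‖y.1‖ := mul_le_mul_of_nonneg_right hx (norm_nonneg _)
  have h4 : x.2 * ‖y.1‖ < x.2 * y.2 := mul_lt_mul_of_pos_left h1 hx0
  rw [lor]
  linarith

/-- The determinant of the Gram matrix with diagonal entries `1` and off-diagonal entries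
`-x`, `-y`, `-z`. -/
def gramDet (x y z : ℝ) : ℝ := 1 - x ^ 2 - y ^ 2 - z ^ 2 - 2 * x * y * z

theorem gramDet_cos (a b c : ℝ) : gramDet (Real.cos a) (Real.cos b) (Real.cos c) =
    -((Real.cos (a + b) + Real.cos c) * (Real.cos (a - b) + Real.cos c)) := by
  rw [gramDet, Real.cos_add, Real.cos_sub]
  have e : Real.sin a ^ 2 * Real.sin b ^ 2 = (1 - Real.cos a ^ 2) * (1 - Real.cos b ^ 2) := by
    rw [Real.sin_sq, Real.sin_sq]
  linear_combination -e

theorem abs_cos_lt_one {a : ℝ} (ha : a ∈ Set.Ioo 0 Real.pi) :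
    -1 < Real.cos a ∧ Real.cos a < 1 := by
  have h := Real.sin_pos_of_mem_Ioo ha
  have := Real.sin_sq_add_cos_sq a
  constructor <;> nlinarith

/-- The angles of a nondegenerate spherical triangle give a positive Gram determinant. -/
theorem gramDet_pos {a b c : ℝ} (h : Real.pi < a + b + c) (h1 : a + b < c + Real.pi)
    (h2 : b + c < a + Real.pi) (h3 : c + a < b + Real.pi) :
    0 < gramDet (Real.cos a) (Real.cos b) (Real.cos c) := by
  rw [gramDet_cos]
  have e1 : Real.cos (a + b) + Real.cos c < 0 := by
    have : Real.cos (a + b) < Real.cos (Real.pi - c) := by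
      rcases le_total (a + b) Real.pi with h4 | h4
      · exact Real.cos_lt_cos_of_nonneg_of_le_pi (by linarith) h4 (by linarith)
      · rw [← Real.cos_two_pi_sub]
        exact Real.cos_lt_cos_of_nonneg_of_le_pi (by linarith) (by linarith) (by linarith)
    rw [Real.cos_pi_sub] at this
    linarith
  have e2 : 0 < Real.cos (a - b) + Real.cos c := by
    have : Real.cos (Real.pi - c) < Real.cos (a - b) := by
      rw [← Real.cos_abs (a - b)]
      refine Real.cos_lt_cos_of_nonneg_of_le_pi (abs_nonneg _) (by linarith) ?_
      rw [abs_lt]; constructor <;> linarith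
    rw [Real.cos_pi_sub] at this
    linarith
  nlinarith [mul_pos (neg_pos.2 e1) e2]

/-- The angles of a hyperbolic triangle give a negative Gram determinant. -/
theorem gramDet_neg {a b c : ℝ} (ha : a ∈ Set.Ioo 0 Real.pi) (hb : b ∈ Set.Ioo 0 Real.pi)
    (hc : c ∈ Set.Ioo 0 Real.pi) (h : a + b + c < Real.pi) :
    gramDet (Real.cos a) (Real.cos b) (Real.cos c) < 0 := by
  rw [gramDet_cos]
  have e1 : 0 < Real.cos (a + b) + Real.cos c := by
    have := Real.cos_lt_cos_of_nonneg_of_le_pi (by linarith [ha.1, hb.1] : 0 ≤ a + b)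
      (by linarith [hc.1] : Real.pi - c ≤ Real.pi) (by linarith)
    rw [Real.cos_pi_sub] at this
    linarith
  have e2 : 0 < Real.cos (a - b) + Real.cos c := by
    have : Real.cos (Real.pi - c) < Real.cos (a - b) := by
      rw [← Real.cos_abs (a - b)]
      refine Real.cos_lt_cos_of_nonneg_of_le_pi (abs_nonneg _) (by linarith [hc.1]) ?_
      rw [abs_lt]; constructor <;> linarith [ha.1, hb.1]
    rw [Real.cos_pi_sub] at this
    linarith
  nlinarith [mul_pos e1 e2]

/-- A Gram matrix with positive determinant and a positive minor is positive definite. -/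
theorem gram_definite {x y z α β γ : ℝ} (hz : z ^ 2 < 1) (hdet : 0 < gramDet x y z)
    (h : α ^ 2 + β ^ 2 + γ ^ 2 - 2 * z * α * β - 2 * y * α * γ - 2 * x * β * γ ≤ 0) :
    α = 0 ∧ β = 0 ∧ γ = 0 := by
  have e : (1 - z ^ 2) *
      (α ^ 2 + β ^ 2 + γ ^ 2 - 2 * z * α * β - 2 * y * α * γ - 2 * x * β * γ) =
      (1 - z ^ 2) * (α - z * β - y * γ) ^ 2 + ((1 - z ^ 2) * β - (x + y * z) * γ) ^ 2 +
        gramDet x y z * γ ^ 2 := by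
    rw [gramDet]; ring
  have hz' : 0 < 1 - z ^ 2 := by linarith
  have h0 := mul_nonpos_of_nonneg_of_nonpos hz'.le h
  rw [e] at h0
  have t1 : 0 ≤ (1 - z ^ 2) * (α - z * β - y * γ) ^ 2 := by positivity
  have t2 : 0 ≤ ((1 - z ^ 2) * β - (x + y * z) * γ) ^ 2 := by positivity
  have t3 : 0 ≤ gramDet x y z * γ ^ 2 := by positivity
  have g : γ = 0 := by
    have : gramDet x y z * γ ^ 2 = 0 := by linarith
    simpa [hdet.ne'] using this
  subst g
  have b : β = 0 := by
    have : ((1 - z ^ 2) * β - (x + y * z) * 0) ^ 2 = 0 := by linarith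
    simpa [hz'.ne'] using this
  subst b
  have a : (1 - z ^ 2) * (α - z * 0 - y * 0) ^ 2 = 0 := by linarith
  simpa [hz'.ne'] using a

/-- Three vectors with a nondegenerate Gram matrix span Euclidean 3-space. -/
theorem eq_zero_of_gramDet_ne_zero {u v w q : E3} {x y z : ℝ} (hu : inner ℝ u u = (1 : ℝ))
    (hv : inner ℝ v v = (1 : ℝ)) (hw : inner ℝ w w = (1 : ℝ)) (hvw : inner ℝ v w = -x)
    (huw : inner ℝ u w = -y) (huv : inner ℝ u v = -z) (hdet : gramDet x y z ≠ 0)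
    (h1 : inner ℝ u q = (0 : ℝ)) (h2 : inner ℝ v q = (0 : ℝ)) (h3 : inner ℝ w q = (0 : ℝ)) :
    q = 0 := by
  simp only [PiLp.inner_apply, RCLike.inner_apply, conj_trivial, Fin.sum_univ_three] at *
  set M : Matrix (Fin 3) (Fin 3) ℝ := !![u 0, u 1, u 2; v 0, v 1, v 2; w 0, w 1, w 2] with hM
  have hMd : M.det ≠ 0 := by
    intro h0
    apply hdet
    have e : gramDet x y z = M.det ^ 2 := by
      rw [hM, Matrix.det_fin_three, gramDet]
      simp only [Matrix.of_apply, Matrix.cons_val', Matrix.cons_val_zero, Matrix.cons_val_one,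
        Matrix.cons_val, Matrix.cons_val_fin_one]
      have ex : x = -(w 0 * v 0 + w 1 * v 1 + w 2 * v 2) := by linarith
      have ey : y = -(w 0 * u 0 + w 1 * u 1 + w 2 * u 2) := by linarith
      have ez : z = -(v 0 * u 0 + v 1 * u 1 + v 2 * u 2) := by linarith
      have : (1 : ℝ) - x ^ 2 - y ^ 2 - z ^ 2 - 2 * x * y * z =
        (u 0 * u 0 + u 1 * u 1 + u 2 * u 2) * (v 0 * v 0 + v 1 * v 1 + v 2 * v 2) *
          (w 0 * w 0 + w 1 * w 1 + w 2 * w 2) - x ^ 2 * (u 0 * u 0 + u 1 * u 1 + u 2 * u 2)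
          - y ^ 2 * (v 0 * v 0 + v 1 * v 1 + v 2 * v 2)
          - z ^ 2 * (w 0 * w 0 + w 1 * w 1 + w 2 * w 2) - 2 * x * y * z := by
        rw [hu, hv, hw]; ring
      rw [this, ex, ey, ez]
      ring
    rw [e, h0]; ring
  have hq : M.mulVec (fun i => q i) = 0 := by
    ext i
    fin_cases i <;> simp [hM, Matrix.mulVec, dotProduct, Fin.sum_univ_three] <;> linarith
  have := Matrix.eq_zero_of_mulVec_eq_zero hMd hq
  ext i
  exact congrFun this i

/-- Three spacelike vectors with positive definite Gram matrix are orthogonal to a unique future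
timelike direction: three planes of hyperbolic space that form a spherical triangle meet in a
point. -/
theorem exists_timelike_orthogonal {X Y Z : Mink} {x y z : ℝ} (hX : lor X X = 1) (hY : lor Y Y = 1)
    (hZ : lor Z Z = 1) (hYZ : lor Y Z = -x) (hXZ : lor X Z = -y) (hXY : lor X Y = -z)
    (hz : z ^ 2 < 1) (hdet : 0 < gramDet x y z) :
    ∃ p : Mink, ‖p.1‖ < p.2 ∧ lor p X = 0 ∧ lor p Y = 0 ∧ lor p Z = 0 ∧
      ∀ q, lor q X = 0 → lor q Y = 0 → lor q Z = 0 → ∃ β : ℝ, q = β • p := by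
  have hYX := lor_comm Y X ▸ hXY
  have hZX := lor_comm Z X ▸ hXZ
  have hZY := lor_comm Z Y ▸ hYZ
  have hcomb : ∀ α β γ : ℝ, lor (α • X + β • Y + γ • Z) (α • X + β • Y + γ • Z) =
      α ^ 2 + β ^ 2 + γ ^ 2 - 2 * z * α * β - 2 * y * α * γ - 2 * x * β * γ := by
    intro α β γ
    simp only [lor_add_left, lor_add_right, lor_smul_left, lor_smul_right, hX, hY, hZ, hXY, hXZ,
      hYZ, hYX, hZX, hZY]
    ring
  obtain ⟨p, hp, hp0⟩ : ∃ p ∈ LinearMap.ker (LinearMap.pi ![lorLin X, lorLin Y, lorLin Z]),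
      p ≠ 0 := by
    apply Submodule.exists_mem_ne_zero_of_ne_bot
    apply LinearMap.ker_ne_bot_of_finrank_lt
    simp
  have hp' : lor p X = 0 ∧ lor p Y = 0 ∧ lor p Z = 0 := by
    have := LinearMap.mem_ker.1 hp
    exact ⟨congrFun this 0, congrFun this 1, congrFun this 2⟩
  obtain ⟨hpX, hpY, hpZ⟩ := hp'
  have hortho : ∀ α β γ : ℝ, lor p (α • X + β • Y + γ • Z) = 0 := by
    intro α β γ
    simp [lor_add_right, lor_smul_right, hpX, hpY, hpZ]
  have hzero : ∀ α β γ δ : ℝ, α • X + β • Y + γ • Z + δ • p = 0 →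
      α = 0 ∧ β = 0 ∧ γ = 0 ∧ δ = 0 := by
    intro α β γ δ h
    have h1 : lor (α • X + β • Y + γ • Z + δ • p) (α • X + β • Y + γ • Z) = 0 := by
      rw [h]; simp [lor]
    rw [lor_add_left, lor_smul_left, hortho, hcomb] at h1
    rw [mul_zero, add_zero] at h1
    obtain ⟨rfl, rfl, rfl⟩ := gram_definite hz hdet h1.le
    simpa [hp0] using h
  have hspan : ∀ q : Mink, ∃ α β γ δ : ℝ, q = α • X + β • Y + γ • Z + δ • p := by
    have hli : LinearIndependent ℝ ![X, Y, Z, p] := by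
      rw [Fintype.linearIndependent_iff]
      intro g hg
      rw [Fin.sum_univ_four] at hg
      obtain ⟨h0, h1, h2, h3⟩ := hzero (g 0) (g 1) (g 2) (g 3) hg
      intro i
      fin_cases i <;> assumption
    intro q
    have htop := hli.span_eq_top_of_card_eq_finrank' (by simp)
    have hq : q ∈ Submodule.span ℝ (Set.range ![X, Y, Z, p]) := htop ▸ Submodule.mem_top
    obtain ⟨c, hc⟩ := (Submodule.mem_span_range_iff_exists_fun ℝ).1 hq
    rw [Fin.sum_univ_four] at hc
    exact ⟨c 0, c 1, c 2, c 3, hc.symm⟩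
  have hneg : lor p p < 0 := by
    by_contra hcon
    push Not at hcon
    obtain ⟨α, β, γ, δ, h⟩ := hspan (0, 1)
    have h1 : lor ((0, 1) : Mink) (0, 1) = -1 := by simp [lor]
    rw [h, lor_add_left, lor_add_right, hcomb, lor_smul_left, lor_smul_right, lor_add_right,
      lor_smul_right, hortho, lor_comm _ p, hortho] at h1
    have h2 : α ^ 2 + β ^ 2 + γ ^ 2 - 2 * z * α * β - 2 * y * α * γ - 2 * x * β * γ ≤ 0 := by
      nlinarith [mul_nonneg (sq_nonneg δ) hcon]
    obtain ⟨rfl, rfl, rfl⟩ := gram_definite hz hdet h2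
    nlinarith [mul_nonneg (sq_nonneg δ) hcon]
  have huniq : ∀ q, lor q X = 0 → lor q Y = 0 → lor q Z = 0 → ∃ β : ℝ, q = β • p := by
    intro q h1 h2 h3
    obtain ⟨α, β, γ, δ, h⟩ := hspan q
    have h4 : lor q (α • X + β • Y + γ • Z) = 0 := by
      simp [lor_add_right, lor_smul_right, h1, h2, h3]
    rw [h, lor_add_left, lor_smul_left, hortho, hcomb] at h4
    rw [mul_zero, add_zero] at h4
    obtain ⟨rfl, rfl, rfl⟩ := gram_definite hz hdet h4.le
    exact ⟨δ, by simpa using h⟩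
  have hnorm : ‖p.1‖ < |p.2| := by
    rw [lor, real_inner_self_eq_norm_sq] at hneg
    refine lt_of_pow_lt_pow_left₀ 2 (abs_nonneg _) ?_
    rw [sq_abs]; linarith
  rcases le_total 0 p.2 with h | h
  · exact ⟨p, by rwa [abs_of_nonneg h] at hnorm, hpX, hpY, hpZ, huniq⟩
  · refine ⟨-p, by rwa [abs_of_nonpos h, ← norm_neg] at hnorm, ?_, ?_, ?_, ?_⟩
    · simp [lor_neg_left, hpX]
    · simp [lor_neg_left, hpY]
    · simp [lor_neg_left, hpZ]
    · intro q h1 h2 h3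
      obtain ⟨β, rfl⟩ := huniq q h1 h2 h3
      exact ⟨-β, by simp⟩

/-- Three spacelike vectors whose angles are those of a hyperbolic triangle have a timelike
combination with positive coefficients. -/
theorem exists_timelike_combination {X Y Z : Mink} {a b c : ℝ} (ha : a ∈ Set.Ioo 0 Real.pi)
    (hb : b ∈ Set.Ioo 0 Real.pi) (hc : c ∈ Set.Ioo 0 Real.pi) (hsum : a + b + c < Real.pi)
    (hX : lor X X = 1) (hY : lor Y Y = 1)
    (hZ : lor Z Z = 1) (hYZ : lor Y Z = -Real.cos a) (hXZ : lor X Z = -Real.cos b)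
    (hXY : lor X Y = -Real.cos c) :
    ∃ α β γ : ℝ, 0 < α ∧ 0 < β ∧ 0 < γ ∧
      lor (α • X + β • Y + γ • Z) (α • X + β • Y + γ • Z) < 0 := by
  have hdet := gramDet_neg ha hb hc hsum
  have key : ∀ {s t r : ℝ}, s ∈ Set.Ioo 0 Real.pi → t ∈ Set.Ioo 0 Real.pi →
      r ∈ Set.Ioo 0 Real.pi → s + t + r < Real.pi →
      0 < Real.cos s + Real.cos t * Real.cos r := by
    intro s t r hs ht hr h
    have := Real.cos_lt_cos_of_nonneg_of_le_pi hs.1.le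
      (by linarith [ht.1, hr.1] : Real.pi - (t + r) ≤ Real.pi) (by linarith)
    rw [Real.cos_pi_sub, Real.cos_add] at this
    have := mul_pos (Real.sin_pos_of_mem_Ioo ht) (Real.sin_pos_of_mem_Ioo hr)
    linarith
  have hYX := lor_comm Y X ▸ hXY
  have hZX := lor_comm Z X ▸ hXZ
  have hZY := lor_comm Z Y ▸ hYZ
  -- the coefficients form the last column of the adjugate of the Gram matrix
  have hc' : 0 < 1 - Real.cos c ^ 2 := by
    obtain ⟨h1, h2⟩ := abs_cos_lt_one hc
    nlinarith
  refine ⟨Real.cos b + Real.cos c * Real.cos a, Real.cos a + Real.cos b * Real.cos c,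
    1 - Real.cos c ^ 2, key hb hc ha (by linarith), key ha hb hc hsum, hc', ?_⟩
  simp only [lor_add_left, lor_add_right, lor_smul_left, lor_smul_right, hX, hY, hZ, hXY, hXZ,
      hYZ, hYX, hZX, hZY]
  have := mul_neg_of_pos_of_neg hc' hdet
  rw [gramDet] at this
  linarith

theorem exists_orthogonal (a b : E3) :
    ∃ n : E3, n ≠ 0 ∧ inner ℝ a n = (0 : ℝ) ∧ inner ℝ b n = (0 : ℝ) := by
  obtain ⟨n, hn, hn0⟩ : ∃ n ∈ LinearMap.ker (LinearMap.pi
      ![(innerₛₗ ℝ a : E3 →ₗ[ℝ] ℝ), (innerₛₗ ℝ b : E3 →ₗ[ℝ] ℝ)]), n ≠ 0 := by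
    apply Submodule.exists_mem_ne_zero_of_ne_bot
    apply LinearMap.ker_ne_bot_of_finrank_lt
    simp
  have hn' := LinearMap.mem_ker.1 hn
  exact ⟨n, hn0, congrFun hn' 0, congrFun hn' 1⟩

/-! ### Disks on the sphere as spacelike vectors -/

theorem norm_toUnitSphere (z : OnePoint ℂ) : ‖toUnitSphere z‖ = 1 := by
  rw [EuclideanSpace.norm_eq, Real.sqrt_eq_one, Fin.sum_univ_three]
  rcases z with _ | z
  · simp [toUnitSphere]
  · have h : ‖z‖ ^ 2 = z.re ^ 2 + z.im ^ 2 := by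
      rw [Complex.sq_norm, Complex.normSq_apply]; ring
    have h0 : z.re ^ 2 + z.im ^ 2 + 1 ≠ 0 := by positivity
    simp only [toUnitSphere, Real.norm_eq_abs, sq_abs, h, Matrix.cons_val_zero,
      Matrix.cons_val_one, Matrix.cons_val]
    field_simp
    ring

theorem exists_toUnitSphere_eq {y : E3} (hy : ‖y‖ = 1) : ∃ z, toUnitSphere z = y := by
  have hy' : y 0 ^ 2 + y 1 ^ 2 + y 2 ^ 2 = 1 := by
    rw [EuclideanSpace.norm_eq, Real.sqrt_eq_one, Fin.sum_univ_three] at hy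
    simpa using hy
  by_cases h2 : y 2 = 1
  · refine ⟨none, ?_⟩
    rw [h2] at hy'
    have h0 : y 0 = 0 := by nlinarith [sq_nonneg (y 0), sq_nonneg (y 1)]
    have h1 : y 1 = 0 := by nlinarith [sq_nonneg (y 0), sq_nonneg (y 1)]
    ext i
    fin_cases i <;> simp [toUnitSphere, h0, h1, h2]
  · have hne : 1 - y 2 ≠ 0 := fun h => h2 (by linarith)
    refine ⟨some ⟨y 0 / (1 - y 2), y 1 / (1 - y 2)⟩, ?_⟩
    have h : ‖(⟨y 0 / (1 - y 2), y 1 / (1 - y 2)⟩ : ℂ)‖ ^ 2 = (1 + y 2) / (1 - y 2) := by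
      rw [Complex.sq_norm, Complex.normSq_apply]
      field_simp
      linear_combination hy'
    have hs : (1 + y 2) / (1 - y 2) + 1 = 2 / (1 - y 2) := by field_simp; ring
    ext i
    fin_cases i <;> simp only [toUnitSphere, h, hs] <;> simp <;> field_simp; ring

namespace SphericalDisk

variable (D E : SphericalDisk)

/-- The center of a disk as a unit vector. -/
noncomputable def axis : E3 := toUnitSphere D.center

theorem norm_axis : ‖D.axis‖ = 1 := norm_toUnitSphere _

theorem inner_axis_self : inner ℝ D.axis D.axis = (1 : ℝ) := by
  rw [real_inner_self_eq_norm_sq, norm_axis]; norm_num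

theorem sin_radius_pos : 0 < Real.sin D.radius :=
  Real.sin_pos_of_pos_of_lt_pi D.radius_pos D.radius_lt_pi

theorem cos_sphericalDist (z w : OnePoint ℂ) :
    Real.cos (sphericalDist z w) = inner ℝ (toUnitSphere z) (toUnitSphere w) := by
  rw [sphericalDist, InnerProductGeometry.cos_angle, norm_toUnitSphere, norm_toUnitSphere]
  simp

theorem mem_toSet_iff (z : OnePoint ℂ) :
    z ∈ D.toSet ↔ Real.cos D.radius ≤ inner ℝ D.axis (toUnitSphere z) := by
  rw [toSet, Set.mem_ofPred_eq, axis, ← cos_sphericalDist]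
  refine (Real.strictAntiOn_cos.le_iff_ge ⟨D.radius_pos.le, D.radius_lt_pi.le⟩
    ⟨InnerProductGeometry.angle_nonneg _ _, InnerProductGeometry.angle_le_pi _ _⟩).symm

/-- The unit spacelike vector of a disk: the disk consists of the null directions which have
nonnegative product with it. -/
noncomputable def vec : Mink :=
  ((Real.sin D.radius)⁻¹ • D.axis, Real.cos D.radius / Real.sin D.radius)

theorem lor_vec (x : Mink) :
    lor x D.vec = (inner ℝ D.axis x.1 - x.2 * Real.cos D.radius) / Real.sin D.radius := by
  rw [lor, vec, real_inner_smul_right, real_inner_comm]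
  ring

theorem lor_vec_vec : lor D.vec E.vec = -D.inversiveDist E := by
  have h1 := D.sin_radius_pos.ne'
  have h2 := E.sin_radius_pos.ne'
  rw [lor_vec, inversiveDist, cos_sphericalDist, vec, real_inner_smul_right, real_inner_comm]
  change _ = -((_ - inner ℝ D.axis E.axis) / _)
  field_simp
  ring

theorem lor_vec_self : lor D.vec D.vec = 1 := by
  have h1 := D.sin_radius_pos.ne'
  rw [lor_vec, vec, real_inner_smul_right, inner_axis_self]
  field_simp
  rw [← Real.sin_sq_add_cos_sq D.radius]; ring

theorem mem_toSet_iff_lor (z : OnePoint ℂ) :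
    z ∈ D.toSet ↔ 0 ≤ lor (toUnitSphere z, 1) D.vec := by
  rw [mem_toSet_iff, lor_vec, one_mul, le_div_iff₀ D.sin_radius_pos, zero_mul, sub_nonneg]

variable {D E}

theorem inversiveDist_mem {x : ℝ} (h : D.overlapAngle E = x) (hx : x ∈ Set.Ioo 0 Real.pi) :
    D.inversiveDist E = Real.cos x := by
  rw [← h, overlapAngle]
  rw [← h, overlapAngle] at hx
  refine (Real.cos_arccos ?_ ?_).symm
  · by_contra hcon
    rw [Real.arccos_of_le_neg_one (not_le.1 hcon).le] at hx
    exact lt_irrefl _ hx.2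
  · by_contra hcon
    rw [Real.arccos_of_one_le (not_le.1 hcon).le] at hx
    exact lt_irrefl _ hx.1

/-- If two disks are disjoint, then so are the half-spaces of hyperbolic space they bound. -/
theorem lor_neg_of_disjoint (h : ¬ (D.toSet ∩ E.toSet).Nonempty) {x : Mink} (hx : ‖x.1‖ ≤ x.2)
    (hx0 : 0 < x.2) (hE : 0 ≤ lor x E.vec) : lor x D.vec < 0 := by
  by_contra hD
  push Not at hD
  apply h
  -- a direction orthogonal to both axes; moving along it keeps both products
  obtain ⟨n, hn0, hDn, hEn⟩ := exists_orthogonal D.axis E.axis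
  have hnn : 0 < ‖n‖ := norm_pos_iff.2 hn0
  set y : E3 := (x.2)⁻¹ • x.1 with hy
  have hy1 : ‖y‖ ≤ 1 := by
    rw [hy, norm_smul, norm_inv, Real.norm_of_nonneg hx0.le, inv_mul_le_iff₀ hx0, mul_one]
    exact hx
  obtain ⟨s, -, hs⟩ : (1 : ℝ) ∈ (fun s : ℝ => ‖y + s • n‖) '' Set.Icc 0 (2 / ‖n‖) := by
    apply intermediate_value_Icc (by positivity) (by fun_prop)
    refine ⟨by simpa using hy1, ?_⟩
    have h1 : ‖(2 / ‖n‖) • n‖ = 2 := by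
      rw [norm_smul, norm_div, norm_norm, Real.norm_of_nonneg (by norm_num)]
      field_simp
    have h2 := norm_sub_norm_le ((2 / ‖n‖) • n) (-y)
    rw [h1, norm_neg, sub_neg_eq_add, add_comm _ y] at h2
    linarith
  obtain ⟨z, hz⟩ := exists_toUnitSphere_eq hs
  have key : ∀ F : SphericalDisk, inner ℝ F.axis n = (0 : ℝ) → 0 ≤ lor x F.vec → z ∈ F.toSet := by
    intro F hFn hF
    rw [lor_vec, le_div_iff₀ F.sin_radius_pos, zero_mul, sub_nonneg] at hF
    rw [mem_toSet_iff, hz]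
    simp only [inner_add_right, inner_smul_right, hFn, mul_zero, add_zero, hy]
    rwa [le_inv_mul_iff₀ hx0]
  exact ⟨z, key D hDn hD, key E hEn hE⟩

end SphericalDisk

/-! ### Irreducible patterns cover the sphere -/

namespace CirclePattern

variable {V : Type*} [Fintype V] [DecidableEq V] {T : SphereTriangulation V} {P : CirclePattern V}

theorem lor_vec_edge (hW : P.overlapAngles T.skeleton ∈ T.W) {u w : V}
    (h : T.skeleton.Adj u w) : lor (P u).vec (P w).vec =
      -Real.cos (P.overlapAngles T.skeleton (SphereTriangulation.edge h)) := by
  rw [SphericalDisk.lor_vec_vec,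
    SphericalDisk.inversiveDist_mem rfl (hW.1 (SphereTriangulation.edge h))]
  rfl

/-- The vertex of the hyperbolic polyhedron which corresponds to a face of the triangulation. -/
theorem exists_vertex (hW : P.overlapAngles T.skeleton ∈ T.W) {t : Finset V}
    (ht : t ∈ T.triangles) : ∃ p : Mink, ‖p.1‖ < p.2 ∧ (∀ v ∈ t, lor p (P v).vec = 0) ∧
      ∀ q, (∀ v ∈ t, lor q (P v).vec = 0) → ∃ β : ℝ, q = β • p := by
  obtain ⟨a, b, c, hab, hac, hbc, rfl⟩ := Finset.card_eq_three.1 (T.card_triangle t ht)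
  have h1 := T.adj_of_mem ht hab (by simp) (by simp)
  have h2 := T.adj_of_mem ht hbc (by simp) (by simp)
  have h3 := T.adj_of_mem ht hac.symm (by simp) (by simp)
  obtain ⟨c1, c2, c3, c4⟩ := hW.2.2.1 a b c h1 h2 h3 ht
  have hz := abs_cos_lt_one (hW.1 (SphereTriangulation.edge h1))
  obtain ⟨p, hp, e1, e2, e3, hq⟩ := exists_timelike_orthogonal (P a).lor_vec_self
    (P b).lor_vec_self (P c).lor_vec_self (lor_vec_edge hW h2)
    (lor_comm (P c).vec _ ▸ lor_vec_edge hW h3) (lor_vec_edge hW h1) (by nlinarith)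
    (gramDet_pos (by linarith) (by linarith) (by linarith) (by linarith))
  refine ⟨p, hp, by simp [e1, e2, e3], fun q h => hq q (h a (by simp)) (h b (by simp))
    (h c (by simp))⟩

/-- Three disks around a separating 3-cycle bound half-spaces without a common point, since
otherwise these three disks would cover the sphere. -/
theorem not_lor_nonneg_of_not_face (hV : 4 < Fintype.card V) (hirr : P.Irreducible)
    (hW : P.overlapAngles T.skeleton ∈ T.W) {a b c : V} (hab : T.skeleton.Adj a b)
    (hbc : T.skeleton.Adj b c) (hca : T.skeleton.Adj c a)
    (hface : ({a, b, c} : Finset V) ∉ T.triangles) {x : Mink} (hx : ‖x.1‖ ≤ x.2) (hx0 : 0 < x.2)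
    (ha : 0 ≤ lor x (P a).vec) (hb : 0 ≤ lor x (P b).vec) : lor x (P c).vec < 0 := by
  by_contra hc
  push Not at hc
  have hsep := T.separates_three_cycle hab hbc hca hface
  have hsum := hW.2.2.2.1 a b c hab hbc hca hsep
  obtain ⟨α, β, γ, hα, hβ, hγ, hneg⟩ := exists_timelike_combination (hW.1 _) (hW.1 _) (hW.1 _)
    (by linarith) (P a).lor_vec_self
    (P b).lor_vec_self (P c).lor_vec_self (lor_vec_edge hW hbc)
    (lor_comm (P c).vec _ ▸ lor_vec_edge hW hca) (lor_vec_edge hW hab)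
  have hcomb : ∀ z : Mink, lor z (α • (P a).vec + β • (P b).vec + γ • (P c).vec) =
      α * lor z (P a).vec + β * lor z (P b).vec + γ * lor z (P c).vec := by
    intro z
    simp only [lor_add_right, lor_smul_right]
  set y := α • (P a).vec + β • (P b).vec + γ • (P c).vec with hy
  rcases lt_or_ge 0 y.2 with h0 | h0
  · have := lor_neg_of_timelike hx hx0 hneg h0
    rw [hcomb] at this
    nlinarith [mul_nonneg hα.le ha, mul_nonneg hβ.le hb, mul_nonneg hγ.le hc]
  · have h0' : 0 < (-y).2 := by
      rcases h0.lt_or_eq with h | h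
      · simpa using h
      · rw [lor, real_inner_self_eq_norm_sq, h] at hneg
        nlinarith [sq_nonneg ‖y.1‖]
    have hcov : (⋃ v ∈ ({a, b, c} : Set V), (P v).toSet) = Set.univ := by
      rw [Set.eq_univ_iff_forall]
      intro z
      have h1 : lor (toUnitSphere z, 1) (-y) < 0 := by
        refine lor_neg_of_timelike (norm_toUnitSphere z).le one_pos ?_ h0'
        rw [lor_neg_left, lor_comm, lor_neg_left]
        linarith
      rw [lor_comm, lor_neg_left, lor_comm, hcomb] at h1
      simp only [Set.mem_insert_iff, Set.mem_singleton_iff, Set.iUnion_iUnion_eq_or_left,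
        Set.iUnion_iUnion_eq_left, Set.mem_union, SphericalDisk.mem_toSet_iff_lor]
      by_contra hcon
      push Not at hcon
      nlinarith [mul_pos_of_neg_of_neg (neg_lt_zero.2 hα) hcon.1,
        mul_pos_of_neg_of_neg (neg_lt_zero.2 hβ) hcon.2.1,
        mul_pos_of_neg_of_neg (neg_lt_zero.2 hγ) hcon.2.2]
    refine (hirr {a, b, c} ?_).ne hcov
    refine Set.ssubset_univ_iff.2 fun he => ?_
    have : (Finset.univ : Finset V) ⊆ {a, b, c} := by
      intro v _
      have : v ∈ ({a, b, c} : Set V) := he ▸ Set.mem_univ v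
      simpa using this
    have := (Finset.card_le_card this).trans Finset.card_le_three
    rw [Finset.card_univ] at this
    omega

/-- Local convexity: the vertex of a face lies strictly outside the disk of the vertex opposite
to it across an edge. -/
theorem lor_neg_of_adjacent_faces (hV : 4 < Fintype.card V) (hirr : P.Irreducible)
    (hcontact : P.contactGraph = T.skeleton)
    (hW : P.overlapAngles T.skeleton ∈ T.W) {a b c : V} {t t' : Finset V} (ht : t ∈ T.triangles)
    (ht' : t' ∈ T.triangles) (hab : a ≠ b) (hac : a ≠ c) (hbc : b ≠ c)
    (hta : a ∈ t) (htb : b ∈ t) (htc : c ∈ t)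
    (ha : a ∈ t') (hb : b ∈ t') (htt : t' ≠ t) {p : Mink} (hp : ‖p.1‖ < p.2)
    (hpt : ∀ v ∈ t', lor p (P v).vec = 0) : lor p (P c).vec < 0 := by
  have hp0 : 0 < p.2 := (norm_nonneg _).trans_lt hp
  obtain ⟨c', h1, h2, rfl⟩ := T.exists_eq_of_mem_triangles ht hab hta htb
  obtain rfl : c = c' := by simpa [hac.symm, hbc.symm] using htc
  obtain ⟨d, hda, hdb, rfl⟩ := T.exists_eq_of_mem_triangles ht' hab ha hb
  have hcd : c ≠ d := by rintro rfl; exact htt rfl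
  have pa := hpt a (by simp)
  have pb := hpt b (by simp)
  have pd := hpt d (by simp)
  by_cases hadj : T.skeleton.Adj c d
  · have hac' := T.adj_of_mem ht hac (by simp) (by simp)
    have hbc' := T.adj_of_mem ht hbc (by simp) (by simp)
    have had' := T.adj_of_mem ht' hda.symm (by simp) (by simp)
    have hbd' := T.adj_of_mem ht' hdb.symm (by simp) (by simp)
    rcases T.not_mem_or_not_mem_of_four_clique hV hab hac hda.symm hbc hdb.symm hcd ht ht' with
      h | h
    · exact not_lor_nonneg_of_not_face hV hirr hW had' hadj.symm hac'.symm
        (by rwa [Finset.pair_comm]) hp.le hp0 pa.ge pd.ge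
    · exact not_lor_nonneg_of_not_face hV hirr hW hbd' hadj.symm hbc'.symm
        (by rwa [Finset.pair_comm]) hp.le hp0 pb.ge pd.ge
  · rw [← hcontact] at hadj
    exact SphericalDisk.lor_neg_of_disjoint (fun h => hadj ⟨hcd, h⟩) hp.le hp0 pd.ge

/-- Local convexity implies that the polyhedron is compact, hence that the disks cover the sphere
(and even the exterior of the ball). The argument is the simplex method: a vertex at which a
linear functional is at least as large as at the adjacent vertices maximises it on the whole
polyhedron. -/
theorem exists_lor_pos (hV : 4 < Fintype.card V) (hirr : P.Irreducible)
    (hcontact : P.contactGraph = T.skeleton)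
    (hW : P.overlapAngles T.skeleton ∈ T.W) {x : Mink} (hx0 : 0 < x.2) (hx : x.2 ≤ ‖x.1‖) :
    ∃ v, 0 < lor x (P v).vec := by
  by_contra hcon
  push Not at hcon
  have hex : ∀ t : Finset V, ∃ p : Mink, t ∈ T.triangles → ‖p.1‖ < p.2 ∧
      (∀ v ∈ t, lor p (P v).vec = 0) ∧
      ∀ q, (∀ v ∈ t, lor q (P v).vec = 0) → ∃ β : ℝ, q = β • p := by
    intro t
    by_cases ht : t ∈ T.triangles
    · obtain ⟨p, hp⟩ := exists_vertex hW ht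
      exact ⟨p, fun _ => hp⟩
    · exact ⟨0, fun h => absurd h ht⟩
  choose p hp using hex
  have hne : T.triangles.Nonempty := by
    have : 0 < Fintype.card V := by omega
    obtain ⟨v⟩ := Fintype.card_pos_iff.1 this
    obtain ⟨t, ht, -⟩ := T.vertex_mem v
    exact ⟨t, ht⟩
  obtain ⟨t, ht, hmax⟩ := T.triangles.exists_max_image (fun t => inner ℝ (p t).1 x.1 / (p t).2) hne
  set M : ℝ := inner ℝ (p t).1 x.1 / (p t).2 with hM
  have hpos : ∀ s ∈ T.triangles, 0 < (p s).2 := fun s hs => (norm_nonneg _).trans_lt (hp s hs).1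
  have hxpos : 0 < ‖x.1‖ := hx0.trans_le hx
  have hM1 : M < ‖x.1‖ := by
    rw [hM, div_lt_iff₀ (hpos t ht)]
    calc inner ℝ (p t).1 x.1 ≤ ‖(p t).1‖ * ‖x.1‖ := real_inner_le_norm _ _
      _ < (p t).2 * ‖x.1‖ := mul_lt_mul_of_pos_right (hp t ht).1 hxpos
      _ = _ := mul_comm _ _
  set φ : Mink → ℝ := fun y => inner ℝ y.1 x.1 - M * y.2 with hφ
  have hφt : φ (p t) = 0 := by
    have := (hpos t ht).ne'
    simp only [hφ, hM]
    field_simp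
    ring
  have hφs : ∀ s ∈ T.triangles, φ (p s) ≤ 0 := by
    intro s hs
    have := hmax s hs
    rw [div_le_iff₀ (hpos s hs)] at this
    simp only [hφ]
    linarith
  obtain ⟨a, b, c, hab, hac, hbc, habc⟩ := Finset.card_eq_three.1 (T.card_triangle t ht)
  have hat : a ∈ t := by simp [habc]
  have hbt : b ∈ t := by simp [habc]
  have hct : c ∈ t := by simp [habc]
  obtain ⟨ta, hta, hta', hab1, hac1, -⟩ := T.exists_other_triangle ht hbc hbt hct
  obtain ⟨tb, htb, htb', hba1, hbc1, -⟩ := T.exists_other_triangle ht hac hat hct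
  obtain ⟨tc, htc, htc', hca1, hcb1, -⟩ := T.exists_other_triangle ht hab hat hbt
  have na := lor_neg_of_adjacent_faces hV hirr hcontact hW ht hta hbc hab.symm hac.symm hbt hct hat
    hab1 hac1 hta' (hp ta hta).1 (hp ta hta).2.1
  have nb := lor_neg_of_adjacent_faces hV hirr hcontact hW ht htb hac hab hbc.symm hat hct hbt
    hba1 hbc1 htb' (hp tb htb).1 (hp tb htb).2.1
  have nc := lor_neg_of_adjacent_faces hV hirr hcontact hW ht htc hab hac hbc hat hbt hct
    hca1 hcb1 htc' (hp tc htc).1 (hp tc htc).2.1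
  set βa := lor x (P a).vec / lor (p ta) (P a).vec with hβa
  set βb := lor x (P b).vec / lor (p tb) (P b).vec with hβb
  set βc := lor x (P c).vec / lor (p tc) (P c).vec with hβc
  have ha0 : 0 ≤ βa := div_nonneg_of_nonpos (hcon a) na.le
  have hb0 : 0 ≤ βb := div_nonneg_of_nonpos (hcon b) nb.le
  have hc0 : 0 ≤ βc := div_nonneg_of_nonpos (hcon c) nc.le
  obtain ⟨α, hα⟩ := (hp t ht).2.2 (x - (βa • p ta + βb • p tb + βc • p tc)) (by
    intro v hv
    have hv' : v = a ∨ v = b ∨ v = c := by simpa [habc] using hv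
    rw [lor_sub_left, lor_add_left, lor_add_left, lor_smul_left, lor_smul_left, lor_smul_left]
    rcases hv' with rfl | rfl | rfl
    · rw [(hp tb htb).2.1 v hba1, (hp tc htc).2.1 v hca1, hβa, div_mul_cancel₀ _ na.ne]
      ring
    · rw [(hp ta hta).2.1 v hab1, (hp tc htc).2.1 v hcb1, hβb, div_mul_cancel₀ _ nb.ne]
      ring
    · rw [(hp ta hta).2.1 v hac1, (hp tb htb).2.1 v hbc1, hβc, div_mul_cancel₀ _ nc.ne]
      ring)
  have hxe : x = α • p t + βa • p ta + βb • p tb + βc • p tc := by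
    rw [← hα]; abel
  have hlin : φ x = α * φ (p t) + βa * φ (p ta) + βb * φ (p tb) + βc * φ (p tc) := by
    have hadd : ∀ y z, φ (y + z) = φ y + φ z := by
      intro y z
      simp only [hφ, Prod.fst_add, Prod.snd_add, inner_add_left]; ring
    have hsm : ∀ (r : ℝ) y, φ (r • y) = r * φ y := by
      intro r y
      simp only [hφ, Prod.smul_fst, Prod.smul_snd, real_inner_smul_left, smul_eq_mul]; ring
    conv_lhs => rw [hxe]
    rw [hadd, hadd, hadd, hsm, hsm, hsm, hsm]
  have h1 : φ x ≤ 0 := by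
    rw [hlin, hφt]
    nlinarith [mul_nonneg ha0 (neg_nonneg.2 (hφs ta hta)),
      mul_nonneg hb0 (neg_nonneg.2 (hφs tb htb)),
      mul_nonneg hc0 (neg_nonneg.2 (hφs tc htc))]
  simp only [hφ, real_inner_self_eq_norm_sq] at h1
  nlinarith [mul_lt_mul_of_pos_right hM1 hx0, mul_le_mul_of_nonneg_left hx hxpos.le]

end CirclePattern

/-! ### The topology of the Riemann sphere -/

theorem toUnitSphere_injective : Function.Injective toUnitSphere := by
  have hlt : ∀ z : ℂ, toUnitSphere (some z) 2 < 1 := by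
    intro z
    simp only [toUnitSphere, Matrix.cons_val]
    rw [div_lt_one (by positivity)]
    linarith
  have hinv : ∀ z : ℂ, z = ⟨toUnitSphere (some z) 0 / (1 - toUnitSphere (some z) 2),
      toUnitSphere (some z) 1 / (1 - toUnitSphere (some z) 2)⟩ := by
    intro z
    have h0 : ‖z‖ ^ 2 + 1 ≠ 0 := by positivity
    have h1 : 1 - (‖z‖ ^ 2 - 1) / (‖z‖ ^ 2 + 1) = 2 / (‖z‖ ^ 2 + 1) := by
      field_simp; ring
    apply Complex.ext <;>
      simp only [toUnitSphere, Matrix.cons_val_zero, Matrix.cons_val_one, Matrix.cons_val, h1] <;>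
      field_simp
  intro z w h
  rcases z with _ | z <;> rcases w with _ | w
  · rfl
  · have := hlt w
    rw [← h] at this
    simp [toUnitSphere] at this
  · have := hlt z
    rw [h] at this
    simp [toUnitSphere] at this
  · exact congrArg some ((hinv z).trans (by rw [h, ← hinv w]))

theorem continuous_toUnitSphere : Continuous toUnitSphere := by
  rw [OnePoint.continuous_iff]
  constructor
  · rw [tendsto_iff_norm_sub_tendsto_zero]
    have hn : ∀ z : ℂ, ‖toUnitSphere (z : OnePoint ℂ) - toUnitSphere OnePoint.infty‖ =
        Real.sqrt (4 / (‖z‖ ^ 2 + 1)) := by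
      intro z
      have h0 : ‖z‖ ^ 2 + 1 ≠ 0 := by positivity
      have hi : inner ℝ (toUnitSphere (z : OnePoint ℂ)) (toUnitSphere OnePoint.infty) =
          (‖z‖ ^ 2 - 1) / (‖z‖ ^ 2 + 1) := by
        change inner ℝ (toUnitSphere (some z)) (toUnitSphere none) = _
        simp [toUnitSphere, PiLp.inner_apply, Fin.sum_univ_three]
      rw [eq_comm, Real.sqrt_eq_iff_mul_self_eq (by positivity) (norm_nonneg _),
        ← pow_two, norm_sub_sq_real, norm_toUnitSphere, norm_toUnitSphere, hi]
      field_simp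
      ring
    simp only [hn]
    rw [← Real.sqrt_zero]
    refine (Real.continuous_sqrt.tendsto 0).comp ?_
    rw [Filter.coclosedCompact_eq_cocompact]
    refine Tendsto.div_atTop tendsto_const_nhds ?_
    exact tendsto_atTop_add_const_right _ _
      ((tendsto_pow_atTop two_ne_zero).comp (tendsto_norm_cocompact_atTop (E := ℂ)))
  · change Continuous fun z : ℂ => toUnitSphere (some z)
    have h0 : ∀ z : ℂ, ‖z‖ ^ 2 + 1 ≠ 0 := fun z => by positivity
    refine (PiLp.continuous_toLp 2 _).comp (continuous_pi fun i => ?_)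
    fin_cases i
    · exact (continuous_const.mul Complex.continuous_re).div (by fun_prop) h0
    · exact (continuous_const.mul Complex.continuous_im).div (by fun_prop) h0
    · exact Continuous.div (f := fun z : ℂ => ‖z‖ ^ 2 - 1) (by fun_prop) (by fun_prop) h0

theorem tendsto_of_tendsto_toUnitSphere {ι : Type*} {l : Filter ι} {z : ι → OnePoint ℂ}
    {w : OnePoint ℂ} (h : Tendsto (fun n => toUnitSphere (z n)) l (𝓝 (toUnitSphere w))) :
    Tendsto z l (𝓝 w) :=
  ((continuous_toUnitSphere.isClosedEmbedding toUnitSphere_injective).isInducing.tendsto_nhds_iff).2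
    h

/-! ### Normalisation by similarities -/

theorem lor_eq_coord (x y : Mink) :
    lor x y = x.1 0 * y.1 0 + x.1 1 * y.1 1 + x.1 2 * y.1 2 - x.2 * y.2 := by
  simp only [lor, PiLp.inner_apply, RCLike.inner_apply, conj_trivial, Fin.sum_univ_three]
  ring

/-- Every unit spacelike vector belongs to a disk. -/
theorem exists_disk_of_lor_self_eq_one {Y : Mink} (hY : lor Y Y = 1) :
    ∃ D : SphericalDisk, D.vec = Y := by
  have hn : ‖Y.1‖ ^ 2 = 1 + Y.2 ^ 2 := by
    rw [lor, real_inner_self_eq_norm_sq] at hY; linarith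
  have hpos : 0 < ‖Y.1‖ := by
    rcases (norm_nonneg Y.1).eq_or_lt with h | h
    · rw [← h] at hn; nlinarith [sq_nonneg Y.2]
    · exact h
  have hlt : |Y.2 / ‖Y.1‖| < 1 := by
    rw [abs_div, abs_of_pos hpos, div_lt_one hpos]
    refine lt_of_pow_lt_pow_left₀ 2 hpos.le ?_
    rw [sq_abs]; linarith
  rw [abs_lt] at hlt
  obtain ⟨z, hz⟩ := exists_toUnitSphere_eq (y := (‖Y.1‖)⁻¹ • Y.1) (by
    rw [norm_smul, norm_inv, norm_norm, inv_mul_cancel₀ hpos.ne'])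
  have hsin : Real.sin (Real.arccos (Y.2 / ‖Y.1‖)) = (‖Y.1‖)⁻¹ := by
    rw [Real.sin_arccos, Real.sqrt_eq_iff_mul_self_eq _ (by positivity)]
    · field_simp; linarith
    · nlinarith
  refine ⟨⟨z, Real.arccos (Y.2 / ‖Y.1‖), Real.arccos_pos.2 hlt.2, ?_⟩, ?_⟩
  · refine lt_of_le_of_ne (Real.arccos_le_pi _) fun h => ?_
    rw [h, Real.sin_pi] at hsin
    exact (inv_pos.2 hpos).ne hsin
  · apply Prod.ext
    · simp only [SphericalDisk.vec, SphericalDisk.axis, hsin, hz, inv_inv, smul_smul]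
      rw [mul_inv_cancel₀ hpos.ne', one_smul]
    · simp only [SphericalDisk.vec, hsin]
      rw [Real.cos_arccos hlt.1.le hlt.2.le]
      field_simp

/-- The Lorentz transformation induced by the similarity `z ↦ (z - β) / l` of the plane. A vector
`X` corresponds to the inequality `A |z|² + 2 Re (B̄ z) + C ≥ 0` with `A = X₂ - X₃`,
`B = X₀ + i X₁` and `C = -(X₂ + X₃)`, and the coefficients are transformed by substitution. -/
noncomputable def similarityLorentz (β : ℂ) (l : ℝ) (X : Mink) : Mink :=
  (!₂[X.1 0 + (X.1 2 - X.2) * β.re, X.1 1 + (X.1 2 - X.2) * β.im,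
    (l * (X.1 2 - X.2) - ((X.1 2 - X.2) * (β.re ^ 2 + β.im ^ 2) +
      2 * (X.1 0 * β.re + X.1 1 * β.im) - (X.1 2 + X.2)) / l) / 2],
    -(l * (X.1 2 - X.2) + ((X.1 2 - X.2) * (β.re ^ 2 + β.im ^ 2) +
      2 * (X.1 0 * β.re + X.1 1 * β.im) - (X.1 2 + X.2)) / l) / 2)

theorem lor_similarityLorentz (β : ℂ) {l : ℝ} (hl : 0 < l) (X Y : Mink) :
    lor (similarityLorentz β l X) (similarityLorentz β l Y) = lor X Y := by
  simp only [lor_eq_coord, similarityLorentz, Matrix.cons_val_zero, Matrix.cons_val_one,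
    Matrix.cons_val]
  field_simp
  ring

theorem lor_toUnitSphere_coe (z : ℂ) (X : Mink) :
    lor (toUnitSphere (some z), 1) X = ((X.1 2 - X.2) * (z.re ^ 2 + z.im ^ 2) +
      2 * (X.1 0 * z.re + X.1 1 * z.im) - (X.1 2 + X.2)) / (‖z‖ ^ 2 + 1) := by
  have h : ‖z‖ ^ 2 = z.re ^ 2 + z.im ^ 2 := by
    rw [Complex.sq_norm, Complex.normSq_apply]; ring
  have h0 : z.re ^ 2 + z.im ^ 2 + 1 ≠ 0 := by positivity
  simp only [lor_eq_coord, toUnitSphere, Matrix.cons_val_zero, Matrix.cons_val_one,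
    Matrix.cons_val, h]
  field_simp
  ring

/-- A point of hyperbolic space can be moved to the origin by a Möbius map: the planes through it
become planes through the origin, and the corresponding disks become hemispheres. -/
theorem exists_normalizing_map {p : Mink} (hp : ‖p.1‖ < p.2) :
    ∃ (f : OnePoint ℂ → OnePoint ℂ) (F : SphericalDisk → SphericalDisk),
      IsMobiusOrAntiMobius f ∧ Function.Injective f ∧ (∀ D, (F D).toSet = f '' D.toSet) ∧
      (∀ D E, lor (F D).vec (F E).vec = lor D.vec E.vec) ∧
      ∀ D : SphericalDisk, lor p D.vec = 0 → (F D).radius = Real.pi / 2 := by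
  have hn : p.1 0 ^ 2 + p.1 1 ^ 2 + p.1 2 ^ 2 < p.2 ^ 2 := by
    have h1 : ‖p.1‖ ^ 2 < p.2 ^ 2 := pow_lt_pow_left₀ hp (norm_nonneg _) two_ne_zero
    rw [EuclideanSpace.norm_sq_eq, Fin.sum_univ_three] at h1
    simpa using h1
  have hp0 : 0 < p.2 := (norm_nonneg _).trans_lt hp
  obtain ⟨k, hk⟩ : ∃ k, k = p.2 - p.1 2 := ⟨_, rfl⟩
  have hk0 : 0 < k := by nlinarith [sq_nonneg (p.1 0), sq_nonneg (p.1 1)]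
  -- the coordinates of the point in the upper half-space
  obtain ⟨β, hβ⟩ : ∃ β : ℂ, β = ⟨p.1 0 / k, p.1 1 / k⟩ := ⟨_, rfl⟩
  have hl2 : 0 < (p.2 ^ 2 - (p.1 0 ^ 2 + p.1 1 ^ 2 + p.1 2 ^ 2)) / k ^ 2 :=
    div_pos (by linarith) (by positivity)
  obtain ⟨l, hl⟩ : ∃ l, l = Real.sqrt ((p.2 ^ 2 - (p.1 0 ^ 2 + p.1 1 ^ 2 + p.1 2 ^ 2)) / k ^ 2) :=
    ⟨_, rfl⟩
  have hl0 : 0 < l := hl ▸ Real.sqrt_pos.2 hl2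
  have hlsq : l ^ 2 = (p.2 ^ 2 - (p.1 0 ^ 2 + p.1 1 ^ 2 + p.1 2 ^ 2)) / k ^ 2 := by
    rw [hl, Real.sq_sqrt hl2.le]
  have hlc : (l : ℂ) ≠ 0 := by exact_mod_cast hl0.ne'
  obtain ⟨g, hg⟩ : ∃ g : GL (Fin 2) ℂ, (g : Matrix (Fin 2) (Fin 2) ℂ) = !![1, -β; 0, (l : ℂ)] :=
    ⟨Matrix.GeneralLinearGroup.mkOfDetNeZero !![1, -β; 0, (l : ℂ)] (by
      rw [Matrix.det_fin_two_of]; simpa using hlc), rfl⟩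
  have hgz : ∀ z : ℂ, g • (z : OnePoint ℂ) = (((z - β) / l : ℂ) : OnePoint ℂ) := by
    intro z
    have := OnePoint.smul_some_eq_ite (g := g) (k := z)
    simp only [hg] at this
    refine this.trans ?_
    simp [hlc, sub_eq_add_neg]
  have hginf : g • (OnePoint.infty : OnePoint ℂ) = OnePoint.infty := by
    rw [OnePoint.smul_infty_eq_self_iff]
    simp [hg]
  have hF : ∀ D : SphericalDisk, ∃ D' : SphericalDisk, D'.vec = similarityLorentz β l D.vec :=
    fun D => exists_disk_of_lor_self_eq_one (by rw [lor_similarityLorentz β hl0, D.lor_vec_self])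
  choose F hF using hF
  have hmem : ∀ D z, g • z ∈ (F D).toSet ↔ z ∈ D.toSet := by
    intro D z
    rw [SphericalDisk.mem_toSet_iff_lor, SphericalDisk.mem_toSet_iff_lor, hF]
    generalize D.vec = X
    rcases z with _ | z
    · change 0 ≤ lor (toUnitSphere (g • OnePoint.infty), 1) _ ↔ _
      rw [hginf]
      change 0 ≤ lor (toUnitSphere none, 1) _ ↔ _
      have e : lor (toUnitSphere none, 1) (similarityLorentz β l X) =
          l * lor (toUnitSphere none, 1) X := by
        simp only [lor_eq_coord, similarityLorentz, toUnitSphere, Matrix.cons_val_zero,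
          Matrix.cons_val_one, Matrix.cons_val]
        field_simp
        ring
      rw [e, mul_nonneg_iff_of_pos_left hl0]
    · change 0 ≤ lor (toUnitSphere (g • (z : OnePoint ℂ)), 1) _ ↔ _
      rw [hgz]
      change 0 ≤ lor (toUnitSphere (some ((z - β) / l)), 1) _ ↔ _
      rw [lor_toUnitSphere_coe, lor_toUnitSphere_coe, le_div_iff₀ (by positivity),
        le_div_iff₀ (by positivity), zero_mul, zero_mul]
      have hre : ((z - β) / l).re = (z.re - β.re) / l := by
        rw [Complex.div_ofReal_re, Complex.sub_re]
      have him : ((z - β) / l).im = (z.im - β.im) / l := by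
        rw [Complex.div_ofReal_im, Complex.sub_im]
      rw [hre, him]
      rw [← mul_nonneg_iff_of_pos_left hl0 (b := (_ : ℝ))]
      refine iff_of_eq (congrArg (0 ≤ ·) ?_)
      simp only [similarityLorentz, Matrix.cons_val_zero, Matrix.cons_val_one, Matrix.cons_val]
      field_simp
      ring
  refine ⟨(g • ·), F, ⟨g, Or.inl fun _ => rfl⟩, MulAction.injective g, ?_, ?_, ?_⟩
  · intro D
    ext w
    constructor
    · intro hw
      refine ⟨g⁻¹ • w, ?_, smul_inv_smul g w⟩
      rwa [← hmem, smul_inv_smul]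
    · rintro ⟨z, hz, rfl⟩
      exact (hmem D z).2 hz
  · intro D E
    rw [hF, hF, lor_similarityLorentz β hl0]
  · intro D hD
    have h2 : (F D).vec.2 = 0 := by
      rw [hF]
      rw [lor_eq_coord] at hD
      generalize D.vec = X at hD
      simp only [similarityLorentz]
      have e : l * (X.1 2 - X.2) + ((X.1 2 - X.2) * (β.re ^ 2 + β.im ^ 2) +
          2 * (X.1 0 * β.re + X.1 1 * β.im) - (X.1 2 + X.2)) / l = 0 := by
        have : l ^ 2 * (X.1 2 - X.2) + ((X.1 2 - X.2) * (β.re ^ 2 + β.im ^ 2) +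
          2 * (X.1 0 * β.re + X.1 1 * β.im) - (X.1 2 + X.2)) = 0 := by
          rw [hlsq, hβ]
          simp only
          field_simp
          rw [hk]
          linear_combination 2 * (p.2 - p.1 2) * hD
        field_simp
        linarith
      rw [neg_div, e]; norm_num
    have hc : Real.cos (F D).radius = 0 := by
      have := (F D).sin_radius_pos.ne'
      simpa [SphericalDisk.vec, this] using h2
    rw [← Real.arccos_cos (F D).radius_pos.le (F D).radius_lt_pi.le, hc, Real.arccos_zero]

/-! ### Spherical geometry -/

theorem inner_self_of_norm_one {a : E3} (ha : ‖a‖ = 1) : inner ℝ a a = (1 : ℝ) := by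
  rw [real_inner_self_eq_norm_sq, ha]; norm_num

theorem arccos_inner_eq_angle {a b : E3} (ha : ‖a‖ = 1) (hb : ‖b‖ = 1) :
    Real.arccos (inner ℝ a b) = InnerProductGeometry.angle a b := by
  rw [InnerProductGeometry.angle, ha, hb]; simp

theorem cos_arccos_inner {a b : E3} (ha : ‖a‖ = 1) (hb : ‖b‖ = 1) :
    Real.cos (Real.arccos (inner ℝ a b)) = inner ℝ a b := by
  rw [arccos_inner_eq_angle ha hb, InnerProductGeometry.cos_angle, ha, hb]; simp

theorem arccos_inner_triangle {a b c : E3} (ha : ‖a‖ = 1) (hb : ‖b‖ = 1) (hc : ‖c‖ = 1) :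
    Real.arccos (inner ℝ a c) ≤ Real.arccos (inner ℝ a b) + Real.arccos (inner ℝ b c) := by
  rw [arccos_inner_eq_angle ha hc, arccos_inner_eq_angle ha hb, arccos_inner_eq_angle hb hc]
  exact InnerProductGeometry.angle_le_angle_add_angle a b c

/-- On the great circle through `a` and `b` there is a point at signed distance `s` from `a`. -/
theorem exists_point_on_geodesic {a b : E3} (ha : ‖a‖ = 1) (hb : ‖b‖ = 1) {d : ℝ}
    (hd : inner ℝ a b = Real.cos d) (s : ℝ) :
    ∃ q : E3, ‖q‖ = 1 ∧ inner ℝ a q = Real.cos s ∧ inner ℝ b q = Real.cos (d - s) := by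
  have haa := inner_self_of_norm_one ha
  have hbb := inner_self_of_norm_one hb
  obtain ⟨n, hn, han, hbe⟩ : ∃ n : E3, inner ℝ n n = (1 : ℝ) ∧ inner ℝ a n = (0 : ℝ) ∧
      b = Real.cos d • a + Real.sin d • n := by
    by_cases h0 : Real.sin d = 0
    · obtain ⟨n, hn0, han, -⟩ := exists_orthogonal a a
      have hnn : ‖n‖ ≠ 0 := norm_ne_zero_iff.2 hn0
      refine ⟨(‖n‖)⁻¹ • n, ?_, ?_, ?_⟩
      · rw [real_inner_smul_left, real_inner_smul_right, real_inner_self_eq_norm_sq]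
        field_simp
      · rw [real_inner_smul_right, han, mul_zero]
      · rw [h0, zero_smul, add_zero, ← sub_eq_zero, ← inner_self_eq_zero (𝕜 := ℝ)]
        simp only [inner_sub_left, inner_sub_right, real_inner_smul_left, real_inner_smul_right,
          haa, hbb, real_inner_comm a b, hd]
        have := Real.sin_sq_add_cos_sq d
        rw [h0] at this
        linarith
    · refine ⟨(Real.sin d)⁻¹ • (b - Real.cos d • a), ?_, ?_, ?_⟩
      · simp only [inner_sub_left, inner_sub_right, real_inner_smul_left, real_inner_smul_right,
          haa, hbb, real_inner_comm a b, hd]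
        field_simp
        linarith [Real.sin_sq_add_cos_sq d]
      · simp only [inner_sub_right, real_inner_smul_right, haa, hd]
        ring
      · rw [smul_smul, mul_inv_cancel₀ h0, one_smul]
        abel
  have hna := real_inner_comm n a ▸ han
  have hq : inner ℝ (Real.cos s • a + Real.sin s • n) (Real.cos s • a + Real.sin s • n) =
      (1 : ℝ) := by
    simp only [inner_add_left, inner_add_right, real_inner_smul_left, real_inner_smul_right,
      haa, hn, han, hna]
    linarith [Real.sin_sq_add_cos_sq s]
  refine ⟨Real.cos s • a + Real.sin s • n, ?_, ?_, ?_⟩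
  · rw [real_inner_self_eq_norm_sq] at hq
    exact (pow_eq_one_iff_of_nonneg (norm_nonneg _) two_ne_zero).1 hq
  · simp only [inner_add_right, real_inner_smul_right, haa, han]
    ring
  · rw [hbe, Real.cos_sub]
    simp only [inner_add_left, inner_add_right, real_inner_smul_left, real_inner_smul_right,
      haa, hn, han, hna]
    ring

namespace SphericalDisk

/-- Two disks meet if and only if the distance of the centers is at most the sum of the radii. -/
theorem inter_nonempty_iff (D E : SphericalDisk) : (D.toSet ∩ E.toSet).Nonempty ↔
    Real.arccos (inner ℝ D.axis E.axis) ≤ D.radius + E.radius := by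
  have hD := D.norm_axis
  have hE := E.norm_axis
  constructor
  · rintro ⟨z, hzD, hzE⟩
    have hz := norm_toUnitSphere z
    have h1 : Real.arccos (inner ℝ D.axis (toUnitSphere z)) ≤ D.radius := by
      rw [arccos_inner_eq_angle hD hz]; exact hzD
    have h2 : Real.arccos (inner ℝ (toUnitSphere z) E.axis) ≤ E.radius := by
      rw [real_inner_comm, arccos_inner_eq_angle hE hz]; exact hzE
    linarith [arccos_inner_triangle hD hz hE]
  · intro h
    set d := Real.arccos (inner ℝ D.axis E.axis) with hd
    have hcos := (cos_arccos_inner hD hE).symm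
    rcases le_total d D.radius with h1 | h1
    · refine ⟨E.center, (D.mem_toSet_iff _).2 ?_, (E.mem_toSet_iff _).2 ?_⟩
      · change _ ≤ inner ℝ D.axis E.axis
        rw [hcos]
        exact Real.cos_le_cos_of_nonneg_of_le_pi (Real.arccos_nonneg _) D.radius_lt_pi.le h1
      · change _ ≤ inner ℝ E.axis E.axis
        rw [E.inner_axis_self]
        exact Real.cos_le_one _
    · obtain ⟨q, hq, hq1, hq2⟩ := exists_point_on_geodesic hD hE hcos D.radius
      obtain ⟨z, rfl⟩ := exists_toUnitSphere_eq hq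
      refine ⟨z, (D.mem_toSet_iff _).2 hq1.ge, (E.mem_toSet_iff _).2 ?_⟩
      rw [hq2]
      exact Real.cos_le_cos_of_nonneg_of_le_pi (by linarith) E.radius_lt_pi.le (by linarith)

end SphericalDisk

/-- A quadratic polynomial whose first nonzero coefficient is negative is negative at small
positive arguments. -/
theorem eventually_quadratic_neg {A B C : ℝ}
    (h : A < 0 ∨ (A = 0 ∧ B < 0) ∨ (A = 0 ∧ B = 0 ∧ C < 0)) :
    ∀ᶠ ε in 𝓝[>] (0 : ℝ), A + B * ε + C * ε ^ 2 < 0 := by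
  rcases h with h | ⟨rfl, h⟩ | ⟨rfl, rfl, h⟩
  · have : Tendsto (fun ε : ℝ => A + B * ε + C * ε ^ 2) (𝓝[>] 0) (𝓝 A) := by
      have h1 : Continuous fun ε : ℝ => A + B * ε + C * ε ^ 2 := by fun_prop
      simpa using (h1.tendsto 0).mono_left nhdsWithin_le_nhds
    exact this.eventually_lt_const h
  · have : Tendsto (fun ε : ℝ => B + C * ε) (𝓝[>] 0) (𝓝 B) := by
      have h1 : Continuous fun ε : ℝ => B + C * ε := by fun_prop
      simpa using (h1.tendsto 0).mono_left nhdsWithin_le_nhds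
    filter_upwards [this.eventually_lt_const h, self_mem_nhdsWithin] with ε h1 h2
    have := mul_neg_of_pos_of_neg h2 h1
    linarith
  · filter_upwards [self_mem_nhdsWithin] with ε h2
    have h2' : (0 : ℝ) < ε := h2
    have := mul_neg_of_neg_of_pos h (pow_pos h2' 2)
    linarith

/-- If the closed disks with centers `c v` and radii `r v` that contain `ξ` have it on their
boundary and some tangent direction at `ξ` leaves all of them, then a point close to `ξ` lies in
none of the disks. -/
theorem exists_uncovered_of_direction {ι : Type*} [Finite ι] {c : ι → E3} {r : ι → ℝ} {ξ m : E3}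
    (hξ : ‖ξ‖ = 1) (hm : inner ℝ ξ m = (0 : ℝ))
    (h : ∀ v, inner ℝ (c v) ξ < Real.cos (r v) ∨
      (inner ℝ (c v) ξ = Real.cos (r v) ∧ inner ℝ (c v) m < (0 : ℝ))) :
    ∃ y : E3, ‖y‖ = 1 ∧ ∀ v, inner ℝ (c v) y < Real.cos (r v) := by
  have hev : ∀ᶠ ε in 𝓝[>] (0 : ℝ), ∀ v, (inner ℝ (c v) ξ - Real.cos (r v)) +
      inner ℝ (c v) m * ε + ‖m‖ ^ 2 * ε ^ 2 < 0 := by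
    rw [eventually_all]
    intro v
    apply eventually_quadratic_neg
    rcases h v with h1 | ⟨h1, h2⟩
    · exact Or.inl (by linarith)
    · exact Or.inr (Or.inl ⟨by linarith, h2⟩)
  obtain ⟨ε, hε⟩ := hev.exists
  set N := ‖ξ + ε • m‖ with hN
  have hN2 : N ^ 2 = 1 + ε ^ 2 * ‖m‖ ^ 2 := by
    rw [hN, norm_add_sq_real, real_inner_smul_right, hm, hξ, norm_smul, mul_pow,
      Real.norm_eq_abs, sq_abs]
    ring
  have hN0 : 0 ≤ N := norm_nonneg _
  have hN1 : 1 ≤ N := by nlinarith [mul_nonneg (sq_nonneg ε) (sq_nonneg ‖m‖)]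
  have hNpos : 0 < N := by linarith
  have hNle : N ≤ 1 + ε ^ 2 * ‖m‖ ^ 2 := by nlinarith
  refine ⟨N⁻¹ • (ξ + ε • m), ?_, fun v => ?_⟩
  · rw [norm_smul, norm_inv, Real.norm_of_nonneg hN0, ← hN, inv_mul_cancel₀ hNpos.ne']
  · rw [real_inner_smul_right, inv_mul_lt_iff₀ hNpos, inner_add_right, real_inner_smul_right]
    have h1 := hε v
    nlinarith [mul_nonneg (by linarith : 0 ≤ N - 1) (by linarith [Real.neg_one_le_cos (r v)] :
      0 ≤ 1 + Real.cos (r v))]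

/-! ### Limits of circle patterns -/

namespace SphereTriangulation

variable {V : Type*} [Fintype V] [DecidableEq V] {T : SphereTriangulation V}

theorem angle_symm (Θ : T.skeleton.edgeSet → ℝ) {u w : V} (h : T.skeleton.Adj u w) :
    Θ (edge h.symm) = Θ (edge h) := congrArg Θ (Subtype.ext Sym2.eq_swap)

/-- For angles in `W`, the three vectors attached to a 3-cycle never lie in a plane: a face gives
a spherical triangle, any other 3-cycle a hyperbolic one. -/
theorem gramDet_ne_zero {Θ : T.skeleton.edgeSet → ℝ} (hΘ : Θ ∈ T.W) {a b c : V}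
    (hab : T.skeleton.Adj a b) (hbc : T.skeleton.Adj b c) (hca : T.skeleton.Adj c a) :
    gramDet (Real.cos (Θ (edge hbc))) (Real.cos (Θ (edge hca))) (Real.cos (Θ (edge hab))) ≠ 0 := by
  by_cases h : ({a, b, c} : Finset V) ∈ T.triangles
  · obtain ⟨h1, h2, h3, h4⟩ := hΘ.2.2.1 a b c hab hbc hca h
    exact (gramDet_pos (by linarith) (by linarith) (by linarith) (by linarith)).ne'
  · have := hΘ.2.2.2.1 a b c hab hbc hca (T.separates_three_cycle hab hbc hca h)
    exact (gramDet_neg (hΘ.1 _) (hΘ.1 _) (hΘ.1 _) (by linarith)).ne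

variable (T) in
/-- The closed conditions which pass to a limit of circle patterns with contact graph the
1-skeleton of `T` and overlap angles converging to `Θ`. The limit disk at `v` has center `c v` and
radius `r v`; it may degenerate to a point (`r v = 0`) or to the sphere (`r v = π`). -/
structure IsLimitPattern (Θ : T.skeleton.edgeSet → ℝ) (c : V → E3) (r : V → ℝ) : Prop where
  norm_center : ∀ v, ‖c v‖ = 1
  radius_mem : ∀ v, r v ∈ Set.Icc 0 Real.pi
  cos_angle : ∀ u w (h : T.skeleton.Adj u w), Real.cos (Θ (edge h)) *
    (Real.sin (r u) * Real.sin (r w)) = Real.cos (r u) * Real.cos (r w) - inner ℝ (c u) (c w)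
  radius_add_le : ∀ u w, u ≠ w → ¬ T.skeleton.Adj u w →
    r u + r w ≤ Real.arccos (inner ℝ (c u) (c w))

/-- The circle with center `c` and radius `r` is nondegenerate and passes through `q`. -/
def OnCircle (c : E3) (r : ℝ) (q : E3) : Prop := 0 < Real.sin r ∧ inner ℝ c q = Real.cos r

/-- The inner unit normal, in the tangent plane at `q`, of the circle with center `c` and radius
`r` through `q`. -/
noncomputable def circleNormal (c : E3) (r : ℝ) (q : E3) : E3 :=
  (Real.sin r)⁻¹ • (c - Real.cos r • q)

theorem inner_circleNormal_point {c q : E3} {r : ℝ} (hq : ‖q‖ = 1) (h : OnCircle c r q) :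
    inner ℝ (circleNormal c r q) q = (0 : ℝ) := by
  rw [circleNormal, real_inner_smul_left, inner_sub_left, real_inner_smul_left, h.2,
    inner_self_of_norm_one hq]
  ring

theorem center_eq {c q : E3} {r : ℝ} (h : 0 < Real.sin r) :
    c = Real.cos r • q + Real.sin r • circleNormal c r q := by
  rw [circleNormal, smul_smul, mul_inv_cancel₀ h.ne', one_smul]
  abel

theorem inner_circleNormal {c c' q : E3} {r r' : ℝ} (hq : ‖q‖ = 1)
    (h : OnCircle c r q) (h' : OnCircle c' r' q) :
    inner ℝ (circleNormal c r q) (circleNormal c' r' q) =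
      (inner ℝ c c' - Real.cos r * Real.cos r') / (Real.sin r * Real.sin r') := by
  have h1 := h.1.ne'
  have h2 := h'.1.ne'
  simp only [circleNormal, real_inner_smul_left, real_inner_smul_right, inner_sub_left,
    inner_sub_right, h.2, real_inner_comm c' q, h'.2, inner_self_of_norm_one hq]
  field_simp
  ring

theorem inner_circleNormal_self {c q : E3} {r : ℝ} (hc : ‖c‖ = 1) (hq : ‖q‖ = 1)
    (h : OnCircle c r q) : inner ℝ (circleNormal c r q) (circleNormal c r q) = (1 : ℝ) := by
  have h1 := h.1.ne'
  rw [inner_circleNormal hq h h, inner_self_of_norm_one hc,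
    div_eq_one_iff_eq (mul_ne_zero h1 h1)]
  linarith [Real.sin_sq_add_cos_sq r]

namespace IsLimitPattern

variable {Θ : T.skeleton.edgeSet → ℝ} {c : V → E3} {r : V → ℝ} (H : T.IsLimitPattern Θ c r)
  (hΘ : Θ ∈ T.W)
include H

theorem inner_le_cos {u w : V} (huw : u ≠ w) (h : ¬ T.skeleton.Adj u w) :
    inner ℝ (c u) (c w) ≤ Real.cos (r u + r w) := by
  rw [← cos_arccos_inner (H.norm_center u) (H.norm_center w)]
  exact Real.cos_le_cos_of_nonneg_of_le_pi (add_nonneg (H.radius_mem u).1 (H.radius_mem w).1)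
    (Real.arccos_le_pi _) (H.radius_add_le u w huw h)

theorem inner_normal_of_adj {q : E3} (hq : ‖q‖ = 1) {u w : V} (hu : OnCircle (c u) (r u) q)
    (hw : OnCircle (c w) (r w) q) (h : T.skeleton.Adj u w) :
    inner ℝ (circleNormal (c u) (r u) q) (circleNormal (c w) (r w) q) =
      -Real.cos (Θ (edge h)) := by
  rw [inner_circleNormal hq hu hw, div_eq_iff (mul_pos hu.1 hw.1).ne']
  linarith [H.cos_angle u w h]

/-- Disks of non-adjacent vertices whose circles share a point touch there from outside. -/
theorem normal_eq_neg_of_not_adj {q : E3} (hq : ‖q‖ = 1) {u w : V}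
    (hu : OnCircle (c u) (r u) q) (hw : OnCircle (c w) (r w) q) (huw : u ≠ w)
    (h : ¬ T.skeleton.Adj u w) :
    circleNormal (c u) (r u) q = -circleNormal (c w) (r w) q := by
  have h1 : inner ℝ (circleNormal (c u) (r u) q) (circleNormal (c w) (r w) q) ≤ (-1 : ℝ) := by
    rw [inner_circleNormal hq hu hw, div_le_iff₀ (mul_pos hu.1 hw.1)]
    have := H.inner_le_cos huw h
    rw [Real.cos_add] at this
    linarith
  rw [eq_neg_iff_add_eq_zero, ← norm_eq_zero, ← sq_eq_zero_iff]
  apply le_antisymm _ (sq_nonneg _)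
  rw [norm_add_sq_real, ← real_inner_self_eq_norm_sq, ← real_inner_self_eq_norm_sq,
    inner_circleNormal_self (H.norm_center u) hq hu,
    inner_circleNormal_self (H.norm_center w) hq hw]
  linarith

include hΘ

theorem normal_ne_of_adj {q : E3} (hq : ‖q‖ = 1) {u w : V} (hu : OnCircle (c u) (r u) q)
    (hw : OnCircle (c w) (r w) q) (h : T.skeleton.Adj u w) :
    circleNormal (c u) (r u) q ≠ circleNormal (c w) (r w) q ∧
      circleNormal (c u) (r u) q ≠ -circleNormal (c w) (r w) q := by
  have h1 := H.inner_normal_of_adj hq hu hw h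
  have h2 := abs_cos_lt_one (hΘ.1 (edge h))
  have h3 := inner_circleNormal_self (H.norm_center w) hq hw
  constructor <;> intro he <;> rw [he] at h1
  · linarith
  · rw [inner_neg_left, h3] at h1
    linarith

theorem normal_injective {q : E3} (hq : ‖q‖ = 1) {u w : V} (hu : OnCircle (c u) (r u) q)
    (hw : OnCircle (c w) (r w) q)
    (he : circleNormal (c u) (r u) q = circleNormal (c w) (r w) q) : u = w := by
  by_contra huw
  by_cases h : T.skeleton.Adj u w
  · exact (H.normal_ne_of_adj hΘ hq hu hw h).1 he
  · have h1 := H.normal_eq_neg_of_not_adj hq hu hw huw h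
    have h2 := inner_circleNormal_self (H.norm_center w) hq hw
    have h3 := he ▸ h1
    have h4 := congrArg (fun x => inner ℝ x (circleNormal (c w) (r w) q)) h3
    simp only [inner_neg_left, h2] at h4
    norm_num at h4

/-- No three circles of a 3-cycle pass through a common point. -/
theorem not_three_cycle_on_point {q : E3} (hq : ‖q‖ = 1) {u v w : V}
    (hu : OnCircle (c u) (r u) q) (hv : OnCircle (c v) (r v) q) (hw : OnCircle (c w) (r w) q)
    (huv : T.skeleton.Adj u v) (hvw : T.skeleton.Adj v w) : ¬ T.skeleton.Adj w u := by
  intro hwu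
  have := eq_zero_of_gramDet_ne_zero (inner_circleNormal_self (H.norm_center u) hq hu)
    (inner_circleNormal_self (H.norm_center v) hq hv)
    (inner_circleNormal_self (H.norm_center w) hq hw) (H.inner_normal_of_adj hq hv hw hvw)
    (real_inner_comm (circleNormal (c w) (r w) q) _ ▸ H.inner_normal_of_adj hq hw hu hwu)
    (H.inner_normal_of_adj hq hu hv huv) (gramDet_ne_zero hΘ huv hvw hwu)
    (inner_circleNormal_point hq hu) (inner_circleNormal_point hq hv)
    (inner_circleNormal_point hq hw)
  rw [this, norm_zero] at hq
  exact zero_ne_one hq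

omit H in
theorem angle_add_eq_pi_of_cos_eq_neg {e f : T.skeleton.edgeSet}
    (h : Real.cos (Θ e) = -Real.cos (Θ f)) : Θ e + Θ f = Real.pi := by
  have he := hΘ.1 e
  have hf := hΘ.1 f
  rw [← Real.cos_pi_sub] at h
  have := Real.injOn_cos ⟨he.1.le, he.2.le⟩ ⟨by linarith [hf.2], by linarith [hf.1]⟩ h
  linarith

/-- The circles of a 4-cycle without diagonals do not pass through a common point: its angles
would sum up to `2π`. -/
theorem not_four_cycle_on_point {q : E3} (hq : ‖q‖ = 1) {s x t y : V}
    (hs : OnCircle (c s) (r s) q) (hx : OnCircle (c x) (r x) q) (ht : OnCircle (c t) (r t) q)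
    (hy : OnCircle (c y) (r y) q) (hsx : T.skeleton.Adj s x) (hxt : T.skeleton.Adj x t)
    (hty : T.skeleton.Adj t y) (hys : T.skeleton.Adj y s) (hst : s ≠ t) (hxy : x ≠ y)
    (hnst : ¬ T.skeleton.Adj s t) (hnxy : ¬ T.skeleton.Adj x y) : False := by
  have n1 := H.normal_eq_neg_of_not_adj hq hs ht hst hnst
  have e1 := H.inner_normal_of_adj hq hs hx hsx
  have e2 := H.inner_normal_of_adj hq hx ht hxt
  have e3 := H.inner_normal_of_adj hq ht hy hty
  have e4 := H.inner_normal_of_adj hq hy hs hys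
  have s1 : Θ (edge hsx) + Θ (edge hxt) = Real.pi := by
    apply angle_add_eq_pi_of_cos_eq_neg hΘ
    rw [n1, inner_neg_left, real_inner_comm] at e1
    linarith
  have s2 : Θ (edge hty) + Θ (edge hys) = Real.pi := by
    apply angle_add_eq_pi_of_cos_eq_neg hΘ
    rw [n1, inner_neg_right, real_inner_comm] at e4
    linarith
  have := hΘ.2.2.2.2 s x t y hsx hxt hty hys hst hxy
    (T.separates_four_cycle hsx hxt hty hys hst hxy hnst hnxy)
  linarith

/-- If the disks of one face are hemispheres, then no disk degenerates. A disk that fills the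
sphere would have its center orthogonal to the three centers of the face. If disks shrink to a
point `q`, then the circles through `q` form a vertex cut between them and the face, so they
contain a 4-cycle. -/
theorem radius_mem_Ioo {t : Finset V} (ht : t ∈ T.triangles) (hr : ∀ v ∈ t, r v = Real.pi / 2)
    (v : V) : r v ∈ Set.Ioo 0 Real.pi := by
  obtain ⟨x, y, z, hxy, hxz, hyz, rfl⟩ := Finset.card_eq_three.1 (T.card_triangle t ht)
  have axy := T.adj_of_mem ht hxy (by simp) (by simp)
  have ayz := T.adj_of_mem ht hyz (by simp) (by simp)
  have azx := T.adj_of_mem ht hxz.symm (by simp) (by simp)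
  have rx := hr x (by simp)
  have ry := hr y (by simp)
  have rz := hr z (by simp)
  have hpi := Real.pi_pos
  have hdot : ∀ {a b} (h : T.skeleton.Adj a b), r a = Real.pi / 2 → r b = Real.pi / 2 →
      inner ℝ (c a) (c b) = -Real.cos (Θ (edge h)) := by
    intro a b h ha hb
    have := H.cos_angle a b h
    rw [ha, hb, Real.cos_pi_div_two, Real.sin_pi_div_two] at this
    linarith
  have hspan : ∀ q : E3, ‖q‖ = 1 → inner ℝ (c x) q = (0 : ℝ) → inner ℝ (c y) q = (0 : ℝ) →
      inner ℝ (c z) q ≠ (0 : ℝ) := by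
    intro q hq h1 h2 h3
    have := eq_zero_of_gramDet_ne_zero (inner_self_of_norm_one (H.norm_center x))
      (inner_self_of_norm_one (H.norm_center y)) (inner_self_of_norm_one (H.norm_center z))
      (hdot ayz ry rz) (real_inner_comm (c z) _ ▸ hdot azx rz rx) (hdot axy rx ry)
      (gramDet_ne_zero hΘ axy ayz azx) h1 h2 h3
    rw [this, norm_zero] at hq
    exact zero_ne_one hq
  have hltpi : ∀ v, r v < Real.pi := by
    intro v
    refine lt_of_le_of_ne (H.radius_mem v).2 fun hv => ?_
    have hperp : ∀ a, r a = Real.pi / 2 → inner ℝ (c a) (c v) = (0 : ℝ) := by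
      intro a ha
      have hav : a ≠ v := by rintro rfl; linarith
      by_cases h : T.skeleton.Adj a v
      · have := H.cos_angle a v h
        rw [hv, ha, Real.cos_pi_div_two, Real.sin_pi] at this
        linarith
      · have := H.radius_add_le a v hav h
        have := Real.arccos_le_pi (inner ℝ (c a) (c v))
        linarith
    exact hspan (c v) (H.norm_center v) (hperp x rx) (hperp y ry) (hperp z rz)
  have hpos_sin : ∀ w, r w ≠ 0 → 0 < Real.sin (r w) := fun w hw =>
    Real.sin_pos_of_pos_of_lt_pi (lt_of_le_of_ne (H.radius_mem w).1 (Ne.symm hw)) (hltpi w)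
  refine ⟨lt_of_le_of_ne (H.radius_mem v).1 fun hv => ?_, hltpi v⟩
  have hq := H.norm_center v
  obtain ⟨a, b, d, e, ha, hb, hd, he, hab, hbd, hde, hea, had, hbe, hnad, hnbe⟩ :=
    T.exists_four_cycle_of_cut (fun w => OnCircle (c w) (r w) (c v))
      (fun w => r w = 0 ∧ c w = c v) ⟨v, hv.symm, rfl⟩ (by
        by_contra hcon
        push Not at hcon
        have hon : ∀ a, r a = Real.pi / 2 → inner ℝ (c a) (c v) = (0 : ℝ) := by
          intro a ha
          have := (hcon a (fun h => by linarith)).2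
          rwa [ha, Real.cos_pi_div_two] at this
        exact hspan (c v) hq (hon x rx) (hon y ry) (hon z rz)) (by
        rintro u w ⟨hu, hcu⟩ huw
        have h1 := H.cos_angle u w huw
        rw [hu, hcu, Real.sin_zero, Real.cos_zero] at h1
        by_cases hw : r w = 0
        · left
          refine ⟨hw, ?_⟩
          rw [hw, Real.cos_zero] at h1
          refine ((inner_eq_one_iff_of_norm_eq_one hq (H.norm_center w) (𝕜 := ℝ)).1 ?_).symm
          linarith
        · right
          refine ⟨hpos_sin w hw, ?_⟩
          rw [real_inner_comm]
          linarith)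
      (fun a b d ha hb hd => H.not_three_cycle_on_point hΘ hq ha hb hd)
      (fun a b d ha hb hd hab had hnab hnad => H.normal_injective hΘ hq hb hd (by
        rw [← neg_inj, ← H.normal_eq_neg_of_not_adj hq ha hb hab hnab,
          H.normal_eq_neg_of_not_adj hq ha hd had hnad]))
  exact H.not_four_cycle_on_point hΘ hq ha hb hd he hab hbd hde hea had hbe hnad hnbe

end IsLimitPattern

end SphereTriangulation

/-! ### Tangencies and uncovered points in the limit -/

namespace SphereTriangulation

variable {V : Type*} [Fintype V] [DecidableEq V] {T : SphereTriangulation V}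

namespace IsLimitPattern

variable {Θ : T.skeleton.edgeSet → ℝ} {c : V → E3} {r : V → ℝ} (H : T.IsLimitPattern Θ c r)
  (hΘ : Θ ∈ T.W)
include H hΘ

/-- Two disks of non-adjacent vertices are not complementary. Otherwise every other circle
crosses their common boundary, so the triangulation is a suspension in which the angles at the two
poles add up to `π` along every meridian. This contradicts the fourth condition if the equator is
not a clique, and the strict inequality in the first condition for the double tetrahedron. -/
theorem not_complementary (hV : 4 < Fintype.card V) (hr : ∀ v, r v ∈ Set.Ioo 0 Real.pi) {u w : V}
    (huw : u ≠ w) (hnadj : ¬ T.skeleton.Adj u w) (hc : c w = -c u) :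
    r u + r w ≠ Real.pi := by
  intro hsum
  have hsin : ∀ v, 0 < Real.sin (r v) := fun v => Real.sin_pos_of_mem_Ioo (hr v)
  have hrw : r w = Real.pi - r u := by linarith
  have hsw : Real.sin (r w) = Real.sin (r u) := by rw [hrw, Real.sin_pi_sub]
  have hcw : Real.cos (r w) = -Real.cos (r u) := by rw [hrw, Real.cos_pi_sub]
  -- for both poles, being non-adjacent to `s` means that `s` lies in the other disk
  have key : ∀ s, s ≠ u → s ≠ w → T.skeleton.Adj u s ∧ T.skeleton.Adj w s := by
    intro s hsu hsw'
    have hss := mul_pos (hsin u) (hsin s)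
    have adj : ∀ {a} (h : T.skeleton.Adj a s), Real.sin (r a) = Real.sin (r u) →
        |Real.cos (r a) * Real.cos (r s) - inner ℝ (c a) (c s)| <
          Real.sin (r u) * Real.sin (r s) := by
      intro a h ha
      have h1 := H.cos_angle a s h
      have h2 := abs_cos_lt_one (hΘ.1 (edge h))
      rw [← h1, ha, abs_mul, abs_of_pos hss]
      exact mul_lt_of_lt_one_left hss (abs_lt.2 h2)
    have nadj : ∀ {a}, s ≠ a → ¬ T.skeleton.Adj a s → Real.sin (r a) = Real.sin (r u) →
        Real.sin (r u) * Real.sin (r s) ≤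
          Real.cos (r a) * Real.cos (r s) - inner ℝ (c a) (c s) := by
      intro a hsa h ha
      have := H.inner_le_cos hsa.symm h
      rw [Real.cos_add, ha] at this
      linarith
    by_contra hcon
    rw [not_and_or] at hcon
    by_cases hu : T.skeleton.Adj u s
    · have h1 := nadj hsw' (hcon.resolve_left (not_not.2 hu)) hsw
      have h2 := (abs_lt.1 (adj hu rfl)).1
      rw [hcw, hc, inner_neg_left] at h1
      linarith
    · have h1 := nadj hsu hu rfl
      by_cases hw : T.skeleton.Adj w s
      · have h2 := (abs_lt.1 (adj hw hsw)).1
        rw [hcw, hc, inner_neg_left] at h2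
        linarith
      · have h2 := nadj hsw' hw hsw
        rw [hcw, hc, inner_neg_left] at h2
        linarith
  have sum : ∀ s (h1 : T.skeleton.Adj u s) (h2 : T.skeleton.Adj w s),
      Θ (edge h1) + Θ (edge h2) = Real.pi := by
    intro s h1 h2
    apply angle_add_eq_pi_of_cos_eq_neg hΘ
    have e1 := H.cos_angle u s h1
    have e2 := H.cos_angle w s h2
    rw [hcw, hc, inner_neg_left, hsw] at e2
    have hss := mul_pos (hsin u) (hsin s)
    refine mul_right_cancel₀ hss.ne' ?_
    linarith
  by_cases hcl : ∀ s t, s ≠ u → s ≠ w → t ≠ u → t ≠ w → s ≠ t → T.skeleton.Adj s t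
  · have hd := T.isDoubleTetrahedron_of_suspension hV huw hnadj (fun s h1 h2 => (key s h1 h2).1)
      (fun s h1 h2 => (key s h1 h2).2) hcl
    obtain ⟨a, b, d, hab, hbd, had, hnad, hlt⟩ := hΘ.2.1.2 hd
    have hcase : (a = u ∧ d = w) ∨ (a = w ∧ d = u) := by
      by_cases hau : a = u
      · by_cases hdw : d = w
        · exact Or.inl ⟨hau, hdw⟩
        · subst hau
          exact absurd (key d had.symm hdw).1 hnad
      by_cases haw : a = w
      · by_cases hdu : d = u
        · exact Or.inr ⟨haw, hdu⟩
        · subst haw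
          exact absurd (key d hdu had.symm).2 hnad
      by_cases hdu : d = u
      · subst hdu
        exact absurd (key a hau haw).1.symm hnad
      by_cases hdw : d = w
      · subst hdw
        exact absurd (key a hau haw).2.symm hnad
      exact absurd (hcl a d hau haw hdu hdw had) hnad
    rcases hcase with ⟨rfl, rfl⟩ | ⟨rfl, rfl⟩
    · have := sum b hab hbd.symm
      rw [angle_symm Θ hbd] at this
      linarith
    · have := sum b hbd.symm hab
      rw [angle_symm Θ hbd] at this
      linarith
  · push Not at hcl
    obtain ⟨s, t, hsu, hsw', htu, htw, hst, hnst⟩ := hcl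
    have hs := key s hsu hsw'
    have ht := key t htu htw
    have s1 := sum s hs.1 hs.2
    have s2 := sum t ht.1 ht.2
    have := hΘ.2.2.2.2 u s w t hs.1 hs.2.symm ht.2 ht.1.symm huw hst
      (T.separates_four_cycle hs.1 hs.2.symm ht.2 ht.1.symm huw hst hnadj hnst)
    rw [angle_symm Θ hs.2, angle_symm Θ ht.1] at this
    linarith

/-- At a point where two disks of non-adjacent vertices touch, no third disk contains the point
in its interior: its angles with the two disks would add up to more than `π`. -/
theorem inner_le_cos_of_tangent (hr : ∀ v, r v ∈ Set.Ioo 0 Real.pi) {q : E3} (hq : ‖q‖ = 1)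
    {u w : V} (hu : OnCircle (c u) (r u) q) (hw : OnCircle (c w) (r w) q) (huw : u ≠ w)
    (hnadj : ¬ T.skeleton.Adj u w) (hsum : r u + r w < Real.pi) (s : V) :
    inner ℝ (c s) q ≤ Real.cos (r s) := by
  by_contra hs
  push Not at hs
  have adj : ∀ a, OnCircle (c a) (r a) q → T.skeleton.Adj a s := by
    intro a ha
    by_contra hna
    have hsa : a ≠ s := by rintro rfl; exact hs.ne' ha.2
    have h1 := H.radius_add_le a s hsa hna
    have h2 := arccos_inner_triangle (H.norm_center a) hq (H.norm_center s)
    have h3 : Real.arccos (inner ℝ (c a) q) = r a := by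
      rw [ha.2, Real.arccos_cos (hr a).1.le (hr a).2.le]
    have h4 : Real.arccos (inner ℝ q (c s)) < r s := by
      rw [real_inner_comm, ← Real.arccos_cos (hr s).1.le (hr s).2.le]
      refine Real.strictAntiOn_arccos ⟨Real.neg_one_le_cos _, Real.cos_le_one _⟩ ⟨?_, ?_⟩ hs
      · linarith [Real.neg_one_le_cos (r s)]
      · have := real_inner_le_norm (c s) q
        rwa [H.norm_center, hq, one_mul] at this
    linarith
  have hus := adj u hu
  have hsw := (adj w hw).symm
  have h1 := hΘ.2.1.1 u s w hus hsw huw hnadj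
  have hcos : 0 ≤ Real.cos (Θ (edge hus)) + Real.cos (Θ (edge hsw)) := by
    have := Real.cos_le_cos_of_nonneg_of_le_pi (hΘ.1 (edge hus)).1.le
      (by linarith [(hΘ.1 (edge hsw)).1] : Real.pi - Θ (edge hsw) ≤ Real.pi) (by linarith)
    rw [Real.cos_pi_sub] at this
    linarith
  have hn := H.normal_eq_neg_of_not_adj hq hu hw huw hnadj
  have e1 := H.cos_angle u s hus
  have e2 := H.cos_angle s w hsw
  rw [center_eq (c := c u) (q := q) hu.1, inner_add_left, real_inner_smul_left,
    real_inner_smul_left, hn, inner_neg_left] at e1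
  rw [real_inner_comm, center_eq (c := c w) (q := q) hw.1, inner_add_left, real_inner_smul_left,
    real_inner_smul_left] at e2
  rw [real_inner_comm q] at hs
  have hss := Real.sin_pos_of_mem_Ioo (hr s)
  have hsp : 0 < Real.sin (r u + r w) :=
    Real.sin_pos_of_pos_of_lt_pi (by linarith [(hr u).1, (hr w).1]) hsum
  rw [Real.sin_add] at hsp
  have key : (Real.cos (Θ (edge hus)) + Real.cos (Θ (edge hsw))) *
      (Real.sin (r u) * Real.sin (r w) * Real.sin (r s)) =
      (Real.sin (r u) * Real.cos (r w) + Real.cos (r u) * Real.sin (r w)) *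
        (Real.cos (r s) - inner ℝ q (c s)) := by
    linear_combination Real.sin (r w) * e1 + Real.sin (r u) * e2
  have l1 := mul_nonneg hcos (mul_pos (mul_pos hu.1 hw.1) hss).le
  have l2 := mul_neg_of_pos_of_neg hsp (by linarith : Real.cos (r s) - inner ℝ q (c s) < 0)
  linarith

/-- Among the circles through a point where two disks of non-adjacent vertices touch there is at
most one further circle, and it crosses these two. -/
theorem adj_and_eq_of_on_tangency {q : E3} (hq : ‖q‖ = 1)
    {u w : V} (hu : OnCircle (c u) (r u) q) (hw : OnCircle (c w) (r w) q) (huw : u ≠ w)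
    (hnadj : ¬ T.skeleton.Adj u w) {s : V} (hs : OnCircle (c s) (r s) q) (hsu : s ≠ u)
    (hsw : s ≠ w) : T.skeleton.Adj u s ∧
      ∀ t, OnCircle (c t) (r t) q → t ≠ u → t ≠ w → t = s := by
  have hn := H.normal_eq_neg_of_not_adj hq hu hw huw hnadj
  have adj : ∀ s, OnCircle (c s) (r s) q → s ≠ u → s ≠ w →
      T.skeleton.Adj u s ∧ T.skeleton.Adj s w := by
    intro s hs hsu hsw
    constructor
    · by_contra h
      have h1 := H.normal_eq_neg_of_not_adj hq hu hs hsu.symm h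
      exact hsw (H.normal_injective hΘ hq hs hw (by rw [← neg_inj, ← h1, hn]))
    · by_contra h
      have h1 := H.normal_eq_neg_of_not_adj hq hs hw hsw h
      exact hsu (H.normal_injective hΘ hq hs hu (by rw [h1, hn]))
  refine ⟨(adj s hs hsu hsw).1, fun t ht htu htw => ?_⟩
  by_contra hts
  have as := adj s hs hsu hsw
  have at' := adj t ht htu htw
  by_cases hst : T.skeleton.Adj s t
  · exact H.not_three_cycle_on_point hΘ hq hu hs ht as.1 hst at'.1.symm
  · exact H.not_four_cycle_on_point hΘ hq hu hs hw ht as.1 as.2 at'.2.symm at'.1.symm huw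
      (Ne.symm hts) hnadj hst

/-- Disks of non-adjacent vertices do not touch if the disks cover the sphere and its exterior in
the sense of `hcov`: at most one further circle passes through a point of tangency, and it closes
the thin gap between the two disks on one side only. The point of the gap on the other side is
reached to second order, by the vector `(q + ε m + ε² κ n, 1 + ε² τ)`. -/
theorem radius_add_lt (hV : 4 < Fintype.card V) (hr : ∀ v, r v ∈ Set.Ioo 0 Real.pi)
    (hcov : ∀ x : Mink, 0 < x.2 → x.2 ≤ ‖x.1‖ →
      ∃ v, x.2 * Real.cos (r v) ≤ inner ℝ (c v) x.1) {u w : V} (huw : u ≠ w)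
    (hnadj : ¬ T.skeleton.Adj u w) : r u + r w < Real.arccos (inner ℝ (c u) (c w)) := by
  refine lt_of_le_of_ne (H.radius_add_le u w huw hnadj) fun heq => ?_
  have hcos : inner ℝ (c u) (c w) = Real.cos (r u + r w) := by
    rw [heq, cos_arccos_inner (H.norm_center u) (H.norm_center w)]
  have hle : r u + r w ≤ Real.pi := heq ▸ Real.arccos_le_pi _
  have hsum : r u + r w < Real.pi := by
    refine lt_of_le_of_ne hle fun hpi => ?_
    rw [hpi, Real.cos_pi] at hcos
    have : c w = -c u := by
      rw [eq_neg_iff_add_eq_zero, add_comm, ← norm_eq_zero, ← sq_eq_zero_iff, norm_add_sq_real,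
        hcos, H.norm_center, H.norm_center]
      norm_num
    exact H.not_complementary hΘ hV hr huw hnadj this hpi
  obtain ⟨q, hq, hqu, hqw⟩ := exists_point_on_geodesic (H.norm_center u) (H.norm_center w) hcos
    (r u)
  rw [add_sub_cancel_left] at hqw
  have hsin : ∀ v, 0 < Real.sin (r v) := fun v => Real.sin_pos_of_mem_Ioo (hr v)
  have hu : OnCircle (c u) (r u) q := ⟨hsin u, hqu⟩
  have hw : OnCircle (c w) (r w) q := ⟨hsin w, hqw⟩
  have hn := H.normal_eq_neg_of_not_adj hq hu hw huw hnadj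
  set n := circleNormal (c u) (r u) q with hndef
  have hnw : circleNormal (c w) (r w) q = -n := by rw [hn, neg_neg]
  have hnn : inner ℝ n n = (1 : ℝ) := inner_circleNormal_self (H.norm_center u) hq hu
  have hnq : inner ℝ n q = (0 : ℝ) := inner_circleNormal_point hq hu
  -- the direction along the gap, on the side not covered by the possible third circle
  obtain ⟨m, hm0, hmq, hmn, hms⟩ : ∃ m : E3, m ≠ 0 ∧ inner ℝ q m = (0 : ℝ) ∧
      inner ℝ n m = (0 : ℝ) ∧ ∀ s, OnCircle (c s) (r s) q → s ≠ u → s ≠ w →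
        inner ℝ (circleNormal (c s) (r s) q) m < (0 : ℝ) := by
    by_cases hex : ∃ s, OnCircle (c s) (r s) q ∧ s ≠ u ∧ s ≠ w
    · obtain ⟨s, hs, hsu, hsw⟩ := hex
      obtain ⟨hus, huniq⟩ := H.adj_and_eq_of_on_tangency hΘ hq hu hw huw hnadj hs hsu hsw
      have h1 := H.inner_normal_of_adj hq hu hs hus
      have h2 := abs_cos_lt_one (hΘ.1 (edge hus))
      rw [← hndef] at h1
      set ns := circleNormal (c s) (r s) q with hns
      have hnsns : inner ℝ ns ns = (1 : ℝ) := inner_circleNormal_self (H.norm_center s) hq hs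
      have hnsq : inner ℝ ns q = (0 : ℝ) := inner_circleNormal_point hq hs
      have hneg : inner ℝ ns (inner ℝ n ns • n - ns) < (0 : ℝ) := by
        rw [inner_sub_right, real_inner_smul_right, real_inner_comm n ns, hnsns, h1]
        nlinarith
      refine ⟨inner ℝ n ns • n - ns, ?_, ?_, ?_, ?_⟩
      · intro h0
        rw [h0, inner_zero_right] at hneg
        exact lt_irrefl _ hneg
      · rw [real_inner_comm, inner_sub_left, real_inner_smul_left, hnq, hnsq]
        ring
      · rw [inner_sub_right, real_inner_smul_right, hnn]
        ring
      · intro t ht htu htw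
        rw [huniq t ht htu htw]
        exact hneg
    · obtain ⟨m, hm0, h1, h2⟩ := exists_orthogonal q n
      exact ⟨m, hm0, h1, h2, fun s hs hsu hsw => absurd ⟨s, hs, hsu, hsw⟩ hex⟩
  have hμ : 0 < ‖m‖ ^ 2 := by positivity
  set τ := ‖m‖ ^ 2 / 4 with hτ
  have hτ0 : 0 < τ := by positivity
  set κ := τ * (Real.cos (r u) / Real.sin (r u) - Real.cos (r w) / Real.sin (r w)) / 2 with hκ
  have hcot : 0 < Real.cos (r u) / Real.sin (r u) + Real.cos (r w) / Real.sin (r w) := by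
    have h1 : 0 < Real.sin (r u + r w) :=
      Real.sin_pos_of_pos_of_lt_pi (by linarith [(hr u).1, (hr w).1]) hsum
    rw [Real.sin_add] at h1
    rw [div_add_div _ _ (hsin u).ne' (hsin w).ne']
    apply div_pos _ (mul_pos (hsin u) (hsin w))
    linarith
  have hκu : κ * Real.sin (r u) - τ * Real.cos (r u) < 0 := by
    have e : κ * Real.sin (r u) - τ * Real.cos (r u) = -(τ * Real.sin (r u) / 2) *
        (Real.cos (r u) / Real.sin (r u) + Real.cos (r w) / Real.sin (r w)) := by
      have h1 := (hsin u).ne'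
      have h2 := (hsin w).ne'
      rw [hκ]
      field_simp
      ring
    rw [e]
    exact mul_neg_of_neg_of_pos (neg_lt_zero.2 (by have := hsin u; positivity)) hcot
  have hκw : -κ * Real.sin (r w) - τ * Real.cos (r w) < 0 := by
    have e : -κ * Real.sin (r w) - τ * Real.cos (r w) = -(τ * Real.sin (r w) / 2) *
        (Real.cos (r u) / Real.sin (r u) + Real.cos (r w) / Real.sin (r w)) := by
      have h1 := (hsin u).ne'
      have h2 := (hsin w).ne'
      rw [hκ]
      field_simp
      ring
    rw [e]
    exact mul_neg_of_neg_of_pos (neg_lt_zero.2 (by have := hsin w; positivity)) hcot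
  have hev : ∀ᶠ ε in 𝓝[>] (0 : ℝ), ∀ v, (inner ℝ (c v) q - Real.cos (r v)) +
      inner ℝ (c v) m * ε + (κ * inner ℝ (c v) n - τ * Real.cos (r v)) * ε ^ 2 < 0 := by
    rw [eventually_all]
    intro v
    apply eventually_quadratic_neg
    rcases (H.inner_le_cos_of_tangent hΘ hr hq hu hw huw hnadj hsum v).lt_or_eq with hlt | heq
    · exact Or.inl (by linarith)
    right
    have hv : OnCircle (c v) (r v) q := ⟨hsin v, heq⟩
    have hce := center_eq (c := c v) (q := q) hv.1
    have hqn := real_inner_comm n q ▸ hnq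
    have hin : inner ℝ (c v) m =
        Real.sin (r v) * inner ℝ (circleNormal (c v) (r v) q) m := by
      conv_lhs => rw [hce]
      rw [inner_add_left, real_inner_smul_left, real_inner_smul_left, hmq]
      ring
    have hin' : inner ℝ (c v) n =
        Real.sin (r v) * inner ℝ (circleNormal (c v) (r v) q) n := by
      conv_lhs => rw [hce]
      rw [inner_add_left, real_inner_smul_left, real_inner_smul_left, hqn]
      ring
    by_cases hvu : v = u
    · subst hvu
      rw [← hndef] at hin hin'
      refine Or.inr ⟨by linarith, by rw [hin, hmn, mul_zero], ?_⟩
      rw [hin', hnn, mul_one]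
      exact hκu
    by_cases hvw : v = w
    · subst hvw
      rw [hnw, inner_neg_left] at hin hin'
      refine Or.inr ⟨by linarith, by rw [hin, hmn]; ring, ?_⟩
      rw [hin', hnn]
      linarith
    · exact Or.inl ⟨by linarith, by rw [hin]; exact mul_neg_of_pos_of_neg hv.1 (hms v hv hvu hvw)⟩
  have hsmall : ∀ᶠ ε in 𝓝[>] (0 : ℝ), ε < 1 / (1 + ‖m‖) :=
    (eventually_lt_nhds (by positivity)).filter_mono nhdsWithin_le_nhds
  obtain ⟨ε, hε, hε1, hε0⟩ := (hev.and (hsmall.and self_mem_nhdsWithin)).exists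
  have hε0' : (0 : ℝ) < ε := hε0
  obtain ⟨v, hv⟩ := hcov (q + ε • m + (ε ^ 2 * κ) • n, 1 + ε ^ 2 * τ) (by positivity) (by
    apply le_of_sq_le_sq _ (norm_nonneg _)
    have e : ‖q + ε • m + (ε ^ 2 * κ) • n‖ ^ 2 =
        1 + ε ^ 2 * ‖m‖ ^ 2 + (ε ^ 2 * κ) ^ 2 := by
      rw [← real_inner_self_eq_norm_sq]
      simp only [inner_add_left, inner_add_right, real_inner_smul_left, real_inner_smul_right,
        inner_self_of_norm_one hq, hnn, hnq, real_inner_comm n q ▸ hnq, hmq,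
        real_inner_comm m q ▸ hmq, hmn, real_inner_comm m n ▸ hmn, real_inner_self_eq_norm_sq m]
      ring
    simp only [e, hτ]
    have h1 : ε * ‖m‖ ≤ 1 := by
      rw [lt_div_iff₀ (by positivity)] at hε1
      linarith
    have h2 : (ε * ‖m‖) ^ 2 ≤ 1 := pow_le_one₀ (by positivity) h1
    have h3 : 0 ≤ (ε * ‖m‖) ^ 2 := sq_nonneg _
    nlinarith [sq_nonneg (ε ^ 2 * κ)])
  have h1 := hε v
  simp only [inner_add_right, real_inner_smul_right] at hv
  linarith

/-- If the open disks other than that of `u` leave out a point `ξ`, then so do the closed disks,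
after a small move of the point. A limit of uncovered points is such a point `ξ`. -/
theorem exists_uncovered (hr : ∀ v, r v ∈ Set.Ioo 0 Real.pi)
    (hlt : ∀ u w, u ≠ w → ¬ T.skeleton.Adj u w →
      r u + r w < Real.arccos (inner ℝ (c u) (c w))) (u : V) {ξ : E3} (hξ : ‖ξ‖ = 1)
    (h : ∀ v, v ≠ u → inner ℝ (c v) ξ ≤ Real.cos (r v)) :
    ∃ y : E3, ‖y‖ = 1 ∧ ∀ v, v ≠ u → inner ℝ (c v) y < Real.cos (r v) := by
  have hsin : ∀ v, 0 < Real.sin (r v) := fun v => Real.sin_pos_of_mem_Ioo (hr v)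
  have hadj : ∀ a b, OnCircle (c a) (r a) ξ → OnCircle (c b) (r b) ξ → a ≠ b →
      T.skeleton.Adj a b := by
    intro a b ha hb hab
    by_contra hn
    have h1 := H.normal_eq_neg_of_not_adj hξ ha hb hab hn
    have h2 := inner_circleNormal hξ ha hb
    rw [h1, inner_neg_left, inner_circleNormal_self (H.norm_center b) hξ hb,
      eq_div_iff (mul_pos ha.1 hb.1).ne'] at h2
    have h3 : inner ℝ (c a) (c b) = Real.cos (r a + r b) := by rw [Real.cos_add]; linarith
    have h4 := hlt a b hab hn
    rw [h3, Real.arccos_cos (by linarith [(hr a).1, (hr b).1])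
      (h4.le.trans (Real.arccos_le_pi _))] at h4
    exact lt_irrefl _ h4
  have hself : ∀ v, OnCircle (c v) (r v) ξ →
      inner ℝ (circleNormal (c v) (r v) ξ) (circleNormal (c v) (r v) ξ) = (1 : ℝ) :=
    fun v hv => inner_circleNormal_self (H.norm_center v) hξ hv
  -- at most two circles pass through `ξ`, and minus the sum of their normals leaves both disks
  obtain ⟨m, hm, hneg⟩ : ∃ m : E3, inner ℝ ξ m = (0 : ℝ) ∧
      ∀ v, v ≠ u → OnCircle (c v) (r v) ξ →
        inner ℝ (circleNormal (c v) (r v) ξ) m < (0 : ℝ) := by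
    by_cases h0 : ∃ a, a ≠ u ∧ OnCircle (c a) (r a) ξ
    · obtain ⟨a, hau, ha⟩ := h0
      have hpa := inner_circleNormal_point hξ ha
      by_cases h1 : ∃ b, b ≠ u ∧ b ≠ a ∧ OnCircle (c b) (r b) ξ
      · obtain ⟨b, hbu, hba, hb⟩ := h1
        have hpb := inner_circleNormal_point hξ hb
        have hab := hadj a b ha hb hba.symm
        have hi := H.inner_normal_of_adj hξ ha hb hab
        have hc := abs_cos_lt_one (hΘ.1 (edge hab))
        refine ⟨-(circleNormal (c a) (r a) ξ + circleNormal (c b) (r b) ξ), ?_, ?_⟩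
        · rw [real_inner_comm, inner_neg_left, inner_add_left, hpa, hpb]
          norm_num
        · intro v hvu hv
          have hvab : v = a ∨ v = b := by
            by_contra hcon
            push Not at hcon
            exact H.not_three_cycle_on_point hΘ hξ ha hb hv hab (hadj b v hb hv hcon.2.symm)
              (hadj v a hv ha hcon.1)
          rcases hvab with rfl | rfl
          · rw [inner_neg_right, inner_add_right, hself v ha, hi]
            linarith
          · rw [inner_neg_right, inner_add_right, hself v hb, real_inner_comm, hi]
            linarith
      · refine ⟨-circleNormal (c a) (r a) ξ, ?_, ?_⟩
        · rw [real_inner_comm, inner_neg_left, hpa, neg_zero]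
        · intro v hvu hv
          have : v = a := by
            by_contra hva
            exact h1 ⟨v, hvu, hva, hv⟩
          subst this
          rw [inner_neg_right, hself v ha]
          norm_num
    · exact ⟨0, inner_zero_right _, fun v hvu hv => absurd ⟨v, hvu, hv⟩ h0⟩
  obtain ⟨y, hy, hyv⟩ := exists_uncovered_of_direction (ι := {v // v ≠ u}) (c := fun v => c v)
    (r := fun v => r v) hξ hm (by
      rintro ⟨v, hvu⟩
      rcases (h v hvu).lt_or_eq with h1 | h1
      · exact Or.inl h1
      · have hv : OnCircle (c v) (r v) ξ := ⟨hsin v, h1⟩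
        refine Or.inr ⟨h1, ?_⟩
        change inner ℝ (c v) m < 0
        rw [center_eq (c := c v) (q := ξ) hv.1, inner_add_left, real_inner_smul_left,
          real_inner_smul_left, hm, mul_zero, zero_add]
        exact mul_neg_of_pos_of_neg hv.1 (hneg v hvu hv))
  exact ⟨y, hy, fun v hvu => hyv ⟨v, hvu⟩⟩

end IsLimitPattern

end SphereTriangulation

/-! ### Convergence of normalised patterns -/

namespace CirclePattern

variable {V : Type*} {P Q : CirclePattern V} {f : OnePoint ℂ → OnePoint ℂ}

theorem contactGraph_eq_of_image (hf : Function.Injective f)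
    (hQ : ∀ v, (Q v).toSet = f '' (P v).toSet) : Q.contactGraph = P.contactGraph := by
  ext u w
  simp only [contactGraph, hQ, ← Set.image_inter hf, Set.image_nonempty]

theorem irreducible_of_image (hf : Function.Injective f)
    (hQ : ∀ v, (Q v).toSet = f '' (P v).toSet) (hP : P.Irreducible) : Q.Irreducible := by
  intro A hA
  rw [Set.ssubset_univ_iff]
  intro h
  obtain ⟨z, hz⟩ := (Set.ne_univ_iff_exists_notMem _).1 (hP A hA).ne
  apply hz
  have hfz : f z ∈ ⋃ v ∈ A, (Q v).toSet := h ▸ Set.mem_univ _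
  simp only [Set.mem_iUnion, hQ, hf.mem_set_image] at hfz ⊢
  exact hfz

theorem overlapAngles_eq_of_lor (h : ∀ u w, lor (Q u).vec (Q w).vec = lor (P u).vec (P w).vec)
    (G : SimpleGraph V) : Q.overlapAngles G = P.overlapAngles G := by
  funext ⟨e, he⟩
  induction e with
  | _ u w =>
    change Real.arccos _ = Real.arccos _
    have := h u w
    rw [SphericalDisk.lor_vec_vec, SphericalDisk.lor_vec_vec, neg_inj] at this
    rw [this]

theorem irreducible_of_forall {P : CirclePattern V}
    (h : ∀ u, ∃ z, ∀ v, v ≠ u → z ∉ (P v).toSet) : P.Irreducible := by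
  intro A hA
  obtain ⟨u, hu⟩ := (Set.ne_univ_iff_exists_notMem _).1 hA.ne
  obtain ⟨z, hz⟩ := h u
  refine Set.ssubset_univ_iff.2 ((Set.ne_univ_iff_exists_notMem _).2 ⟨z, ?_⟩)
  simp only [Set.mem_iUnion, not_exists]
  exact fun v hv => hz v (by rintro rfl; exact hu hv)

/-- Patterns in which the disks of a fixed face are hemispheres have a subsequence that converges
to an irreducible pattern with the same contact graph. -/
theorem exists_convergent_subsequence [Fintype V] [DecidableEq V] (T : SphereTriangulation V)
    (hV : 4 < Fintype.card V) (Q : ℕ → CirclePattern V) (hirr : ∀ n, (Q n).Irreducible)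
    (hcontact : ∀ n, (Q n).contactGraph = T.skeleton)
    {K : Set (T.skeleton.edgeSet → ℝ)} (hK : IsCompact K) (hKW : K ⊆ T.W)
    (hangle : ∀ n, (Q n).overlapAngles T.skeleton ∈ K) {t : Finset V} (ht : t ∈ T.triangles)
    (hface : ∀ n, ∀ v ∈ t, (Q n v).radius = Real.pi / 2) :
    ∃ (φ : ℕ → ℕ) (P' : CirclePattern V), StrictMono φ ∧
      ConvergesTo (fun n => Q (φ n)) P' ∧ P'.Irreducible ∧ P'.contactGraph = T.skeleton := by
  have hcompact : IsCompact ((Set.univ.pi fun _ : V => Metric.sphere (0 : E3) 1) ×ˢ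
      ((Set.univ.pi fun _ : V => Set.Icc 0 Real.pi) ×ˢ K)) :=
    (isCompact_univ_pi fun _ => isCompact_sphere _ _).prod
      ((isCompact_univ_pi fun _ => isCompact_Icc).prod hK)
  obtain ⟨⟨c, r, Θ⟩, hmem, φ, hφ, hlim⟩ := hcompact.tendsto_subseq
    (x := fun n => (fun v => (Q n v).axis, fun v => (Q n v).radius,
      (Q n).overlapAngles T.skeleton))
    (fun n => ⟨fun v _ => by simpa using (Q n v).norm_axis,
      fun v _ => ⟨(Q n v).radius_pos.le, (Q n v).radius_lt_pi.le⟩, hangle n⟩)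
  obtain ⟨hc, hr, hΘK⟩ := hmem
  have hΘ := hKW hΘK
  have hcv : ∀ v, Tendsto (fun n => (Q (φ n) v).axis) atTop (𝓝 (c v)) :=
    fun v => (tendsto_pi_nhds.1 hlim.fst_nhds) v
  have hrv : ∀ v, Tendsto (fun n => (Q (φ n) v).radius) atTop (𝓝 (r v)) :=
    fun v => (tendsto_pi_nhds.1 hlim.snd_nhds.fst_nhds) v
  have hΘe : ∀ e, Tendsto (fun n => (Q (φ n)).overlapAngles T.skeleton e) atTop (𝓝 (Θ e)) :=
    fun e => (tendsto_pi_nhds.1 hlim.snd_nhds.snd_nhds) e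
  have hcos : ∀ v, Tendsto (fun n => Real.cos (Q (φ n) v).radius) atTop (𝓝 (Real.cos (r v))) :=
    fun v => (Real.continuous_cos.tendsto _).comp (hrv v)
  have hsin : ∀ v, Tendsto (fun n => Real.sin (Q (φ n) v).radius) atTop (𝓝 (Real.sin (r v))) :=
    fun v => (Real.continuous_sin.tendsto _).comp (hrv v)
  have H : T.IsLimitPattern Θ c r :=
    { norm_center := fun v => by simpa using hc v (Set.mem_univ v)
      radius_mem := fun v => hr v (Set.mem_univ v)
      cos_angle := fun u w h => by
        refine tendsto_nhds_unique (((Real.continuous_cos.tendsto _).comp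
          (hΘe (SphereTriangulation.edge h))).mul ((hsin u).mul (hsin w)))
          ((((hcos u).mul (hcos w)).sub ((hcv u).inner (hcv w))).congr fun n => ?_)
        have h1 := SphericalDisk.inversiveDist_mem (D := Q (φ n) u) (E := Q (φ n) w) rfl
          ((hKW (hangle (φ n))).1 (SphereTriangulation.edge h))
        have h2 := (Q (φ n) u).sin_radius_pos.ne'
        have h3 := (Q (φ n) w).sin_radius_pos.ne'
        rw [SphericalDisk.inversiveDist, SphericalDisk.cos_sphericalDist,
          div_eq_iff (mul_ne_zero h2 h3)] at h1
        exact h1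
      radius_add_le := fun u w huw h => by
        refine le_of_tendsto_of_tendsto' ((hrv u).add (hrv w))
          ((Real.continuous_arccos.tendsto _).comp ((hcv u).inner (hcv w))) fun n => ?_
        have h1 : ¬ ((Q (φ n) u).toSet ∩ (Q (φ n) w).toSet).Nonempty := by
          intro hne
          apply h
          rw [← hcontact (φ n)]
          exact ⟨huw, hne⟩
        rw [SphericalDisk.inter_nonempty_iff] at h1
        exact (not_le.1 h1).le }
  have hrt : ∀ v ∈ t, r v = Real.pi / 2 := by
    intro v hv
    refine tendsto_nhds_unique (hrv v) (tendsto_const_nhds.congr fun n => ?_)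
    exact (hface (φ n) v hv).symm
  have hr' := H.radius_mem_Ioo hΘ ht hrt
  have hcov : ∀ x : Mink, 0 < x.2 → x.2 ≤ ‖x.1‖ →
      ∃ v, x.2 * Real.cos (r v) ≤ inner ℝ (c v) x.1 := by
    intro x hx0 hx
    by_contra hcon
    push Not at hcon
    have hev : ∀ᶠ n in atTop, ∀ v,
        inner ℝ (Q (φ n) v).axis x.1 < x.2 * Real.cos (Q (φ n) v).radius := by
      rw [eventually_all]
      exact fun v => ((hcv v).inner tendsto_const_nhds).eventually_lt
        (tendsto_const_nhds.mul (hcos v)) (hcon v)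
    obtain ⟨n, hn⟩ := hev.exists
    obtain ⟨v, hv⟩ := exists_lor_pos hV (hirr (φ n)) (hcontact (φ n)) (hKW (hangle (φ n))) hx0 hx
    rw [SphericalDisk.lor_vec, lt_div_iff₀ (Q (φ n) v).sin_radius_pos] at hv
    linarith [hn v]
  have hlt := fun u w => H.radius_add_lt hΘ hV hr' hcov (u := u) (w := w)
  choose z hz using fun v => exists_toUnitSphere_eq (H.norm_center v)
  refine ⟨φ, fun v => ⟨z v, r v, (hr' v).1, (hr' v).2⟩, hφ, ?_, ?_, ?_⟩
  · intro v
    exact ⟨tendsto_of_tendsto_toUnitSphere (by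
      have h := hcv v
      rw [← hz v] at h
      exact h), hrv v⟩
  · apply irreducible_of_forall
    intro u
    have hex : ∀ n, ∃ y, ∀ v, v ≠ u → y ∉ (Q n v).toSet := by
      intro n
      have hss : {v | v ≠ u} ⊂ Set.univ :=
        Set.ssubset_univ_iff.2 ((Set.ne_univ_iff_exists_notMem _).2 ⟨u, fun h => h rfl⟩)
      obtain ⟨y, hy⟩ := (Set.ne_univ_iff_exists_notMem _).1 (hirr n _ hss).ne
      refine ⟨y, fun v hv hyv => hy ?_⟩
      simp only [Set.mem_iUnion]
      exact ⟨v, hv, hyv⟩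
    choose y hy using hex
    obtain ⟨ξ, hξ, ψ, hψ, hξlim⟩ := (isCompact_sphere (0 : E3) 1).tendsto_subseq
      (x := fun n => toUnitSphere (y (φ n))) (fun n => by simpa using norm_toUnitSphere _)
    obtain ⟨q, hq, hqv⟩ := H.exists_uncovered hΘ hr' hlt u (ξ := ξ) (by simpa using hξ) (by
      intro v hv
      refine le_of_tendsto_of_tendsto' (((hcv v).comp hψ.tendsto_atTop).inner hξlim)
        ((hcos v).comp hψ.tendsto_atTop) fun n => ?_
      have := hy (φ (ψ n)) v hv
      rw [SphericalDisk.mem_toSet_iff, not_le] at this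
      exact this.le)
    obtain ⟨x, rfl⟩ := exists_toUnitSphere_eq hq
    refine ⟨x, fun v hv => ?_⟩
    rw [SphericalDisk.mem_toSet_iff, not_le]
    simpa only [SphericalDisk.axis, hz] using hqv v hv
  · ext u w
    simp only [contactGraph, SphericalDisk.inter_nonempty_iff, SphericalDisk.axis, hz]
    constructor
    · rintro ⟨huw, h⟩
      by_contra hn
      exact (hlt u w huw hn).not_ge h
    · intro h
      refine ⟨h.ne, ?_⟩
      by_contra hcon
      push Not at hcon
      have h1 := H.cos_angle u w h
      have h2 := abs_cos_lt_one (hΘ.1 (SphereTriangulation.edge h))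
      have h3 := mul_pos (Real.sin_pos_of_mem_Ioo (hr' u)) (Real.sin_pos_of_mem_Ioo (hr' w))
      have h4 := Real.cos_le_cos_of_nonneg_of_le_pi (by linarith [(hr' u).1, (hr' w).1])
        (Real.arccos_le_pi _) hcon.le
      rw [cos_arccos_inner (H.norm_center u) (H.norm_center w), Real.cos_add] at h4
      nlinarith

end CirclePattern

theorem theorem1p5 {V : Type*} [Fintype V] [DecidableEq V] (T : SphereTriangulation V)
    (hV : 4 < Fintype.card V) (P : ℕ → CirclePattern V)
    (hirr : ∀ n, (P n).Irreducible)
    (hcontact : ∀ n, (P n).contactGraph = T.skeleton)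
    (K : Set (T.skeleton.edgeSet → ℝ)) (hK : IsCompact K) (hKW : K ⊆ T.W)
    (hangle : ∀ n, (P n).overlapAngles T.skeleton ∈ K) :
    ∃ (φ : ℕ → ℕ) (f : ℕ → OnePoint ℂ → OnePoint ℂ) (Q : ℕ → CirclePattern V)
      (P' : CirclePattern V),
      StrictMono φ ∧
      (∀ n, IsMobiusOrAntiMobius (f n)) ∧
      (∀ n v, (Q n v).toSet = f n '' (P (φ n) v).toSet) ∧
      CirclePattern.ConvergesTo Q P' ∧
      P'.Irreducible ∧
      P'.contactGraph = T.skeleton := by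
  obtain ⟨v⟩ : Nonempty V := Fintype.card_pos_iff.1 (by omega)
  obtain ⟨t, ht, -⟩ := T.vertex_mem v
  -- move the hyperbolic point of the face `t` to the origin
  choose p hp hpt _ using fun n => CirclePattern.exists_vertex (hKW (hangle n)) ht
  choose f F hmob hinj himg hlor hhemi using fun n => exists_normalizing_map (hp n)
  obtain ⟨φ, P', hφ, hconv, hirr', hcontact'⟩ := CirclePattern.exists_convergent_subsequence T hV
    (fun n v => F n (P n v))
    (fun n => CirclePattern.irreducible_of_image (hinj n) (fun v => himg n (P n v)) (hirr n))
    (fun n => (CirclePattern.contactGraph_eq_of_image (hinj n)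
      (fun v => himg n (P n v))).trans (hcontact n)) hK hKW
    (fun n => (CirclePattern.overlapAngles_eq_of_lor (P := P n)
      (fun u w => hlor n _ _) T.skeleton).symm ▸ hangle n) ht
    (fun n v hv => hhemi n _ (hpt n v hv))
  exact ⟨φ, fun n => f (φ n), fun n v => F (φ n) (P (φ n) v), P', hφ, fun n => hmob _,
    fun n v => himg _ _, hconv, hirr', hcontact'⟩
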